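/- Let $d\ge 1$, $\mathcal X=[0,1]^d$, $\mathcal P=[0,1]$, with all balls closed and taken in the $\ell_\infty$-norm inside these sets. A dynamic pricing problem $I$ consists of a target covariate law $Q_X$ on $\mathcal X$, a joint law $\mu$ of source covariate-price pairs on $\mathcal X\times\mathcal P$ with covariate marginal $P_X$, and a conditional law on $[0,1]$ of the revenue $Y$ given covariate and price, common to source and target, with mean $f(x,p)=\mathbb E[Y\mid x,p]$. The seller has $n_P\ge 0$ independent source triplets $(X^P_t,p^P_t,Y^P_t)$. At each target step $t=1,\dots,n_Q$ (with $n_Q\ge 1$) a fresh covariate $X_t\sim Q_X$ is observed, a price $p_t^\pi$ is set by a (possibly randomized) policy $\pi$ that depends measurably on the source data, the past target data and $X_t$, and a revenue $Y_t$ with mean $f(X_t,p_t^\pi)$ is received. The regret is $R_{\pi,I}(n_Q)=\sum_{t=1}^{n_Q}\mathbb E\{\max_{p\in\mathcal P}f(X_t,p)-f(X_t,p_t^\pi)\}$. Let $C_{\mathrm{Lip}}>0$, $0<c_\gamma\le 1$, $0<c_Q\le 1$, $0\le\gamma<\infty$, $0\le\kappa\le 1$, and let $\mathcal I(\gamma,c_\gamma,\kappa,C_{\mathrm{Lip}},c_Q)$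 be the class of problems such that: (a) $\gamma$ is the transfer exponent of $P_X$ with respect to $Q_X$, i.e. the infimum of all $\gamma'\ge 0$ for which some $c'\in(0,1]$ satisfies $P_X(B(x,r))\ge c' r^{\gamma'}Q_X(B(x,r))$ for all $x\in\mathrm{supp}(Q_X)$, $r\in(0,1]$; and this inequality holds for $\gamma'=\gamma$ with $c'=c_\gamma$; (b) the exploration coefficient $$\inf_{x\in\mathrm{supp}(P_X),\ r\in(0,1/2],\ p\in[r,1-r]}\frac{\mu\big(B(x,r)\times[p-r,p+r]\big)}{2r\,P_X(B(x,r))}$$ equals $\kappa$; (c) $|f(z_1)-f(z_2)|\le C_{\mathrm{Lip}}\|z_1-z_2\|_\infty$ for all $z_1,z_2\in\mathcal X\times\mathcal P$; (d) there is a constant $C_Q>c_Q$ with $c_Q r^d\le Q_X(B(x,r))\le C_Q r^d$ for all $x\in\mathrm{supp}(Q_X)$, $r\in(0,1]$. Then there is a constant $c>0$ depending only on $C_{\mathrm{Lip}}$, $c_\gamma$ and $c_Q$ such that, for all such $d,n_P,n_Q,\gamma,\kappa$, $$\inf_\pi\ \sup_{I\in\mathcal I(\gamma,c_\gamma,\kappa,C_{\mathrm{Lip}},c_Q)}R_{\pi,I}(n_Q)\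 \ge\ c\,n_Q\Big(n_Q+(\kappa n_P)^{\frac{d+3}{d+3+\gamma}}\Big)^{-\frac1{d+3}}.$$ -/

import Mathlib

open MeasureTheory ProbabilityTheory
open scoped ENNReal

noncomputable section

namespace DynamicPricing

/-- The covariate space `[0, 1]^d`, with the distance of the `ℓ_∞`-norm. -/
abbrev Cov (d : ℕ) : Type := Fin d → unitInterval

/-- The price space `[0, 1]`. -/
abbrev Price : Type := unitInterval

/-- One observation: covariate, price and revenue in `[0, 1]`. The covariate-price space
`Cov d × Price` carries the maximum distance, which is that of the `ℓ_∞`-norm. -/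
abbrev Obs (d : ℕ) : Type := (Cov d × Price) × unitInterval

/-- A dynamic pricing problem with covariate shift: the law of the target covariates, the joint law
of the source covariate-price pairs, and the conditional law of the revenue given covariate and
price, which is common to source and target. -/
structure Problem (d : ℕ) where
  /-- law of a target covariate -/
  targetCov : Measure (Cov d)
  /-- joint law of a source covariate-price pair -/
  sourcePair : Measure (Cov d × Price)
  /-- conditional law of the revenue given covariate and price -/
  revenue : Kernel (Cov d × Price) unitInterval
  [isProb_targetCov : IsProbabilityMeasure targetCov]
  [isProb_sourcePair : IsProbabilityMeasure sourcePair]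
  [isMarkov_revenue : IsMarkovKernel revenue]

attribute [instance] Problem.isProb_targetCov Problem.isProb_sourcePair Problem.isMarkov_revenue

/-- The marginal law of the source covariates. -/
def Problem.sourceCov {d : ℕ} (I : Problem d) : Measure (Cov d) := I.sourcePair.fst

/-- The reward function `f(x, p)`, the conditional mean of the revenue. -/
def Problem.reward {d : ℕ} (I : Problem d) (z : Cov d × Price) : ℝ :=
  ∫ y, (y : ℝ) ∂(I.revenue z)

/-- The maximal expected revenue `f*(x)`, the maximum over all prices `p` of `f(x, p)`. -/
def Problem.optReward {d : ℕ} (I : Problem d) (x : Cov d) : ℝ :=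
  ⨆ p : Price, I.reward (x, p)

/-- Lipschitz continuity of the reward function with constant `L` in the `ℓ_∞`-distance. -/
def Problem.LipschitzReward {d : ℕ} (I : Problem d) (L : ℝ) : Prop :=
  ∀ z₁ z₂ : Cov d × Price, |I.reward z₁ - I.reward z₂| ≤ L * dist z₁ z₂

/-- The mass of a ball of radius `r ≤ 1` centred in the support is of order `r ^ d`, with lower
constant `cQ`. -/
def BallMassCondition {d : ℕ} (Q : Measure (Cov d)) (cQ : ℝ) : Prop :=
  ∃ CQ : ℝ, cQ < CQ ∧ ∀ x ∈ Q.support, ∀ r ∈ Set.Ioc (0 : ℝ) 1,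
    cQ * r ^ d ≤ Q.real (Metric.closedBall x r) ∧ Q.real (Metric.closedBall x r) ≤ CQ * r ^ d

/-- `P(B(x, r)) ≥ c r^g Q(B(x, r))` for all `x` in the support of `Q` and all `0 < r ≤ 1`. -/
def TransferBound {d : ℕ} (P Q : Measure (Cov d)) (g c : ℝ) : Prop :=
  ∀ x ∈ Q.support, ∀ r ∈ Set.Ioc (0 : ℝ) 1,
    c * r ^ g * Q.real (Metric.closedBall x r) ≤ P.real (Metric.closedBall x r)

/-- The transfer exponent of `P` with respect to `Q`, an element of `[0, ∞]`. -/
def transferExponent {d : ℕ} (P Q : Measure (Cov d)) : ℝ≥0∞ :=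
  sInf {e : ℝ≥0∞ | ∃ g : ℝ, 0 ≤ g ∧ e = ENNReal.ofReal g ∧
    ∃ c : ℝ, 0 < c ∧ c ≤ 1 ∧ TransferBound P Q g c}

/-- The exploration coefficient of the joint law `μ` of the source covariate-price pairs. -/
def explorationCoeff {d : ℕ} (μ : Measure (Cov d × Price)) : ℝ :=
  sInf {a : ℝ | ∃ x ∈ μ.fst.support, ∃ r ∈ Set.Ioc (0 : ℝ) (1 / 2), ∃ p : Price,
    (p : ℝ) ∈ Set.Icc r (1 - r) ∧
    a = μ.real (Metric.closedBall x r ×ˢ Metric.closedBall p r) /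
      (2 * r * μ.fst.real (Metric.closedBall x r))}

/-- The class of problems with transfer exponent `γ` (with constant `cγ`), exploration
coefficient `κ`, Lipschitz constant `L` and lower target constant `cQ`. -/
structure InClass {d : ℕ} (γ cγ κ L cQ : ℝ) (I : Problem d) : Prop where
  transfer_eq : transferExponent I.sourceCov I.targetCov = ENNReal.ofReal γ
  transfer_bound : TransferBound I.sourceCov I.targetCov γ cγ
  exploration : explorationCoeff I.sourcePair = κ
  lipschitz : I.LipschitzReward L
  ballMass : BallMassCondition I.targetCov cQ

/-- What has been seen after `t` target steps: the `nP` source triplets, followed by the first `t`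
target triplets. -/
def Hist (d nP : ℕ) : ℕ → Type
  | 0 => Fin nP → Obs d
  | t + 1 => Hist d nP t × Obs d

/-- The product σ-algebra on histories. -/
instance instMeasurableSpaceHist (d nP : ℕ) : (t : ℕ) → MeasurableSpace (Hist d nP t)
  | 0 => inferInstanceAs (MeasurableSpace (Fin nP → Obs d))
  | t + 1 =>
    letI := instMeasurableSpaceHist d nP t
    inferInstanceAs (MeasurableSpace (Hist d nP t × Obs d))

/-- An admissible price policy: the price at step `t + 1` is drawn from a law that depends
measurably on the source data, the past target data and the current covariate. Non-randomized
policies are the ones whose kernels are deterministic. -/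
structure Policy (d nP : ℕ) where
  /-- conditional law of the next price given the history and the current covariate -/
  price : (t : ℕ) → Kernel (Hist d nP t × Cov d) Price
  [isMarkov_price : ∀ t, IsMarkovKernel (price t)]

attribute [instance] Policy.isMarkov_price

/-- Conditional law of the next target triplet given the history: a fresh covariate, a price
from the policy, and a revenue. -/
def Problem.step {d nP : ℕ} (I : Problem d) (π : Policy d nP) (t : ℕ) :
    Kernel (Hist d nP t) (Obs d) :=
  (Kernel.const (Hist d nP t) I.targetCov ⊗ₖ π.price t) ⊗ₖ
    Kernel.prodMkLeft (Hist d nP t) I.revenue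

/-- Joint law of the source data (independent triplets) and the first `t` target triplets. -/
def Problem.law {d nP : ℕ} (I : Problem d) (π : Policy d nP) : (t : ℕ) → Measure (Hist d nP t)
  | 0 => Measure.pi (fun _ : Fin nP => I.sourcePair ⊗ₘ I.revenue)
  | t + 1 => I.law π t ⊗ₘ I.step π t

/-- The cumulative regret of the policy `π` over `nQ` target steps. -/
def Problem.regret {d nP : ℕ} (I : Problem d) (π : Policy d nP) (nQ : ℕ) : ℝ :=
  ∑ t ∈ Finset.range nQ,
    ∫ h : Hist d nP t × Obs d, (I.optReward h.2.1.1 - I.reward h.2.1) ∂(I.law π (t + 1))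

/-- The minimax regret over `nQ` target steps with `nP` source triplets, in the extended reals. -/
def minimaxRegret (d nP nQ : ℕ) (γ cγ κ L cQ : ℝ) : EReal :=
  ⨅ π : Policy d nP, ⨆ I : {I : Problem d // InClass γ cγ κ L cQ I},
    ((I.1.regret π nQ : ℝ) : EReal)

end DynamicPricing

end

/-! The lower bound comes from running one bandit problem with `M` arms in each of `M ^ d` cells. In
units of `1 / (16 M)` the cells along each axis are the intervals `[8 j, 8 j + 1]`, and the target
law is uniform on the product cells, each of mass `q = M ^ (-d)`. The mean revenue is `1 / 2`,
except for one bump per product cell of height `L / (8 M)`, centred at the corner of the cell and at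
one of `M` prices with disjoint neighbourhoods. Inside a cell, missing the bump costs at least `L /
(16 M)`. A policy that finds the bumps in at most half of its visits therefore has regret at least
`nQ * L / (32 M)`.

To find the bump of a cell, a policy must distinguish the problem from the one with this bump
removed. The relative entropy of the two data laws is at most `4 (L / (8 M)) ^ 2` times the expected
number of observations in the support of the bump. Averaged over the `M` prices, the target steps
supply at most `nQ * q / M` such observations. Source prices are uniform with probability `κ` and
otherwise `0`, where no bump lives. The source covariate law keeps only a fraction `A = (16 / M) ^
γ` of the mass of each cell in the first coordinate. So the source supplies at most `κ * nP * A * q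
/ (4 M)` observations. Both numbers are harmless once `nQ` and `κ * nP * A` are at most `M ^ (d + 3)
/ 4`. By `exists_cell_number` this holds for an `M` of order `(nQ + (κ nP) ^ ((d+3)/(d+3+γ))) ^
(1/(d+3))`, which is the rate.

The source law must have transfer exponent exactly `γ`, and the transfer inequality must hold with
constant `1` so that every `cγ ≤ 1` is covered. The mass removed from a cell is put on an atom
between the cells, out of reach of the bumps, and the mass that stays is warped so that it thins out
at the left end of the cell. The heart of this construction is `rpow_mul_cellSum_le`. The
statistical half rests on the change of measure `IsLikelihoodRatio.integral_law_le`, the averaging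
over one bump in `sum_law_bumpSet_le` and the averaging over all bumps in `exists_regret_ge`. -/

noncomputable section

namespace DynamicPricing

/-! ### Likelihood ratios, relative entropy and change of measure -/

section Likelihood

lemma _root_.MeasureTheory.Integrable.integral_compProd_measure {α β : Type*}
    [MeasurableSpace α] [MeasurableSpace β] {μ : Measure α} [SFinite μ] {κ : Kernel α β}
    [IsSFiniteKernel κ] {f : α × β → ℝ} (hf : Integrable f (μ ⊗ₘ κ)) :
    Integrable (fun a => ∫ b, f (a, b) ∂(κ a)) μ := by
  simpa using MeasureTheory.Integrable.integral_compProd (κ := Kernel.const Unit μ) (a := ())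
    (η := Kernel.prodMkLeft Unit κ) hf

lemma abs_sq_sub_one_mul_le (y : ℝ) {β : ℝ} (hβ : 0 < β) :
    |y ^ 2 - 1| * (4 * β) ≤ (2 * β * (y - 1)) ^ 2 + (y + 1) ^ 2 := by
  have h4 : (0 : ℝ) < 4 * β := by positivity
  rw [← abs_of_pos h4, ← abs_mul, abs_le]
  constructor
  · nlinarith [sq_nonneg (2 * β * (y - 1) + (y + 1))]
  · nlinarith [sq_nonneg (2 * β * (y - 1) - (y + 1))]

lemma pi_eq_withDensity_prod {ι α : Type*} [Fintype ι] [MeasurableSpace α] (μ ν : Measure α)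
    [IsProbabilityMeasure μ] [IsProbabilityMeasure ν] {ℓ : α → ℝ} (hℓ : Measurable ℓ)
    (h0 : ∀ x, 0 ≤ ℓ x) {C : ℝ} (hC : ∀ x, ℓ x ≤ C)
    (h : ν = μ.withDensity fun x => ENNReal.ofReal (ℓ x)) :
    Measure.pi (fun _ : ι => ν) =
      (Measure.pi fun _ : ι => μ).withDensity fun w => ENNReal.ofReal (∏ i, ℓ (w i)) := by
  refine Measure.pi_eq fun s hs => ?_
  have hint : ∀ i, Integrable ℓ (μ.restrict (s i)) := fun i =>
    Integrable.of_bound hℓ.aestronglyMeasurable C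
      (.of_forall fun x => by rw [Real.norm_of_nonneg (h0 x)]; exact hC x)
  rw [withDensity_apply _ (MeasurableSet.univ_pi hs), Measure.restrict_pi_pi,
    ← ofReal_integral_eq_lintegral_ofReal (Integrable.fintype_prod_dep (f := fun _ => ℓ) hint)
      (.of_forall fun w => Finset.prod_nonneg fun i _ => h0 _),
    integral_fintype_prod_eq_prod (fun _ => ℓ),
    ENNReal.ofReal_prod_of_nonneg fun i _ => integral_nonneg h0]
  refine Finset.prod_congr rfl fun i _ => ?_
  rw [h, withDensity_apply _ (hs i), ofReal_integral_eq_lintegral_ofReal (hint i) (.of_forall h0)]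

variable {d nP : ℕ}

/-- The problems `I₀` and `I₁` differ only in their revenue laws, and `ℓ` is the density of the
second revenue law with respect to the first one. -/
structure IsLikelihoodRatio (I₀ I₁ : Problem d) (ℓ : Obs d → ℝ) : Prop where
  targetCov_eq : I₁.targetCov = I₀.targetCov
  sourcePair_eq : I₁.sourcePair = I₀.sourcePair
  measurable : Measurable ℓ
  half_le : ∀ o, 1 / 2 ≤ ℓ o
  le_two : ∀ o, ℓ o ≤ 2
  revenue_eq : ∀ z, I₁.revenue z =
    (I₀.revenue z).withDensity fun y => ENNReal.ofReal (ℓ (z, y))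

/-- The likelihood ratio of a history. -/
def lik (ℓ : Obs d → ℝ) : (t : ℕ) → Hist d nP t → ℝ
  | 0 => fun w => ∏ i : Fin nP, ℓ (w i)
  | t + 1 => fun h => lik ℓ t h.1 * ℓ h.2

instance isProbabilityMeasure_law (I : Problem d) (π : Policy d nP) :
    ∀ t, IsProbabilityMeasure (I.law π t)
  | 0 => inferInstanceAs (IsProbabilityMeasure
      (Measure.pi (fun _ : Fin nP => I.sourcePair ⊗ₘ I.revenue)))
  | t + 1 => by
    have := isProbabilityMeasure_law I π t
    have : IsMarkovKernel (I.step π t) := by unfold Problem.step; infer_instance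
    exact inferInstanceAs (IsProbabilityMeasure (I.law π t ⊗ₘ I.step π t))

instance isMarkovKernel_step (I : Problem d) (π : Policy d nP) (t : ℕ) :
    IsMarkovKernel (I.step π t) := by unfold Problem.step; infer_instance

lemma measurable_lik {ℓ : Obs d → ℝ} (hℓ : Measurable ℓ) :
    ∀ t, Measurable (lik (nP := nP) ℓ t)
  | 0 => by
    have : Measurable fun w : Fin nP → Obs d => ∏ i, ℓ (w i) :=
      Finset.measurable_prod _ fun i _ => hℓ.comp (measurable_pi_apply i)
    exact this
  | t + 1 => by
    have h1 := measurable_lik hℓ t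
    have : Measurable fun h : Hist d nP t × Obs d => lik ℓ t h.1 * ℓ h.2 :=
      (h1.comp measurable_fst).mul (hℓ.comp measurable_snd)
    exact this

/-- These crude bounds serve only to make the likelihood ratio and its logarithm bounded, hence
integrable. They do not enter the rate. -/
lemma lik_bounds {ℓ : Obs d → ℝ} (h1 : ∀ o, 1 / 2 ≤ ℓ o) (h2 : ∀ o, ℓ o ≤ 2) :
    ∀ t (h : Hist d nP t), (1 / 2) ^ (nP + t) ≤ lik ℓ t h ∧ lik ℓ t h ≤ 2 ^ (nP + t)
  | 0 => fun w => by
    change (1 / 2) ^ (nP + 0) ≤ ∏ i : Fin nP, ℓ (w i) ∧ ∏ i : Fin nP, ℓ (w i) ≤ 2 ^ (nP + 0)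
    constructor
    · calc (1 / 2 : ℝ) ^ (nP + 0) = ∏ _i : Fin nP, (1 / 2 : ℝ) := by simp
        _ ≤ _ := Finset.prod_le_prod (by norm_num) fun i _ => h1 _
    · calc ∏ i : Fin nP, ℓ (w i) ≤ ∏ _i : Fin nP, (2 : ℝ) :=
          Finset.prod_le_prod (fun i _ => by linarith [h1 (w i)]) fun i _ => h2 _
        _ = _ := by simp
  | t + 1 => fun h => by
    obtain ⟨ha, hb⟩ := lik_bounds h1 h2 t h.1
    change (1 / 2) ^ (nP + t + 1) ≤ lik ℓ t h.1 * ℓ h.2 ∧ lik ℓ t h.1 * ℓ h.2 ≤ 2 ^ (nP + t + 1)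
    rw [pow_succ, pow_succ]
    have := h1 h.2
    have := h2 h.2
    have h0 : (0 : ℝ) < (1 / 2) ^ (nP + t) := by positivity
    constructor
    · gcongr
      exact h0.le.trans ha
    · gcongr

lemma lik_pos {ℓ : Obs d → ℝ} (h1 : ∀ o, 1 / 2 ≤ ℓ o) (h2 : ∀ o, ℓ o ≤ 2) (t : ℕ)
    (h : Hist d nP t) : 0 < lik ℓ t h :=
  lt_of_lt_of_le (by positivity) (lik_bounds h1 h2 t h).1

namespace IsLikelihoodRatio

variable {I₀ I₁ : Problem d} {ℓ : Obs d → ℝ} (hℓ : IsLikelihoodRatio I₀ I₁ ℓ)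
include hℓ

lemma measurable_ofReal : Measurable fun o => ENNReal.ofReal (ℓ o) :=
  ENNReal.measurable_ofReal.comp hℓ.measurable

lemma measurable_ofReal_mul {F : Obs d → ℝ≥0∞} (hF : Measurable F) :
    Measurable fun o => ENNReal.ofReal (ℓ o) * F o :=
  hℓ.measurable_ofReal.mul hF

lemma lintegral_revenue (z : Cov d × Price) {F : unitInterval → ℝ≥0∞} (hF : Measurable F) :
    ∫⁻ y, F y ∂(I₁.revenue z) = ∫⁻ y, ENNReal.ofReal (ℓ (z, y)) * F y ∂(I₀.revenue z) := by
  have hm : Measurable fun y => ENNReal.ofReal (ℓ (z, y)) :=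
    hℓ.measurable_ofReal.comp measurable_prodMk_left
  rw [hℓ.revenue_eq, lintegral_withDensity_eq_lintegral_mul _ hm hF]
  rfl

lemma lintegral_source {F : Obs d → ℝ≥0∞} (hF : Measurable F) :
    ∫⁻ o, F o ∂(I₁.sourcePair ⊗ₘ I₁.revenue) =
      ∫⁻ o, ENNReal.ofReal (ℓ o) * F o ∂(I₀.sourcePair ⊗ₘ I₀.revenue) := by
  rw [Measure.lintegral_compProd hF, Measure.lintegral_compProd (hℓ.measurable_ofReal_mul hF),
    hℓ.sourcePair_eq]
  refine lintegral_congr fun z => ?_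
  exact hℓ.lintegral_revenue z (hF.comp measurable_prodMk_left)

lemma source_eq : I₁.sourcePair ⊗ₘ I₁.revenue =
    (I₀.sourcePair ⊗ₘ I₀.revenue).withDensity fun o => ENNReal.ofReal (ℓ o) := by
  ext s hs
  have := hℓ.lintegral_source (F := s.indicator 1) (measurable_one.indicator hs)
  rw [lintegral_indicator_one hs] at this
  rw [this, withDensity_apply _ hs, ← lintegral_indicator hs]
  refine lintegral_congr fun o => ?_
  by_cases h : o ∈ s <;> simp [h]

/-- The covariate law and the pricing kernel are common to both problems, so they cancel and only
the revenue contributes a density. -/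
lemma lintegral_step (π : Policy d nP) (t : ℕ) (h : Hist d nP t) {F : Obs d → ℝ≥0∞}
    (hF : Measurable F) :
    ∫⁻ o, F o ∂(I₁.step π t h) = ∫⁻ o, ENNReal.ofReal (ℓ o) * F o ∂(I₀.step π t h) := by
  unfold Problem.step
  rw [Kernel.lintegral_compProd _ _ _ hF,
    Kernel.lintegral_compProd _ _ _ (hℓ.measurable_ofReal_mul hF), hℓ.targetCov_eq]
  refine lintegral_congr fun z => ?_
  simp only [Kernel.prodMkLeft_apply]
  exact hℓ.lintegral_revenue z (hF.comp measurable_prodMk_left)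

lemma lintegral_law (π : Policy d nP) : ∀ (t : ℕ) (F : Hist d nP t → ℝ≥0∞) (_ : Measurable F),
    ∫⁻ h, F h ∂(I₁.law π t) = ∫⁻ h, ENNReal.ofReal (lik ℓ t h) * F h ∂(I₀.law π t)
  | 0 => fun F hF => by
    have key : I₁.law π 0 = (I₀.law π 0).withDensity fun h => ENNReal.ofReal (lik ℓ 0 h) :=
      pi_eq_withDensity_prod _ _ hℓ.measurable (fun x => by linarith [hℓ.half_le x]) hℓ.le_two
        hℓ.source_eq
    have hm : Measurable fun h : Hist d nP 0 => ENNReal.ofReal (lik ℓ 0 h) :=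
      ENNReal.measurable_ofReal.comp (measurable_lik hℓ.measurable 0)
    rw [key, lintegral_withDensity_eq_lintegral_mul _ hm hF]
    rfl
  | t + 1 => fun F hF => by
    have hF' : Measurable (fun q : Hist d nP t × Obs d => F q) := hF
    have hm' : Measurable fun q : Hist d nP t × Obs d =>
        ENNReal.ofReal (lik ℓ (t + 1) q) * F q :=
      (ENNReal.measurable_ofReal.comp (measurable_lik (nP := nP) hℓ.measurable (t + 1))).mul hF'
    change ∫⁻ h : Hist d nP t × Obs d, F h ∂(I₁.law π t ⊗ₘ I₁.step π t) =
      ∫⁻ h : Hist d nP t × Obs d, ENNReal.ofReal (lik ℓ (t + 1) h) * F h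
        ∂(I₀.law π t ⊗ₘ I₀.step π t)
    rw [Measure.lintegral_compProd hF', Measure.lintegral_compProd hm',
      lintegral_law π t _ hF'.lintegral_kernel_prod_right']
    refine lintegral_congr fun h => ?_
    have hFh : Measurable fun o => F (h, o) := hF'.comp measurable_prodMk_left
    rw [hℓ.lintegral_step π t h hFh,
      ← lintegral_const_mul _ (hℓ.measurable_ofReal_mul hFh)]
    refine lintegral_congr fun o => ?_
    change _ = ENNReal.ofReal (lik ℓ t h * ℓ o) * F (h, o)
    rw [ENNReal.ofReal_mul (lik_pos hℓ.half_le hℓ.le_two t h).le, mul_assoc]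

lemma integral_law (π : Policy d nP) (t : ℕ) {F : Hist d nP t → ℝ} (hF : Measurable F)
    (h0 : ∀ h, 0 ≤ F h) :
    ∫ h, F h ∂(I₁.law π t) = ∫ h, lik ℓ t h * F h ∂(I₀.law π t) := by
  have hp := lik_pos (nP := nP) hℓ.half_le hℓ.le_two t
  rw [integral_eq_lintegral_of_nonneg_ae (.of_forall h0) hF.aestronglyMeasurable,
    integral_eq_lintegral_of_nonneg_ae (.of_forall fun h => mul_nonneg (hp h).le (h0 h))
      ((measurable_lik hℓ.measurable t).mul hF).aestronglyMeasurable,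
    hℓ.lintegral_law π t _ hF.ennreal_ofReal]
  simp only [ENNReal.ofReal_mul (hp _).le]

lemma abs_log_le (o : Obs d) : |Real.log (ℓ o)| ≤ Real.log 2 := by
  have h1 := hℓ.half_le o
  have h2 := hℓ.le_two o
  rw [abs_le]
  constructor
  · rw [← Real.log_inv]
    exact Real.log_le_log (by norm_num) (by linarith)
  · exact Real.log_le_log (by linarith) h2

lemma integrable_log (μ : Measure (Obs d)) [IsFiniteMeasure μ] :
    Integrable (fun o => Real.log (ℓ o)) μ :=
  Integrable.of_bound (Real.measurable_log.comp hℓ.measurable).aestronglyMeasurable (Real.log 2)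
    (.of_forall fun o => by rw [Real.norm_eq_abs]; exact hℓ.abs_log_le o)

lemma abs_log_lik_le (t : ℕ) (h : Hist d nP t) :
    |Real.log (lik ℓ t h)| ≤ (nP + t : ℕ) * Real.log 2 := by
  obtain ⟨h1, h2⟩ := lik_bounds hℓ.half_le hℓ.le_two t h
  have hp := lik_pos hℓ.half_le hℓ.le_two t h
  rw [abs_le]
  constructor
  · have := Real.log_le_log (by positivity) h1
    rw [Real.log_pow, one_div, Real.log_inv] at this
    linarith
  · have := Real.log_le_log hp h2
    rwa [Real.log_pow] at this

lemma measurable_log_lik (t : ℕ) : Measurable fun h : Hist d nP t => Real.log (lik ℓ t h) :=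
  Real.measurable_log.comp (measurable_lik hℓ.measurable t)

lemma integrable_log_lik (t : ℕ) (μ : Measure (Hist d nP t)) [IsFiniteMeasure μ] :
    Integrable (fun h => Real.log (lik ℓ t h)) μ :=
  Integrable.of_bound (hℓ.measurable_log_lik t).aestronglyMeasurable _
    (.of_forall fun h => by rw [Real.norm_eq_abs]; exact hℓ.abs_log_lik_le t h)

lemma integrable_lik (t : ℕ) (μ : Measure (Hist d nP t)) [IsFiniteMeasure μ] :
    Integrable (lik ℓ t) μ :=
  Integrable.of_bound (measurable_lik hℓ.measurable t).aestronglyMeasurable (2 ^ (nP + t))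
    (.of_forall fun h => by
      rw [Real.norm_of_nonneg (lik_pos hℓ.half_le hℓ.le_two t h).le]
      exact (lik_bounds hℓ.half_le hℓ.le_two t h).2)

lemma integral_lik (π : Policy d nP) (t : ℕ) : ∫ h, lik ℓ t h ∂(I₀.law π t) = 1 := by
  have := hℓ.integral_law π t (F := fun _ => 1) measurable_const fun _ => zero_le_one
  simpa using this.symm

/-- If the conditional relative entropy of the revenue laws is at most `ε` on `B` and vanishes
elsewhere, then a source triplet contributes at most `ε` times the mass of `B`. -/
lemma integral_neg_log_source_le {B : Set (Cov d × Price)} (hB : MeasurableSet B) {ε : ℝ}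
    (hkl : ∀ z, ∫ y, -Real.log (ℓ (z, y)) ∂(I₀.revenue z) ≤ B.indicator (fun _ => ε) z) :
    ∫ o, -Real.log (ℓ o) ∂(I₀.sourcePair ⊗ₘ I₀.revenue) ≤ ε * I₀.sourcePair.real B := by
  have hint := (hℓ.integrable_log (I₀.sourcePair ⊗ₘ I₀.revenue)).neg
  have h1 := Measure.integral_compProd hint
  simp only [Pi.neg_apply] at h1
  rw [h1]
  refine (integral_mono hint.integral_compProd_measure ((integrable_const ε).indicator hB)
    hkl).trans_eq ?_
  rw [integral_indicator_const _ hB, smul_eq_mul, mul_comm]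

lemma integral_neg_log_step_le (π : Policy d nP) (t : ℕ) (h : Hist d nP t)
    {B : Set (Cov d × Price)} (hB : MeasurableSet B) {ε : ℝ}
    (hkl : ∀ z, ∫ y, -Real.log (ℓ (z, y)) ∂(I₀.revenue z) ≤ B.indicator (fun _ => ε) z) :
    ∫ o, -Real.log (ℓ o) ∂(I₀.step π t h) ≤
      ∫ o, (Prod.fst ⁻¹' B).indicator (fun _ => ε) o ∂(I₀.step π t h) := by
  have hint := (hℓ.integrable_log (I₀.step π t h)).neg
  have hint' : Integrable ((Prod.fst ⁻¹' B : Set (Obs d)).indicator (fun _ => ε))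
      (I₀.step π t h) := (integrable_const ε).indicator (measurable_fst hB)
  unfold Problem.step at hint hint' ⊢
  have h1 := ProbabilityTheory.integral_compProd hint
  have h2 := ProbabilityTheory.integral_compProd hint'
  simp only [Pi.neg_apply] at h1
  rw [h1, h2]
  refine integral_mono hint.integral_compProd hint'.integral_compProd fun z => ?_
  simp only [Kernel.prodMkLeft_apply]
  refine (hkl z).trans_eq ?_
  by_cases hz : z ∈ B <;> simp [Set.indicator, hz]

/-- The relative entropy of the two laws of the first `t` observations. -/
lemma integral_neg_log_lik_le (π : Policy d nP) {B : Set (Cov d × Price)} (hB : MeasurableSet B)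
    {ε : ℝ} (hkl : ∀ z, ∫ y, -Real.log (ℓ (z, y)) ∂(I₀.revenue z) ≤ B.indicator (fun _ => ε) z) :
    ∀ t, ∫ h, -Real.log (lik ℓ t h) ∂(I₀.law π t) ≤ ε * (nP * I₀.sourcePair.real B +
      ∑ s ∈ Finset.range t,
        (I₀.law π (s + 1)).real {h : Hist d nP s × Obs d | h.2.1 ∈ B})
  | 0 => by
    have hl : ∀ w : Fin nP → Obs d, -Real.log (lik ℓ 0 w) = ∑ i, -Real.log (ℓ (w i)) := by
      intro w
      change -Real.log (∏ i, ℓ (w i)) = _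
      rw [Real.log_prod fun i _ => by linarith [hℓ.half_le (w i)], Finset.sum_neg_distrib]
    have hi := hℓ.integrable_log (I₀.sourcePair ⊗ₘ I₀.revenue)
    change ∫ w : Fin nP → Obs d, -Real.log (lik ℓ 0 w)
      ∂(Measure.pi fun _ : Fin nP => I₀.sourcePair ⊗ₘ I₀.revenue) ≤ _
    simp only [hl]
    have hi' : ∀ i : Fin nP, Integrable (fun w : Fin nP → Obs d => -Real.log (ℓ (w i)))
        (Measure.pi fun _ : Fin nP => I₀.sourcePair ⊗ₘ I₀.revenue) := fun i =>
      integrable_comp_eval (μ := fun _ : Fin nP => I₀.sourcePair ⊗ₘ I₀.revenue)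
        (f := fun o => -Real.log (ℓ o)) hi.neg
    rw [integral_finsetSum _ fun i _ => hi' i]
    have := hℓ.integral_neg_log_source_le hB hkl
    calc _ = ∑ _i : Fin nP, ∫ o, -Real.log (ℓ o) ∂(I₀.sourcePair ⊗ₘ I₀.revenue) :=
          Finset.sum_congr rfl fun i _ =>
            integral_comp_eval (μ := fun _ : Fin nP => I₀.sourcePair ⊗ₘ I₀.revenue)
              (i := i) (f := fun o => -Real.log (ℓ o)) hi.neg.aestronglyMeasurable
      _ ≤ ∑ _i : Fin nP, ε * I₀.sourcePair.real B := Finset.sum_le_sum fun _ _ => this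
      _ = _ := by simp; ring
  | t + 1 => by
    have ih := integral_neg_log_lik_le π hB hkl t
    have hE : MeasurableSet {h : Hist d nP t × Obs d | h.2.1 ∈ B} :=
      (measurable_fst.comp measurable_snd) hB
    have hl : ∀ q : Hist d nP t × Obs d,
        -Real.log (lik ℓ (t + 1) q) = -Real.log (lik ℓ t q.1) + -Real.log (ℓ q.2) := by
      intro q
      change -Real.log (lik ℓ t q.1 * ℓ q.2) = _
      rw [Real.log_mul (lik_pos hℓ.half_le hℓ.le_two t q.1).ne'
        (by linarith [hℓ.half_le q.2])]
      ring
    have hi1 : Integrable (fun q : Hist d nP t × Obs d => -Real.log (lik ℓ t q.1))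
        (I₀.law π t ⊗ₘ I₀.step π t) :=
      Integrable.of_bound
        ((hℓ.measurable_log_lik t).comp measurable_fst).neg.aestronglyMeasurable _
        (.of_forall fun q => by
          rw [norm_neg, Real.norm_eq_abs]; exact hℓ.abs_log_lik_le t q.1)
    have hi2 : Integrable (fun q : Hist d nP t × Obs d => -Real.log (ℓ q.2))
        (I₀.law π t ⊗ₘ I₀.step π t) :=
      Integrable.of_bound
        ((Real.measurable_log.comp hℓ.measurable).comp measurable_snd).neg.aestronglyMeasurable _
        (.of_forall fun q => by
          rw [norm_neg, Real.norm_eq_abs]; exact hℓ.abs_log_le q.2)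
    have hi3 : Integrable ({h : Hist d nP t × Obs d | h.2.1 ∈ B}.indicator fun _ => ε)
        (I₀.law π t ⊗ₘ I₀.step π t) := (integrable_const ε).indicator hE
    have hs : ∫ q : Hist d nP t × Obs d, -Real.log (ℓ q.2) ∂(I₀.law π t ⊗ₘ I₀.step π t) ≤
        ε * (I₀.law π (t + 1)).real {h : Hist d nP t × Obs d | h.2.1 ∈ B} := by
      calc _ = ∫ h, ∫ o, -Real.log (ℓ o) ∂(I₀.step π t h) ∂(I₀.law π t) :=
            Measure.integral_compProd hi2
        _ ≤ ∫ h, ∫ o, {h : Hist d nP t × Obs d | h.2.1 ∈ B}.indicator (fun _ => ε) (h, o)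
              ∂(I₀.step π t h) ∂(I₀.law π t) :=
            integral_mono hi2.integral_compProd_measure hi3.integral_compProd_measure fun h =>
              hℓ.integral_neg_log_step_le π t h hB hkl
        _ = ∫ q, {h : Hist d nP t × Obs d | h.2.1 ∈ B}.indicator (fun _ => ε) q
              ∂(I₀.law π t ⊗ₘ I₀.step π t) := (Measure.integral_compProd hi3).symm
        _ = _ := by
            rw [integral_indicator_const _ hE, smul_eq_mul, mul_comm]; rfl
    change ∫ q : Hist d nP t × Obs d, -Real.log (lik ℓ (t + 1) q)
      ∂(I₀.law π t ⊗ₘ I₀.step π t) ≤ _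
    simp only [hl]
    rw [integral_add hi1 hi2, Finset.sum_range_succ]
    have h1 : ∫ q : Hist d nP t × Obs d, -Real.log (lik ℓ t q.1) ∂(I₀.law π t ⊗ₘ I₀.step π t) =
        ∫ h, -Real.log (lik ℓ t h) ∂(I₀.law π t) := by
      rw [Measure.integral_compProd hi1]
      simp
    rw [h1]
    linarith

omit hℓ in
-- With `y = √x`, weighted AM-GM splits `|x - 1| = |y - 1| (y + 1)` into `β (y - 1) ^ 2 + (y + 1) ^
-- 2 / (4 β)`. Then `log y ≤ y - 1` gives `(y - 1) ^ 2 ≤ x - 1 - log x`, and `(y + 1) ^ 2 ≤ 2 (x +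
-- 1)`. The result is a Pinsker-type bound that is linear in the relative entropy, so it can later
-- be summed over the arms without Cauchy-Schwarz.
lemma sub_one_mul_le {x β b m : ℝ} (hx : 0 < x) (hβ : 0 < β) (hb : 0 ≤ b) (hbm : b ≤ m) :
    (x - 1) * b ≤ m * (β * (x - 1 - Real.log x) + (x + 1) / (2 * β)) := by
  have hs := Real.sqrt_pos.2 hx
  have hsq := Real.sq_sqrt hx.le
  have hlog := Real.log_le_sub_one_of_pos hs
  rw [Real.log_sqrt hx.le] at hlog
  set y := Real.sqrt x
  have h1 : (y - 1) ^ 2 ≤ x - 1 - Real.log x := by nlinarith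
  have h2 : |x - 1| ≤ β * (x - 1 - Real.log x) + (x + 1) / (2 * β) := by
    have h3 : |x - 1| ≤ β * (y - 1) ^ 2 + (y + 1) ^ 2 / (4 * β) := by
      have e : β * (y - 1) ^ 2 + (y + 1) ^ 2 / (4 * β) =
          ((2 * β * (y - 1)) ^ 2 + (y + 1) ^ 2) / (4 * β) := by field_simp; ring
      rw [e, le_div_iff₀ (by positivity), ← hsq]
      exact abs_sq_sub_one_mul_le y hβ
    have h4 : (y + 1) ^ 2 / (4 * β) ≤ (x + 1) / (2 * β) := by
      rw [div_le_div_iff₀ (by positivity) (by positivity), ← hsq]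
      nlinarith [mul_nonneg hβ.le (sq_nonneg (y - 1))]
    nlinarith
  calc (x - 1) * b ≤ |x - 1| * b := by gcongr; exact le_abs_self _
    _ ≤ |x - 1| * m := by gcongr
    _ ≤ _ := by rw [mul_comm]; exact mul_le_mul_of_nonneg_left h2 (hb.trans hbm)

/-- Change of measure: the means of a bounded statistic under the two laws differ by little when
the relative entropy is small. -/
lemma integral_law_le (π : Policy d nP) (t : ℕ) {g : Hist d nP t → ℝ} (hg : Measurable g)
    (h0 : ∀ h, 0 ≤ g h) {m : ℝ} (hm : ∀ h, g h ≤ m) {β : ℝ} (hβ : 0 < β) :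
    ∫ h, g h ∂(I₁.law π t) ≤ ∫ h, g h ∂(I₀.law π t) +
      m * (β * (∫ h, -Real.log (lik ℓ t h) ∂(I₀.law π t)) + 1 / β) := by
  have hp := lik_pos (nP := nP) hℓ.half_le hℓ.le_two t
  have hiL := hℓ.integrable_lik t (I₀.law π t)
  have hilog := hℓ.integrable_log_lik t (I₀.law π t)
  have hig : Integrable g (I₀.law π t) := Integrable.of_bound hg.aestronglyMeasurable m
    (.of_forall fun h => by rw [Real.norm_of_nonneg (h0 h)]; exact hm h)
  have hiLg : Integrable (fun h => lik ℓ t h * g h) (I₀.law π t) :=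
    Integrable.of_bound ((measurable_lik hℓ.measurable t).mul hg).aestronglyMeasurable
      (2 ^ (nP + t) * m) (.of_forall fun h => by
        rw [Real.norm_of_nonneg (mul_nonneg (hp h).le (h0 h))]
        exact mul_le_mul (lik_bounds hℓ.half_le hℓ.le_two t h).2 (hm h) (h0 h) (by positivity))
  have hbound : Integrable (fun h => m * (β * (lik ℓ t h - 1 - Real.log (lik ℓ t h)) +
      (lik ℓ t h + 1) / (2 * β))) (I₀.law π t) :=
    ((((hiL.sub (integrable_const 1)).sub hilog).const_mul β).add
      ((hiL.add (integrable_const 1)).div_const (2 * β))).const_mul m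
  -- The likelihood ratio has mean one under the first law. So the `β` term integrates to `β` times
  -- the relative entropy, and the other term to `1 / β`.
  have key := integral_mono (hiLg.sub hig) hbound fun h => by
    have := sub_one_mul_le (hp h) hβ (h0 h) (hm h)
    simp only [Pi.sub_apply]
    linarith
  simp only [Pi.sub_apply] at key
  have h1 : Integrable (fun h => lik ℓ t h - 1) (I₀.law π t) := hiL.sub (integrable_const 1)
  have h2 : Integrable (fun h => lik ℓ t h - 1 - Real.log (lik ℓ t h)) (I₀.law π t) :=
    h1.sub hilog
  have h3 : Integrable (fun h => lik ℓ t h + 1) (I₀.law π t) := hiL.add (integrable_const 1)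
  rw [integral_sub hiLg hig, integral_const_mul, integral_add (h2.const_mul β)
    (h3.div_const (2 * β)), integral_const_mul, integral_div, integral_sub h1 hilog,
    integral_sub hiL (integrable_const 1), integral_add hiL (integrable_const 1),
    hℓ.integral_lik π t] at key
  rw [hℓ.integral_law π t hg h0, integral_neg]
  simp only [integral_const, probReal_univ, smul_eq_mul, mul_one] at key
  have e : (1 + 1) / (2 * β) = 1 / β := by field_simp; norm_num
  rw [e] at key
  linarith

end IsLikelihoodRatio

end Likelihood

/-! ### Thinning out the mass of `[0, 1]` near `0` -/

section Warp

open unitInterval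

lemma volume_real_Icc (x y : I) (h : x ≤ y) :
    (volume : Measure I).real (Set.Icc x y) = y - x := by
  rw [measureReal_def, unitInterval.volume_Icc, ENNReal.toReal_ofReal (sub_nonneg.2 h)]

lemma setOf_abs_sub_le_eq_Icc (x : I) {τ : ℝ} (h0 : 0 ≤ τ) :
    ∃ a b : I, a ≤ x ∧ x ≤ b ∧ {u : I | |(u : ℝ) - x| ≤ τ} = Set.Icc a b ∧
      (a : ℝ) = max 0 (x - τ) ∧ (b : ℝ) = min 1 (x + τ) := by
  have hx0 := x.2.1
  have hx1 := x.2.2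
  refine ⟨⟨max 0 (x - τ), le_max_left _ _, max_le zero_le_one (by linarith)⟩,
    ⟨min 1 (x + τ), le_min zero_le_one (by linarith), min_le_left _ _⟩,
    max_le hx0 (by linarith), le_min hx1 (by linarith), ?_, rfl, rfl⟩
  ext u
  have hu0 := u.2.1
  have hu1 := u.2.2
  simp only [Set.mem_ofPred_eq, Set.mem_Icc, abs_le, ← Subtype.coe_le_coe, max_le_iff, le_min_iff]
  constructor
  · rintro ⟨h1, h2⟩
    exact ⟨⟨hu0, by linarith⟩, hu1, by linarith⟩
  · rintro ⟨⟨-, h1⟩, -, h2⟩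
    exact ⟨by linarith, by linarith⟩

lemma le_volume_real_abs_sub_le (x : I) {τ : ℝ} (h0 : 0 ≤ τ) (h1 : τ ≤ 1) :
    τ ≤ (volume : Measure I).real {u : I | |(u : ℝ) - x| ≤ τ} := by
  obtain ⟨a, b, hax, hxb, he, ha, hb⟩ := setOf_abs_sub_le_eq_Icc x h0
  rw [he, volume_real_Icc a b (hax.trans hxb), ha, hb]
  have hx0 := x.2.1
  have hx1 := x.2.2
  rcases max_cases 0 ((x : ℝ) - τ) with h | h <;> rcases min_cases 1 ((x : ℝ) + τ) with h' | h' <;>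
    rw [h.1, h'.1] <;> linarith

lemma volume_real_abs_sub_le_le (x τ : ℝ) (h0 : 0 ≤ τ) :
    (volume : Measure I).real {u : I | |(u : ℝ) - x| ≤ τ} ≤ 2 * τ := by
  have h : volume {u : I | |(u : ℝ) - x| ≤ τ} ≤ ENNReal.ofReal (2 * τ) := by
    rw [unitInterval.volume_apply, ← Real.volume_closedBall x τ]
    refine measure_mono ?_
    rintro _ ⟨u, hu, rfl⟩
    exact hu
  exact ENNReal.toReal_le_of_le_ofReal (by linarith) h

/-- The inverse distribution function of a law on `[0, 1]` whose distribution function is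
`min u (η ^ (-γ) * u ^ (γ + 1))`. -/
def warp (γ η : ℝ) (u : I) : I :=
  Set.projIcc 0 1 zero_le_one
    (max (u : ℝ) (η ^ (1 - (γ + 1)⁻¹) * (u : ℝ) ^ (γ + 1)⁻¹))

variable {γ η : ℝ}

lemma coe_warp (hγ : 0 < γ) (hη0 : 0 < η) (hη1 : η ≤ 1) (u : I) :
    (warp γ η u : ℝ) = max (u : ℝ) (η ^ (1 - (γ + 1)⁻¹) * (u : ℝ) ^ (γ + 1)⁻¹) := by
  have hθ1 : (γ + 1)⁻¹ ≤ 1 := inv_le_one_of_one_le₀ (by linarith)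
  have hθ0 : 0 ≤ (γ + 1)⁻¹ := by positivity
  have h1 : η ^ (1 - (γ + 1)⁻¹) * (u : ℝ) ^ (γ + 1)⁻¹ ≤ 1 :=
    mul_le_one₀ (Real.rpow_le_one hη0.le hη1 (by linarith)) (Real.rpow_nonneg u.2.1 _)
      (Real.rpow_le_one u.2.1 u.2.2 hθ0)
  rw [warp, Set.coe_projIcc, min_eq_right (max_le u.2.2 h1), max_eq_right]
  exact u.2.1.trans (le_max_left _ _)

lemma measurable_warp (hγ : 0 < γ) : Measurable (warp γ η) := by
  have hθ0 : 0 ≤ (γ + 1)⁻¹ := by positivity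
  refine (continuous_projIcc.comp (continuous_subtype_val.max (continuous_const.mul ?_))).measurable
  exact Continuous.rpow_const continuous_subtype_val fun _ => Or.inr hθ0

lemma warp_eq_self (hγ : 0 < γ) (hη0 : 0 < η) (hη1 : η ≤ 1) {u : I} (hu : η ≤ u) :
    warp γ η u = u := by
  have hθ1 : (γ + 1)⁻¹ ≤ 1 := inv_le_one_of_one_le₀ (by linarith)
  have hu0 : (0 : ℝ) < u := hη0.trans_le hu
  refine Subtype.ext ?_
  rw [coe_warp hγ hη0 hη1, max_eq_left]
  calc η ^ (1 - (γ + 1)⁻¹) * (u : ℝ) ^ (γ + 1)⁻¹ ≤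
      (u : ℝ) ^ (1 - (γ + 1)⁻¹) * (u : ℝ) ^ (γ + 1)⁻¹ := by
        gcongr
    _ = u := by rw [← Real.rpow_add hu0]; simp

lemma rpow_warp_le_iff (hγ : 0 < γ) (hη0 : 0 < η) {u b : ℝ} (hu : 0 ≤ u) (hb : 0 ≤ b) :
    η ^ (1 - (γ + 1)⁻¹) * u ^ (γ + 1)⁻¹ ≤ b ↔ u ≤ η ^ (-γ) * b ^ (γ + 1) := by
  have h1 : 0 < γ + 1 := by linarith
  have hpos : 0 ≤ η ^ (1 - (γ + 1)⁻¹) * u ^ (γ + 1)⁻¹ := by positivity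
  have e : (η ^ (1 - (γ + 1)⁻¹) * u ^ (γ + 1)⁻¹) ^ (γ + 1) = η ^ γ * u := by
    rw [Real.mul_rpow (by positivity) (by positivity), ← Real.rpow_mul hη0.le,
      ← Real.rpow_mul hu, inv_mul_cancel₀ h1.ne', Real.rpow_one]
    congr 2
    field_simp
    ring
  rw [← Real.rpow_le_rpow_iff hpos hb h1, e, Real.rpow_neg hη0.le, ← div_eq_inv_mul,
    le_div_iff₀ (by positivity), mul_comm]

lemma le_rpow_warp_iff (hγ : 0 < γ) (hη0 : 0 < η) {u b : ℝ} (hu : 0 ≤ u) (hb : 0 ≤ b) :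
    b ≤ η ^ (1 - (γ + 1)⁻¹) * u ^ (γ + 1)⁻¹ ↔ η ^ (-γ) * b ^ (γ + 1) ≤ u := by
  have h1 : 0 < γ + 1 := by linarith
  have hpos : 0 ≤ η ^ (1 - (γ + 1)⁻¹) * u ^ (γ + 1)⁻¹ := by positivity
  have e : (η ^ (1 - (γ + 1)⁻¹) * u ^ (γ + 1)⁻¹) ^ (γ + 1) = η ^ γ * u := by
    rw [Real.mul_rpow (by positivity) (by positivity), ← Real.rpow_mul hη0.le,
      ← Real.rpow_mul hu, inv_mul_cancel₀ h1.ne', Real.rpow_one]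
    congr 2
    field_simp
    ring
  rw [← Real.rpow_le_rpow_iff hb hpos h1, e, Real.rpow_neg hη0.le, ← div_eq_inv_mul,
    div_le_iff₀ (by positivity), mul_comm (η ^ γ)]

/-- On the linear branch at `b`, the increment is at least `b - a`, which dominates its own power `γ
+ 1` on `[0, 1]`. On the power branch, superadditivity of `s ^ (γ + 1)` and `η ^ (-γ) ≥ 1` suffice.
-/
lemma rpow_sub_le_warp_cdf_sub (hγ : 0 < γ) (hη0 : 0 < η) (hη1 : η ≤ 1) {a b : ℝ} (ha : 0 ≤ a)
    (hab : a ≤ b) (hb : b ≤ 1) :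
    (b - a) ^ (γ + 1) ≤ min b (η ^ (-γ) * b ^ (γ + 1)) - min a (η ^ (-γ) * a ^ (γ + 1)) := by
  have hb0 : 0 ≤ b := ha.trans hab
  have hlin : (b - a) ^ (γ + 1) ≤ b - a := by
    calc (b - a) ^ (γ + 1) ≤ (b - a) ^ (1 : ℝ) :=
        Real.rpow_le_rpow_of_exponent_ge' (by linarith) (by linarith) zero_le_one (by linarith)
      _ = _ := Real.rpow_one _
  have h1 : 1 ≤ η ^ (-γ) := Real.one_le_rpow_of_pos_of_le_one_of_nonpos hη0 hη1 (by linarith)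
  rcases le_total b (η ^ (-γ) * b ^ (γ + 1)) with h | h
  · rw [min_eq_left h]
    linarith [min_le_left a (η ^ (-γ) * a ^ (γ + 1))]
  · rw [min_eq_right h]
    have hsup : (b - a) ^ (γ + 1) + a ^ (γ + 1) ≤ b ^ (γ + 1) := by
      have := Real.add_rpow_le_rpow_add (by linarith : 0 ≤ b - a) ha (by linarith : 1 ≤ γ + 1)
      simpa using this
    have hp : 0 ≤ (b - a) ^ (γ + 1) := Real.rpow_nonneg (by linarith) _
    have := min_le_right a (η ^ (-γ) * a ^ (γ + 1))
    nlinarith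

/-- The ball is an interval `[a, b]` of length at least `τ`, even at the ends of `[0, 1]`. The warp
maps the interval between the values of the distribution function at `a` and `b` into it. By
`rpow_sub_le_warp_cdf_sub` that interval has length at least `(b - a) ^ γ * (b - a)`. -/
lemma rpow_mul_volume_real_le_warp (hγ : 0 < γ) (hη0 : 0 < η) (hη1 : η ≤ 1) (x : I) {τ : ℝ}
    (h0 : 0 ≤ τ) (h1 : τ ≤ 1) :
    τ ^ γ * (volume : Measure I).real {u : I | |(u : ℝ) - x| ≤ τ} ≤
      (volume : Measure I).real {u : I | |(warp γ η u : ℝ) - x| ≤ τ} := by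
  have hτ := le_volume_real_abs_sub_le x h0 h1
  obtain ⟨a, b, hax, hxb, he, ha, hb⟩ := setOf_abs_sub_le_eq_Icc x h0
  have hab := hax.trans hxb
  rw [he, volume_real_Icc a b hab] at hτ ⊢
  have ha0 := a.2.1
  have hb0 := b.2.1
  have hcdf : ∀ c : I, min (c : ℝ) (η ^ (-γ) * (c : ℝ) ^ (γ + 1)) ∈ Set.Icc (0 : ℝ) 1 := fun c =>
    ⟨le_min c.2.1 (mul_nonneg (by positivity) (Real.rpow_nonneg c.2.1 _)),
      (min_le_left _ _).trans c.2.2⟩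
  have hkey := rpow_sub_le_warp_cdf_sub hγ hη0 hη1 ha0 hab b.2.2
  have hle : min (a : ℝ) (η ^ (-γ) * (a : ℝ) ^ (γ + 1)) ≤
      min (b : ℝ) (η ^ (-γ) * (b : ℝ) ^ (γ + 1)) := by
    have : 0 ≤ ((b : ℝ) - a) ^ (γ + 1) := Real.rpow_nonneg (by linarith [Subtype.coe_le_coe.2 hab]) _
    linarith
  have hsub : Set.Icc (⟨_, hcdf a⟩ : I) ⟨_, hcdf b⟩ ⊆
      {u : I | |(warp γ η u : ℝ) - x| ≤ τ} := by
    rintro u ⟨hu1, hu2⟩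
    have hmem : warp γ η u ∈ Set.Icc a b := by
      rw [Set.mem_Icc, ← Subtype.coe_le_coe, ← Subtype.coe_le_coe, coe_warp hγ hη0 hη1]
      constructor
      · rw [le_max_iff, le_rpow_warp_iff hγ hη0 u.2.1 ha0]
        exact min_le_iff.1 hu1
      · rw [max_le_iff, rpow_warp_le_iff hγ hη0 u.2.1 hb0]
        exact le_min_iff.1 hu2
    rw [← he] at hmem
    exact hmem
  calc τ ^ γ * ((b : ℝ) - a) ≤ ((b : ℝ) - a) ^ γ * ((b : ℝ) - a) := by
        have : (0 : ℝ) ≤ (b : ℝ) - a := by linarith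
        gcongr
    _ = ((b : ℝ) - a) ^ (γ + 1) := by
        rw [Real.rpow_add_one' (by linarith) (by linarith)]
    _ ≤ _ := hkey
    _ = (volume : Measure I).real (Set.Icc (⟨_, hcdf a⟩ : I) ⟨_, hcdf b⟩) :=
        (volume_real_Icc ⟨_, hcdf a⟩ ⟨_, hcdf b⟩ hle).symm
    _ ≤ _ := measureReal_mono hsub

lemma volume_real_warp_le (hγ : 0 < γ) (hη0 : 0 < η) (hη1 : η ≤ 1) {τ : ℝ} (h0 : 0 ≤ τ) :
    (volume : Measure I).real {u : I | |(warp γ η u : ℝ)| ≤ τ} ≤ 2 * η ^ (-γ) * τ ^ (γ + 1) := by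
  have hsub : {u : I | |(warp γ η u : ℝ)| ≤ τ} ⊆
      {u : I | |(u : ℝ) - 0| ≤ η ^ (-γ) * τ ^ (γ + 1)} := by
    intro u hu
    rw [Set.mem_ofPred_eq, sub_zero, abs_of_nonneg u.2.1]
    rw [Set.mem_ofPred_eq, abs_of_nonneg (warp γ η u).2.1, coe_warp hγ hη0 hη1, max_le_iff,
      rpow_warp_le_iff hγ hη0 u.2.1 h0] at hu
    exact hu.2
  refine (measureReal_mono hsub).trans ?_
  refine (volume_real_abs_sub_le_le 0 _ (by positivity)).trans_eq (by ring)

/-- A reparametrization of `[0, 1]` that moves points by little and thins out the mass near `0`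
by a power `γ` of the distance. -/
lemma exists_warp (hγ : 0 ≤ γ) (hη : 0 < γ → 0 < η) (hη1 : η ≤ 1) :
    ∃ ψ : I → I, Measurable ψ ∧ (∀ u : I, η ≤ u → ψ u = u) ∧
      (∀ (x : I) (τ : ℝ), 0 ≤ τ → τ ≤ 1 →
        τ ^ γ * (volume : Measure I).real {u : I | |(u : ℝ) - x| ≤ τ} ≤
          (volume : Measure I).real {u : I | |(ψ u : ℝ) - x| ≤ τ}) ∧
      (0 < γ → ∃ K : ℝ, 0 ≤ K ∧ ∀ τ : ℝ, 0 ≤ τ →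
        (volume : Measure I).real {u : I | |(ψ u : ℝ)| ≤ τ} ≤ K * τ ^ (γ + 1)) := by
  rcases hγ.eq_or_lt with rfl | hγ'
  · refine ⟨id, measurable_id, fun _ _ => rfl, fun x τ _ _ => by simp, fun h => (lt_irrefl _ h).elim⟩
  · have hη0 := hη hγ'
    exact ⟨warp γ η, measurable_warp hγ', fun u hu => warp_eq_self hγ' hη0 hη1 hu,
      fun x τ h0 h1 => rpow_mul_volume_real_le_warp hγ' hη0 hη1 x h0 h1,
      fun _ => ⟨2 * η ^ (-γ), by positivity, fun τ h0 => volume_real_warp_le hγ' hη0 hη1 h0⟩⟩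

end Warp

/-! ### Masses of intervals, counted cell by cell -/

section CellSums

open unitInterval

/-- The fraction of the cell `[8 j, 8 j + 1]`, reparametrized by `ψ`, at distance at most `ρ`
from `v`. -/
def cellFrac (ψ : I → I) (j : ℕ) (v ρ : ℝ) : ℝ :=
  (volume : Measure I).real {u : I | |8 * (j : ℝ) + ψ u - v| ≤ ρ}

lemma cellFrac_nonneg (ψ : I → I) (j : ℕ) (v ρ : ℝ) : 0 ≤ cellFrac ψ j v ρ := measureReal_nonneg

lemma cellFrac_le_one (ψ : I → I) (j : ℕ) (v ρ : ℝ) : cellFrac ψ j v ρ ≤ 1 := measureReal_le_one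

variable {i j : ℕ} {ρ : ℝ}

lemma cellFrac_eq_one (ψ : I → I) (x : I) (h : 8 * |(j : ℝ) - i| + 1 ≤ ρ) :
    cellFrac ψ j (8 * i + x) ρ = 1 := by
  have : {u : I | |8 * (j : ℝ) + ψ u - (8 * i + x)| ≤ ρ} = Set.univ := by
    refine Set.eq_univ_of_forall fun u => ?_
    have h1 := (ψ u).2
    have h2 := x.2
    have h3 := neg_abs_le ((j : ℝ) - i)
    have h4 := le_abs_self ((j : ℝ) - i)
    rw [Set.mem_ofPred_eq, abs_le]
    constructor <;> linarith [h1.1, h1.2, h2.1, h2.2]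
  rw [cellFrac, this]
  simp

lemma cellFrac_eq_zero (ψ : I → I) (x : I) (h : ρ < 8 * |(j : ℝ) - i| - 1) :
    cellFrac ψ j (8 * i + x) ρ = 0 := by
  have : {u : I | |8 * (j : ℝ) + ψ u - (8 * i + x)| ≤ ρ} = ∅ := by
    refine Set.eq_empty_of_forall_notMem fun u hu => ?_
    have h1 := (ψ u).2
    have h2 := x.2
    rw [Set.mem_ofPred_eq, abs_le] at hu
    rcases abs_cases ((j : ℝ) - i) with h3 | h3 <;> linarith [h1.1, h1.2, h2.1, h2.2]
  rw [cellFrac, this]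
  simp

/-- Only parameters below `η` are moved by `ψ`, so a cell loses at most `η`. -/
lemma cellFrac_id_le_add {ψ : I → I} {η : ℝ} (hη0 : 0 ≤ η) (hη1 : η ≤ 1)
    (hψ : ∀ u : I, η ≤ u → ψ u = u) (j : ℕ) (v ρ : ℝ) :
    cellFrac id j v ρ ≤ cellFrac ψ j v ρ + η := by
  have hsub : {u : I | |8 * (j : ℝ) + (id u : I) - v| ≤ ρ} ⊆
      {u : I | |8 * (j : ℝ) + ψ u - v| ≤ ρ} ∪ Set.Iio ⟨η, hη0, hη1⟩ := by
    intro u hu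
    rcases lt_or_ge (u : ℝ) η with h | h
    · exact Or.inr h
    · left
      rw [Set.mem_ofPred_eq, hψ u h]
      exact hu
  refine (measureReal_mono hsub).trans ((measureReal_union_le _ _).trans ?_)
  rw [cellFrac, measureReal_def volume (Set.Iio _), unitInterval.volume_Iio,
    ENNReal.toReal_ofReal hη0]

lemma cellFrac_self (ψ : I → I) (i : ℕ) (x : I) (ρ : ℝ) :
    cellFrac ψ i (8 * i + x) ρ = (volume : Measure I).real {u : I | |(ψ u : ℝ) - x| ≤ ρ} := by
  simp only [cellFrac, add_sub_add_left_eq_sub]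

lemma cellFrac_id_le (j : ℕ) (v : ℝ) (h : 0 ≤ ρ) : cellFrac id j v ρ ≤ 2 * ρ := by
  refine le_trans (le_of_eq ?_) (volume_real_abs_sub_le_le (v - 8 * j) ρ h)
  unfold cellFrac
  congr 1
  ext u
  simp only [Set.mem_ofPred_eq, id]
  rw [show 8 * (j : ℝ) + u - v = u - (v - 8 * j) by ring]

/-- The number of cells around a given cell that are covered by a long interval. -/
lemma le_sum_cellFrac_id {M : ℕ} (i : Fin M) (x : I) (h0 : 0 ≤ ρ) (h1 : ρ ≤ 16 * M) :
    ρ / 16 ≤ ∑ j : Fin M, cellFrac id j (8 * (i : ℕ) + x) ρ := by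
  have hown : cellFrac id i (8 * (i : ℕ) + x) ρ ≤
      ∑ j : Fin M, cellFrac id j (8 * (i : ℕ) + x) ρ :=
    Finset.single_le_sum (f := fun j : Fin M => cellFrac id j (8 * (i : ℕ) + x) ρ)
      (fun j _ => cellFrac_nonneg _ _ _ _) (Finset.mem_univ i)
  rcases le_or_gt ρ 1 with h | h
  · rw [cellFrac_self] at hown
    have := le_volume_real_abs_sub_le x h0 h
    simp only [id] at hown
    linarith
  rcases le_or_gt ρ 16 with h' | h'
  · rw [cellFrac_eq_one id x (by simpa using h.le)] at hown
    linarith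
  -- All cells of index distance at most `k` from `i` lie inside the interval.
  set k := ⌊(ρ - 1) / 8⌋₊ with hk
  have hk1 : (k : ℝ) ≤ (ρ - 1) / 8 := Nat.floor_le (by linarith)
  have hk2 : (ρ - 1) / 8 < k + 1 := Nat.lt_floor_add_one _
  set m := min (k + 1) M with hm
  have hmM : m ≤ M := min_le_right _ _
  have hmk : m ≤ k + 1 := min_le_left _ _
  -- A window of `m` consecutive indices that contains `i` is shifted to the left where needed to
  -- stay below `M`. Its members are within `m - 1 ≤ k` of `i`.
  set a := min (i : ℕ) (M - m) with ha
  have hi := i.2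
  have hmem : ∀ n ∈ Finset.Ico a (a + m), n < M := by
    intro n hn
    rw [Finset.mem_Ico] at hn
    omega
  have hfull : ∀ j ∈ (Finset.Ico a (a + m)).attachFin hmem,
      1 ≤ cellFrac id (j : Fin M) (8 * (i : ℕ) + x) ρ := by
    intro j hj
    rw [Finset.mem_attachFin, Finset.mem_Ico] at hj
    refine (cellFrac_eq_one id x ?_).ge
    have h2 : (j : ℕ) ≤ i + k ∧ (i : ℕ) ≤ j + k := by omega
    have h3 : (j : ℝ) ≤ (i : ℕ) + k := by exact_mod_cast h2.1
    have h4 : ((i : ℕ) : ℝ) ≤ j + k := by exact_mod_cast h2.2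
    have : |((j : ℕ) : ℝ) - (i : ℕ)| ≤ k := by rw [abs_le]; constructor <;> linarith
    linarith
  have hsum : (m : ℝ) ≤ ∑ j : Fin M, cellFrac id j (8 * (i : ℕ) + x) ρ := by
    calc (m : ℝ) = ∑ _j ∈ (Finset.Ico a (a + m)).attachFin hmem, (1 : ℝ) := by simp
      _ ≤ ∑ j ∈ (Finset.Ico a (a + m)).attachFin hmem,
            cellFrac id (j : Fin M) (8 * (i : ℕ) + x) ρ := Finset.sum_le_sum hfull
      _ ≤ _ := Finset.sum_le_sum_of_subset_of_nonneg (Finset.subset_univ _)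
            fun j _ _ => cellFrac_nonneg _ _ _ _
  refine le_trans ?_ hsum
  rw [hm, Nat.cast_min, le_min_iff]
  push_cast
  constructor <;> linarith

/-- At most two cells are cut by the boundary of an interval. -/
lemma card_boundary_cells_le {M : ℕ} (i : Fin M) (ρ : ℝ) (h0 : 0 ≤ ρ) :
    (Finset.univ.filter fun j : Fin M => ρ < 8 * |((j : ℕ) : ℝ) - (i : ℕ)| + 4 ∧
      8 * |((j : ℕ) : ℝ) - (i : ℕ)| - 1 ≤ ρ).card ≤ 2 := by
  -- A cut cell at index distance `D` has `8 D - 1 ≤ ρ < 8 D + 4`, which forces `D = n`. So its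
  -- index is `i + n` or `i - n`.
  set n := ⌊(ρ + 1) / 8⌋₊ with hn
  have hn1 : (n : ℝ) ≤ (ρ + 1) / 8 := Nat.floor_le (by linarith)
  have hn2 : (ρ + 1) / 8 < n + 1 := Nat.lt_floor_add_one _
  have : ∀ j ∈ (Finset.univ.filter fun j : Fin M => ρ < 8 * |((j : ℕ) : ℝ) - (i : ℕ)| + 4 ∧
      8 * |((j : ℕ) : ℝ) - (i : ℕ)| - 1 ≤ ρ),
      ((j : ℕ) : ℤ) ∈ ({(i : ℕ) + (n : ℤ), (i : ℕ) - (n : ℤ)} : Finset ℤ) := by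
    intro j hj
    simp only [Finset.mem_filter, Finset.mem_univ, true_and] at hj
    obtain ⟨h1, h2⟩ := hj
    have hz : |((j : ℕ) : ℝ) - (i : ℕ)| = ((|((j : ℕ) : ℤ) - (i : ℕ)| : ℤ) : ℝ) := by
      push_cast; rfl
    rw [hz] at h1 h2
    have h3 : (|((j : ℕ) : ℤ) - (i : ℕ)| : ℤ) < (n : ℤ) + 1 := by
      have : ((|((j : ℕ) : ℤ) - (i : ℕ)| : ℤ) : ℝ) < n + 1 := by linarith
      exact_mod_cast this
    have h4 : (n : ℤ) < (|((j : ℕ) : ℤ) - (i : ℕ)| : ℤ) + 1 := by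
      have : (n : ℝ) < ((|((j : ℕ) : ℤ) - (i : ℕ)| : ℤ) : ℝ) + 1 := by linarith
      exact_mod_cast this
    simp only [Finset.mem_insert, Finset.mem_singleton]
    rcases abs_cases (((j : ℕ) : ℤ) - (i : ℕ)) with h | h <;> omega
  refine (Finset.card_le_card_of_injOn (fun j : Fin M => ((j : ℕ) : ℤ)) this ?_).trans
    Finset.card_le_two
  intro j _ j' _ h
  exact Fin.ext (Int.ofNat.inj h)

/-- `1 - t₀ ^ γ` exceeds `1 - t ^ γ` by a factor that is at most linear in `t / t₀`. -/
lemma one_sub_rpow_mul_le {t₀ t γ : ℝ} (h0 : 0 < t₀) (h1 : t₀ ≤ t) (h2 : t ≤ 1 / 2)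
    (hγ : 0 ≤ γ) : (1 - t₀ ^ γ) * t₀ ≤ 3 * t * (1 - t ^ γ) := by
  have ht : 0 < t := h0.trans_le h1
  have hlt : Real.log t < 0 := Real.log_neg ht (by linarith)
  have hlog2 : (1 : ℝ) / 2 ≤ -Real.log t := by
    have := Real.log_le_log ht h2
    have h3 := Real.log_two_gt_d9
    rw [one_div, Real.log_inv] at this
    linarith
  -- Writing `t₀ ^ γ = (t ^ γ) ^ m` with `m ≥ 1`, Bernoulli's inequality gives a factor `m` that
  -- does not depend on `γ`.
  set m := Real.log t₀ / Real.log t with hm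
  have hm1 : 1 ≤ m := by
    rw [hm, le_div_iff_of_neg hlt, one_mul]
    exact Real.log_le_log h0 h1
  have hpow : t₀ ^ γ = (t ^ γ) ^ m := by
    rw [← Real.rpow_mul ht.le, Real.rpow_def_of_pos h0, Real.rpow_def_of_pos ht]
    congr 1
    rw [hm]
    have := hlt.ne
    field_simp
  have hw0 : 0 ≤ t ^ γ := Real.rpow_nonneg ht.le _
  have hw1 : t ^ γ ≤ 1 := Real.rpow_le_one ht.le (by linarith) hγ
  have hb : 1 - t₀ ^ γ ≤ m * (1 - t ^ γ) := by
    have := one_add_mul_self_le_rpow_one_add (s := t ^ γ - 1) (by linarith) hm1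
    rw [hpow]
    simp only [add_sub_cancel] at this
    linarith
  -- Since `-log t ≥ 1 / 2` and `log (t / t₀) ≤ t / t₀ - 1`, one has `m ≤ 1 + 2 (t / t₀ - 1) ≤ 3 t /
  -- t₀`.
  have hmb : m * t₀ ≤ 3 * t := by
    have h3 : -Real.log t₀ ≤ -Real.log t + (t / t₀ - 1) := by
      have := Real.log_le_sub_one_of_pos (div_pos ht h0)
      rw [Real.log_div ht.ne' h0.ne'] at this
      linarith
    have h4 : m ≤ 3 * (t / t₀) := by
      rw [hm, div_le_iff_of_neg hlt]
      have h5 : 1 ≤ t / t₀ := by rwa [one_le_div h0]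
      nlinarith
    calc m * t₀ ≤ 3 * (t / t₀) * t₀ := by gcongr
      _ = 3 * t := by field_simp
  calc (1 - t₀ ^ γ) * t₀ ≤ m * (1 - t ^ γ) * t₀ := by gcongr
    _ = m * t₀ * (1 - t ^ γ) := by ring
    _ ≤ _ := by
      have : 0 ≤ 1 - t ^ γ := by linarith
      gcongr

/-- The mass of an interval, in units of the mass of a cell, when a fraction `A` of each cell is
kept and reparametrized by `ψ`, and the rest is moved to the point `8 j + 4`. -/
def cellSum (M : ℕ) (A : ℝ) (ψ : I → I) (v ρ : ℝ) : ℝ :=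
  ∑ j : Fin M, (A * cellFrac ψ j v ρ +
    (1 - A) * if |8 * ((j : ℕ) : ℝ) + 4 - v| ≤ ρ then 1 else 0)

lemma cellSum_one_id (M : ℕ) (v ρ : ℝ) :
    cellSum M 1 id v ρ = ∑ j : Fin M, cellFrac id j v ρ := by
  simp [cellSum]

/-- This is the transfer inequality with constant `1`, in cell units. An interval loses mass against
the target only at its own cell, when short, or at the at most two cells cut by its boundary. The
loss is paid for by the factor `t ^ γ`, by the atom of the own cell, or, for long intervals, by the
gap `1 - t ^ γ` times the number of cells covered. -/
lemma rpow_mul_cellSum_le {M : ℕ} (hM : 32 ≤ M) {γ : ℝ} (hγ : 0 ≤ γ) {A η : ℝ}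
    (hA : A = (16 / M) ^ γ) (hη : η = (1 - A) / 2) {ψ : I → I}
    (hψ : ∀ u : I, η ≤ u → ψ u = u)
    (hloc : ∀ (x : I) (τ : ℝ), 0 ≤ τ → τ ≤ 1 →
        τ ^ γ * (volume : Measure I).real {u : I | |(u : ℝ) - x| ≤ τ} ≤
          (volume : Measure I).real {u : I | |(ψ u : ℝ) - x| ≤ τ})
    (i : Fin M) (x : I) {t : ℝ} (ht0 : 0 < t) (ht1 : t ≤ 1) :
    t ^ γ * cellSum M 1 id (8 * (i : ℕ) + x) (16 * M * t) ≤
      cellSum M A ψ (8 * (i : ℕ) + x) (16 * M * t) := by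
  have hM' : (32 : ℝ) ≤ M := by exact_mod_cast hM
  have hMpos : (0 : ℝ) < M := by linarith
  have h16 : (16 : ℝ) / M ≤ 1 / 2 := by rw [div_le_div_iff₀ hMpos two_pos]; linarith
  have hA0 : 0 ≤ A := by rw [hA]; positivity
  have hA1 : A ≤ 1 := by rw [hA]; exact Real.rpow_le_one (by positivity) (by linarith) hγ
  have hη0 : 0 ≤ η := by linarith
  have hη1 : η ≤ 1 := by linarith
  have hx0 := x.2.1
  have hx1 := x.2.2
  have htγ0 : 0 ≤ t ^ γ := Real.rpow_nonneg ht0.le _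
  have htγ1 : t ^ γ ≤ 1 := Real.rpow_le_one ht0.le ht1 hγ
  rw [cellSum_one_id]
  set ρ := 16 * M * t with hρ
  have hρ0 : 0 < ρ := by positivity
  set v := 8 * ((i : ℕ) : ℝ) + (x : ℝ) with hv
  have hfrac := fun j : Fin M => cellFrac_id_le_add hη0 hη1 hψ j v ρ
  have hind : ∀ j : Fin M, 0 ≤ (1 - A) * (if |8 * ((j : ℕ) : ℝ) + 4 - v| ≤ ρ then (1 : ℝ) else 0) :=
    fun j => mul_nonneg (by linarith) (by split_ifs <;> norm_num)
  -- short intervals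
  have hsmall : ρ ≤ 5 → t ^ γ * ∑ j : Fin M, cellFrac id j v ρ ≤ cellSum M A ψ v ρ := by
    intro h5
    have hz : ∀ j : Fin M, j ≠ i → cellFrac id j v ρ = 0 := by
      intro j hj
      refine cellFrac_eq_zero id x ?_
      have h1 : (1 : ℝ) ≤ |((j : ℕ) : ℝ) - (i : ℕ)| := by
        have : (1 : ℤ) ≤ |((j : ℕ) : ℤ) - (i : ℕ)| := by
          refine Int.one_le_abs fun h => hj (Fin.ext ?_)
          omega
        exact_mod_cast this
      linarith
    rw [Finset.sum_eq_single i (fun j _ hj => hz j hj) (by simp)]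
    have hown : A * cellFrac ψ i v ρ ≤ cellSum M A ψ v ρ := by
      refine le_trans ?_ (Finset.single_le_sum (f := fun j : Fin M => A * cellFrac ψ j v ρ +
        (1 - A) * if |8 * ((j : ℕ) : ℝ) + 4 - v| ≤ ρ then 1 else 0)
        (fun j _ => add_nonneg (mul_nonneg hA0 (cellFrac_nonneg _ _ _ _)) (hind j))
        (Finset.mem_univ i))
      linarith [hind i]
    refine le_trans ?_ hown
    rcases le_or_gt ρ 1 with h1 | h1
    · have := hloc x ρ hρ0.le h1
      rw [hv, cellFrac_self, cellFrac_self]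
      -- The base of the right side is `(16 / M) * ρ = 256 t`, which exceeds `t`.
      have hAt : t ^ γ ≤ A * ρ ^ γ := by
        rw [hA, ← Real.mul_rpow (by positivity) hρ0.le]
        refine Real.rpow_le_rpow ht0.le ?_ hγ
        have : 16 / (M : ℝ) * ρ = 256 * t := by rw [hρ]; field_simp; norm_num
        linarith
      calc t ^ γ * _ ≤ A * ρ ^ γ * _ := by
            gcongr
        _ = A * (ρ ^ γ * _) := by rw [mul_assoc]
        _ ≤ _ := by gcongr; exact this
    · rw [hv, cellFrac_eq_one ψ x (by simpa using h1.le), mul_one]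
      have hAt : t ^ γ ≤ A := by
        rw [hA]
        refine Real.rpow_le_rpow ht0.le ?_ hγ
        rw [le_div_iff₀ hMpos]
        linarith
      exact (mul_le_of_le_one_right htγ0 (cellFrac_le_one _ _ _ _)).trans hAt
  rcases le_or_gt ρ 5 with h5 | h5
  · exact hsmall h5
  -- deficits of the single cells
  set bad := Finset.univ.filter fun j : Fin M => ρ < 8 * |((j : ℕ) : ℝ) - (i : ℕ)| + 4 ∧
      8 * |((j : ℕ) : ℝ) - (i : ℕ)| - 1 ≤ ρ with hbad
  have hcard : (bad.card : ℝ) ≤ 2 := by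
    have : bad.card ≤ 2 := card_boundary_cells_le i ρ hρ0.le
    exact_mod_cast this
  have hgood : ∀ j : Fin M, j ∉ bad → 8 * |((j : ℕ) : ℝ) - (i : ℕ)| + 4 ≤ ρ ∨
      ρ < 8 * |((j : ℕ) : ℝ) - (i : ℕ)| - 1 := by
    intro j hj
    by_contra hcon
    rw [not_or, not_le, not_lt] at hcon
    exact hj (by rw [hbad, Finset.mem_filter]; exact ⟨Finset.mem_univ _, hcon⟩)
  have hatom : ∀ j : Fin M, 8 * |((j : ℕ) : ℝ) - (i : ℕ)| + 4 ≤ ρ →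
      |8 * ((j : ℕ) : ℝ) + 4 - v| ≤ ρ := by
    intro j hj
    rw [hv, abs_le]
    rcases abs_cases (((j : ℕ) : ℝ) - (i : ℕ)) with h | h <;> constructor <;> linarith
  rcases le_or_gt t (16 / M) with hmid | hmid
  · -- intervals of intermediate length
    have htA : t ^ γ ≤ A := by rw [hA]; exact Real.rpow_le_rpow ht0.le hmid hγ
    -- Since `ρ > 5`, the atom of the own cell lies in the interval and contributes `1 - A`. This
    -- balances the loss of the at most two cut cells, `η = (1 - A) / 2` each.
    have hterm : ∀ j : Fin M, A * cellFrac id j v ρ + (if j = i then 1 - A else 0) -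
        (if j ∈ bad then η else 0) ≤ A * cellFrac ψ j v ρ +
          (1 - A) * if |8 * ((j : ℕ) : ℝ) + 4 - v| ≤ ρ then 1 else 0 := by
      intro j
      have hA2 : A * cellFrac id j v ρ ≤ A * cellFrac ψ j v ρ + η := by
        have := mul_le_mul_of_nonneg_left (hfrac j) hA0
        have : A * η ≤ η := mul_le_of_le_one_left hη0 hA1
        linarith
      have hi : (if j = i then 1 - A else 0) ≤
          (1 - A) * if |8 * ((j : ℕ) : ℝ) + 4 - v| ≤ ρ then 1 else 0 := by
        split_ifs with h1 h2 h2
        · simp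
        · exact absurd (hatom j (by rw [h1]; simp; linarith)) h2
        · linarith
        · simp
      by_cases hj : j ∈ bad
      · rw [if_pos hj]; linarith
      · rw [if_neg hj]
        have : cellFrac id j v ρ ≤ cellFrac ψ j v ρ := by
          rcases hgood j hj with h | h
          · rw [hv, cellFrac_eq_one ψ x (by linarith)]
            exact cellFrac_le_one _ _ _ _
          · rw [hv, cellFrac_eq_zero id x h]
            exact cellFrac_nonneg _ _ _ _
        have := mul_le_mul_of_nonneg_left this hA0
        linarith
    have hsum := Finset.sum_le_sum fun j (_ : j ∈ Finset.univ) => hterm j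
    rw [Finset.sum_sub_distrib, Finset.sum_add_distrib, ← Finset.mul_sum,
      Finset.sum_ite_eq' Finset.univ i, if_pos (Finset.mem_univ i), Finset.sum_ite_mem,
      Finset.univ_inter, Finset.sum_const, nsmul_eq_mul] at hsum
    have hb : (bad.card : ℝ) * η ≤ 2 * η := by gcongr
    have hS : 0 ≤ ∑ j : Fin M, cellFrac id j v ρ :=
      Finset.sum_nonneg fun j _ => cellFrac_nonneg _ _ _ _
    have := mul_le_mul_of_nonneg_right htA hS
    change _ ≤ cellSum M A ψ v ρ at hsum
    linarith
  -- Uncut cells inside the interval bring their atoms along and lose nothing. A cut cell loses at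
  -- most `1 - A` through a missing atom and `η` through the warp.
  · have hterm : ∀ j : Fin M, cellFrac id j v ρ - (if j ∈ bad then (1 - A) + η else 0) ≤
        A * cellFrac ψ j v ρ +
          (1 - A) * if |8 * ((j : ℕ) : ℝ) + 4 - v| ≤ ρ then 1 else 0 := by
      intro j
      by_cases hj : j ∈ bad
      · rw [if_pos hj]
        have := mul_le_mul_of_nonneg_left (hfrac j) hA0
        have : A * η ≤ η := mul_le_of_le_one_left hη0 hA1
        have h3 : (1 - A) * cellFrac id j v ρ ≤ 1 - A :=
          mul_le_of_le_one_right (by linarith) (cellFrac_le_one _ _ _ _)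
        linarith [hind j]
      · rw [if_neg hj, sub_zero]
        rcases hgood j hj with h | h
        · rw [if_pos (hatom j h), hv, cellFrac_eq_one ψ x (by linarith)]
          linarith [cellFrac_le_one id j (8 * ((i : ℕ) : ℝ) + (x : ℝ)) ρ]
        · rw [hv, cellFrac_eq_zero id x h, ← hv]
          have := mul_nonneg hA0 (cellFrac_nonneg ψ j v ρ)
          linarith [hind j]
    rcases le_or_gt t (1 / 2) with hhalf | hhalf
    · have hsum := Finset.sum_le_sum fun j (_ : j ∈ Finset.univ) => hterm j
      rw [Finset.sum_sub_distrib, Finset.sum_ite_mem, Finset.univ_inter, Finset.sum_const,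
        nsmul_eq_mul] at hsum
      have hb : (bad.card : ℝ) * (1 - A + η) ≤ 2 * (1 - A + η) := by
        have : 0 ≤ 1 - A + η := by linarith
        gcongr
      have hlow := le_sum_cellFrac_id (ρ := ρ) i x hρ0.le (by rw [hρ]; nlinarith)
      rw [← hv] at hlow
      have hρt : ρ / 16 = M * t := by rw [hρ]; ring
      rw [hρt] at hlow
      -- With `t₀ = 16 / M`, so that `A = t₀ ^ γ`, this bounds the total loss `2 (1 - A + η) = 3 (1
      -- - A)` by `(1 - t ^ γ) * (M * t)`, where `M * t` bounds the number of covered cells from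
      -- below.
      have hkey := one_sub_rpow_mul_le (γ := γ) (by positivity) hmid.le hhalf hγ
      rw [← hA] at hkey
      have hkey' : 3 * (1 - A) ≤ (1 - t ^ γ) * (M * t) := by
        have : (1 - A) * 16 ≤ 3 * t * (1 - t ^ γ) * M := by
          have := mul_le_mul_of_nonneg_right hkey hMpos.le
          rwa [mul_assoc (1 - A), div_mul_cancel₀ _ hMpos.ne'] at this
        nlinarith [mul_nonneg (sub_nonneg.2 htγ1) (mul_pos hMpos ht0).le]
      have hmul := mul_le_mul_of_nonneg_left hlow (sub_nonneg.2 htγ1)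
      change _ ≤ cellSum M A ψ v ρ at hsum
      linarith
    · -- long intervals contain everything
      have hall : ∀ j : Fin M, j ∉ bad := by
        intro j hj
        rw [hbad, Finset.mem_filter] at hj
        have hj1 : ((j : ℕ) : ℝ) + 1 ≤ M := by exact_mod_cast j.2
        have hi1 : ((i : ℕ) : ℝ) + 1 ≤ M := by exact_mod_cast i.2
        have hj0 : (0 : ℝ) ≤ (j : ℕ) := Nat.cast_nonneg _
        have hi0 : (0 : ℝ) ≤ (i : ℕ) := Nat.cast_nonneg _
        have : |((j : ℕ) : ℝ) - (i : ℕ)| ≤ M - 1 := by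
          rw [abs_le]; constructor <;> linarith
        have : 8 * (M : ℝ) ≤ ρ := by rw [hρ]; nlinarith
        linarith [hj.2.1]
      have hsum := Finset.sum_le_sum fun j (_ : j ∈ Finset.univ) => hterm j
      simp only [hall, if_false, sub_zero] at hsum
      change _ ≤ cellSum M A ψ v ρ at hsum
      have hS : 0 ≤ ∑ j : Fin M, cellFrac id j v ρ :=
        Finset.sum_nonneg fun j _ => cellFrac_nonneg _ _ _ _
      exact (mul_le_of_le_one_left hS htγ1).trans hsum

end CellSums

/-! ### One-dimensional laws carried by cells and atoms -/

section CellLaw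

open unitInterval

/-- The point `v / (16 M)` of the unit interval. -/
def pos (M : ℕ) (v : ℝ) : I := Set.projIcc 0 1 zero_le_one (v / (16 * M))

lemma continuous_pos (M : ℕ) : Continuous (pos M) :=
  continuous_projIcc.comp (continuous_id.div_const _)

lemma coe_pos {M : ℕ} {v : ℝ} (h0 : 0 ≤ v) (h1 : v ≤ 8 * M) :
    (pos M v : ℝ) = v / (16 * M) := by
  rw [pos, Set.projIcc_of_mem]
  refine ⟨by positivity, div_le_one_of_le₀ ?_ (by positivity)⟩
  have : (0 : ℝ) ≤ M := Nat.cast_nonneg M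
  linarith

lemma dist_pos {M : ℕ} {v w : ℝ} (hv : v ∈ Set.Icc (0 : ℝ) (8 * M))
    (hw : w ∈ Set.Icc (0 : ℝ) (8 * M)) : dist (pos M v) (pos M w) = |v - w| / (16 * M) := by
  rw [Subtype.dist_eq, Real.dist_eq, coe_pos hv.1 hv.2, coe_pos hw.1 hw.2, ← sub_div, abs_div,
    abs_of_nonneg (by positivity : (0 : ℝ) ≤ 16 * M)]

lemma cell_mem_Icc {M : ℕ} (j : Fin M) {u : ℝ} (hu : u ∈ Set.Icc (0 : ℝ) 4) :
    8 * ((j : ℕ) : ℝ) + u ∈ Set.Icc (0 : ℝ) (8 * M) := by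
  have hj1 : ((j : ℕ) : ℝ) + 1 ≤ M := by exact_mod_cast j.2
  have hj0 : (0 : ℝ) ≤ (j : ℕ) := Nat.cast_nonneg _
  exact ⟨by linarith [hu.1], by linarith [hu.2]⟩

lemma cell_mem_Icc' {M : ℕ} (j : Fin M) (u : I) :
    8 * ((j : ℕ) : ℝ) + u ∈ Set.Icc (0 : ℝ) (8 * M) :=
  cell_mem_Icc j ⟨u.2.1, by linarith [u.2.2]⟩

/-- The law on `[0, 1]` which gives mass `1 / M` to each of the `M` cells `[8 j, 8 j + 1]` in
units of `1 / (16 M)`, after a fraction `A` of each cell has been reparametrized by `ψ` and the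
rest has been moved to the point `8 j + 4`. -/
def cellLaw (M : ℕ) (A : ℝ) (ψ : I → I) : Measure I :=
  (M : ℝ≥0∞)⁻¹ • ∑ j : Fin M,
    (ENNReal.ofReal A • (volume : Measure I).map (fun u => pos M (8 * (j : ℕ) + ψ u)) +
      ENNReal.ofReal (1 - A) • Measure.dirac (pos M (8 * (j : ℕ) + 4)))

variable {M : ℕ} {A : ℝ} {ψ : I → I}

lemma measurable_pos_cell (hψ : Measurable ψ) (j : ℕ) :
    Measurable fun u => pos M (8 * (j : ℝ) + ψ u) :=
  (continuous_pos M).measurable.comp (measurable_const.add (measurable_subtype_coe.comp hψ))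

lemma isProbabilityMeasure_cellLaw (hM : M ≠ 0) (hA0 : 0 ≤ A) (hA1 : A ≤ 1)
    (hψ : Measurable ψ) : IsProbabilityMeasure (cellLaw M A ψ) := by
  refine ⟨?_⟩
  have h : ∀ j : Fin M, (volume : Measure I).map (fun u => pos M (8 * (j : ℕ) + ψ u)) Set.univ = 1 :=
    fun j => by rw [Measure.map_apply (measurable_pos_cell hψ j) .univ]; simp
  have h2 : ENNReal.ofReal A + ENNReal.ofReal (1 - A) = 1 := by
    rw [← ENNReal.ofReal_add hA0 (by linarith)]; simp
  simp only [cellLaw, Measure.smul_apply, Measure.finsetSum_apply, Measure.add_apply, h,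
    measure_univ, smul_eq_mul, mul_one, h2, Finset.sum_const, Finset.card_univ, Fintype.card_fin,
    nsmul_eq_mul]
  exact ENNReal.inv_mul_cancel (by exact_mod_cast hM) (ENNReal.natCast_ne_top M)

lemma cellLaw_real (hA0 : 0 ≤ A) (hA1 : A ≤ 1) (hψ : Measurable ψ) {S : Set I}
    (hS : MeasurableSet S) :
    (cellLaw M A ψ).real S = (∑ j : Fin M,
      (A * (volume : Measure I).real {u | pos M (8 * (j : ℕ) + ψ u) ∈ S} +
        (1 - A) * S.indicator 1 (pos M (8 * (j : ℕ) + 4)))) / M := by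
  have h : ∀ j : Fin M, (volume : Measure I).map (fun u => pos M (8 * (j : ℕ) + ψ u)) S =
      volume {u | pos M (8 * (j : ℕ) + ψ u) ∈ S} :=
    fun j => Measure.map_apply (measurable_pos_cell hψ j) hS
  rw [measureReal_def]
  simp only [cellLaw, Measure.smul_apply, Measure.finsetSum_apply, Measure.add_apply, h,
    smul_eq_mul, Measure.dirac_apply' _ hS]
  rw [ENNReal.toReal_mul, ENNReal.toReal_sum, div_eq_inv_mul]
  · congr 1
    · simp
    · refine Finset.sum_congr rfl fun j _ => ?_
      have hind : (S.indicator (1 : I → ℝ≥0∞) (pos M (8 * (j : ℕ) + 4))).toReal =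
          S.indicator (1 : I → ℝ) (pos M (8 * (j : ℕ) + 4)) := by
        by_cases hm : pos M (8 * (j : ℕ) + 4) ∈ S <;> simp [hm]
      have hfin : S.indicator (1 : I → ℝ≥0∞) (pos M (8 * (j : ℕ) + 4)) ≠ ∞ := by
        by_cases hm : pos M (8 * (j : ℕ) + 4) ∈ S <;> simp [hm]
      rw [ENNReal.toReal_add (ENNReal.mul_ne_top ENNReal.ofReal_ne_top (measure_ne_top _ _))
        (ENNReal.mul_ne_top ENNReal.ofReal_ne_top hfin), ENNReal.toReal_mul, ENNReal.toReal_mul,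
        ENNReal.toReal_ofReal hA0, ENNReal.toReal_ofReal (by linarith), hind]
      rfl
  · intro j _
    have hfin : S.indicator (1 : I → ℝ≥0∞) (pos M (8 * (j : ℕ) + 4)) ≠ ∞ := by
      by_cases hm : pos M (8 * (j : ℕ) + 4) ∈ S <;> simp [hm]
    exact ENNReal.add_ne_top.2 ⟨ENNReal.mul_ne_top ENNReal.ofReal_ne_top (measure_ne_top _ _),
      ENNReal.mul_ne_top ENNReal.ofReal_ne_top hfin⟩

lemma cellLaw_real_closedBall (hM : M ≠ 0) (hA0 : 0 ≤ A) (hA1 : A ≤ 1) (hψ : Measurable ψ)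
    {v : ℝ} (hv : v ∈ Set.Icc (0 : ℝ) (8 * M)) (t : ℝ) :
    (cellLaw M A ψ).real (Metric.closedBall (pos M v) t) = cellSum M A ψ v (16 * M * t) / M := by
  have hM0 : (0 : ℝ) < 16 * M := by positivity
  rw [cellLaw_real hA0 hA1 hψ Metric.isClosed_closedBall.measurableSet, cellSum]
  congr 1
  refine Finset.sum_congr rfl fun j _ => ?_
  have h1 : {u | pos M (8 * ((j : ℕ) : ℝ) + ψ u) ∈ Metric.closedBall (pos M v) t} =
      {u : I | |8 * ((j : ℕ) : ℝ) + ψ u - v| ≤ 16 * M * t} := by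
    ext u
    rw [Set.mem_ofPred_eq, Set.mem_ofPred_eq, Metric.mem_closedBall,
      dist_pos (cell_mem_Icc' j _) hv, div_le_iff₀' hM0]
  have h2 : pos M (8 * ((j : ℕ) : ℝ) + 4) ∈ Metric.closedBall (pos M v) t ↔
      |8 * ((j : ℕ) : ℝ) + 4 - v| ≤ 16 * M * t := by
    rw [Metric.mem_closedBall, dist_pos (cell_mem_Icc j ⟨by norm_num, le_rfl⟩) hv,
      div_le_iff₀' hM0]
  rw [h1, cellFrac]
  congr 2
  by_cases h : |8 * ((j : ℕ) : ℝ) + 4 - v| ≤ 16 * M * t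
  · rw [if_pos h, Set.indicator_of_mem (h2.2 h)]; rfl
  · rw [if_neg h, Set.indicator_of_notMem (mt h2.1 h)]

/-- The radius is two units: the ball swallows its own cell, of width one, but misses its atom, at
distance four, and everything that belongs to other cells. Hence the source law sees a bump only
with the reduced mass `A / M`. -/
lemma cellLaw_real_ball (hM : M ≠ 0) (hA0 : 0 ≤ A) (hA1 : A ≤ 1) (hψ : Measurable ψ)
    (i : Fin M) :
    (cellLaw M A ψ).real (Metric.ball (pos M (8 * (i : ℕ))) (1 / (8 * M))) = A / M := by
  have hM0 : (0 : ℝ) < 16 * M := by positivity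
  have hi : 8 * ((i : ℕ) : ℝ) ∈ Set.Icc (0 : ℝ) (8 * M) := by
    simpa only [add_zero] using cell_mem_Icc i (u := 0) ⟨le_rfl, by norm_num⟩
  have hr : 1 / (8 * (M : ℝ)) * (16 * M) = 2 := by field_simp; norm_num
  have hdist : ∀ j : Fin M, j ≠ i → 8 ≤ |8 * ((j : ℕ) : ℝ) - 8 * (i : ℕ)| := by
    intro j hj
    have : (1 : ℤ) ≤ |((j : ℕ) : ℤ) - (i : ℕ)| :=
      Int.one_le_abs fun h => hj (Fin.ext (by omega))
    have h1 : (1 : ℝ) ≤ |((j : ℕ) : ℝ) - (i : ℕ)| := by exact_mod_cast this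
    rw [← mul_sub, abs_mul, abs_of_pos (by norm_num : (0 : ℝ) < 8)]
    linarith
  have hcell : ∀ (j : Fin M) (u : ℝ), u ∈ Set.Icc (0 : ℝ) 4 →
      (pos M (8 * (j : ℕ) + u) ∈ Metric.ball (pos M (8 * (i : ℕ))) (1 / (8 * M)) ↔
        j = i ∧ u < 2) := by
    intro j u hu
    rw [Metric.mem_ball, dist_pos (cell_mem_Icc j hu) hi, div_lt_iff₀ hM0, hr]
    constructor
    · intro h
      have hji : j = i := by
        by_contra hne
        have h8 := hdist j hne
        rw [abs_lt] at h
        rcases abs_cases (8 * ((j : ℕ) : ℝ) - 8 * (i : ℕ)) with h' | h' <;>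
          linarith [hu.1, hu.2]
      refine ⟨hji, ?_⟩
      rw [hji, add_sub_cancel_left, abs_of_nonneg hu.1] at h
      exact h
    · rintro ⟨rfl, h⟩
      rwa [add_sub_cancel_left, abs_of_nonneg hu.1]
  rw [cellLaw_real hA0 hA1 hψ Metric.isOpen_ball.measurableSet]
  congr 1
  rw [Finset.sum_eq_single i]
  · have h1 : {u | pos M (8 * ((i : ℕ) : ℝ) + ψ u) ∈
        Metric.ball (pos M (8 * (i : ℕ))) (1 / (8 * M))} = Set.univ := by
      refine Set.eq_univ_of_forall fun u => ?_
      rw [Set.mem_ofPred_eq, hcell i _ ⟨(ψ u).2.1, by linarith [(ψ u).2.2]⟩]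
      exact ⟨rfl, by linarith [(ψ u).2.2]⟩
    rw [h1, Set.indicator_of_notMem]
    · simp
    · rw [hcell i 4 ⟨by norm_num, le_rfl⟩]; norm_num
  · intro j _ hj
    have h1 : {u | pos M (8 * ((j : ℕ) : ℝ) + ψ u) ∈
        Metric.ball (pos M (8 * (i : ℕ))) (1 / (8 * M))} = ∅ := by
      refine Set.eq_empty_of_forall_notMem fun u => ?_
      rw [Set.mem_ofPred_eq, hcell j _ ⟨(ψ u).2.1, by linarith [(ψ u).2.2]⟩]
      exact fun h => hj h.1
    rw [h1, Set.indicator_of_notMem]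
    · simp
    · rw [hcell j 4 ⟨by norm_num, le_rfl⟩]; exact fun h => hj h.1
  · simp

/-- The union of the cells. -/
def cells (M : ℕ) : Set I := ⋃ i : Fin M, Set.range fun u : I => pos M (8 * (i : ℕ) + u)

lemma mem_cells {M : ℕ} {y : I} :
    y ∈ cells M ↔ ∃ (i : Fin M) (u : I), pos M (8 * (i : ℕ) + u) = y := by
  simp [cells]

lemma isClosed_cells (M : ℕ) : IsClosed (cells M) :=
  isClosed_iUnion_of_finite fun _ => (isCompact_range
    ((continuous_pos M).comp (continuous_const.add continuous_subtype_val))).isClosed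

lemma cellLaw_one_id_compl_cells (hM : M ≠ 0) : (cellLaw M 1 id) (cells M)ᶜ = 0 := by
  have := isProbabilityMeasure_cellLaw hM zero_le_one le_rfl measurable_id
  rw [← measureReal_eq_zero_iff, cellLaw_real zero_le_one le_rfl measurable_id
    (isClosed_cells M).isOpen_compl.measurableSet]
  have h1 : ∀ j : Fin M, {u : I | pos M (8 * ((j : ℕ) : ℝ) + (id u : I)) ∈ (cells M)ᶜ} = ∅ :=
    fun j => Set.eq_empty_of_forall_notMem fun u hu => hu (mem_cells.2 ⟨j, u, rfl⟩)
  simp only [h1]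
  simp

end CellLaw

/-! ### The one-dimensional transfer pair -/

section Transfer

open unitInterval

/-- The properties of a pair of one-dimensional laws, the second of which is carried by the closed
set `K`, that ensure the transfer exponent `γ`. -/
structure IsTransferPair (γ C : ℝ) (P Q : Measure I) (K : Set I) : Prop where
  isClosed : IsClosed K
  compl_eq_zero : Q Kᶜ = 0
  nonempty : K.Nonempty
  le_ball : ∀ x ∈ K, ∀ t ∈ Set.Ioc (0 : ℝ) 1, t ≤ Q.real (Metric.closedBall x t)
  ball_le : ∀ x ∈ K, ∀ t ∈ Set.Ioc (0 : ℝ) 1, Q.real (Metric.closedBall x t) ≤ C * t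
  transfer : ∀ x ∈ K, ∀ t ∈ Set.Ioc (0 : ℝ) 1,
    t ^ γ * Q.real (Metric.closedBall x t) ≤ P.real (Metric.closedBall x t)
  exact : 0 < γ → ∃ x ∈ K, ∃ C' t₀ : ℝ, 0 < t₀ ∧ t₀ ≤ 1 ∧ ∀ t ∈ Set.Ioc (0 : ℝ) t₀,
    P.real (Metric.closedBall x t) ≤ C' * t ^ γ * Q.real (Metric.closedBall x t)

/-- The lower bounds are those of `le_sum_cellFrac_id` and `rpow_mul_cellSum_le`, divided by `M`.
Sharpness of the exponent comes from the warp, whose mass within `τ` of `0` is of order `τ ^ (γ +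
1)`. The warp level `η = (1 - A) / 2` is positive for `γ > 0` because `16 / M < 1`. -/
lemma isTransferPair_cellLaw {M : ℕ} (hM : 32 ≤ M) {γ : ℝ} (hγ : 0 ≤ γ) :
    ∃ ψ : I → I, Measurable ψ ∧
      IsTransferPair γ (32 * M) (cellLaw M ((16 / M) ^ γ) ψ) (cellLaw M 1 id) (cells M) := by
  have hM' : (32 : ℝ) ≤ M := by exact_mod_cast hM
  have hM0 : M ≠ 0 := by omega
  have hMpos : (0 : ℝ) < M := by linarith
  have h16 : (16 : ℝ) / M < 1 := by rw [div_lt_one hMpos]; linarith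
  set A : ℝ := (16 / M) ^ γ with hA
  have hA0 : 0 ≤ A := by positivity
  have hA1 : A ≤ 1 := Real.rpow_le_one (by positivity) h16.le hγ
  obtain ⟨ψ, hψm, hψ, hloc, hex⟩ := exists_warp (γ := γ) (η := (1 - A) / 2) hγ
    (fun h => by
      have : A < 1 := Real.rpow_lt_one (by positivity) h16 h
      linarith) (by linarith)
  refine ⟨ψ, hψm, isClosed_cells M, cellLaw_one_id_compl_cells hM0, ?_, ?_, ?_, ?_, ?_⟩
  · exact ⟨_, mem_cells.2 ⟨⟨0, by omega⟩, 0, rfl⟩⟩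
  · rintro _ hx t ⟨ht0, ht1⟩
    obtain ⟨i, x, rfl⟩ := mem_cells.1 hx
    rw [cellLaw_real_closedBall hM0 zero_le_one le_rfl measurable_id (cell_mem_Icc' i x),
      le_div_iff₀ hMpos, cellSum_one_id]
    have := le_sum_cellFrac_id (ρ := 16 * M * t) i x (by positivity) (by nlinarith)
    linarith
  · rintro _ hx t ⟨ht0, ht1⟩
    obtain ⟨i, x, rfl⟩ := mem_cells.1 hx
    rw [cellLaw_real_closedBall hM0 zero_le_one le_rfl measurable_id (cell_mem_Icc' i x),
      div_le_iff₀ hMpos, cellSum_one_id]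
    calc ∑ j : Fin M, cellFrac id j (8 * (i : ℕ) + x) (16 * M * t)
        ≤ ∑ _j : Fin M, 2 * (16 * M * t) :=
          Finset.sum_le_sum fun j _ => cellFrac_id_le _ _ (by positivity)
      _ = 32 * M * t * M := by simp; ring
  · rintro _ hx t ⟨ht0, ht1⟩
    obtain ⟨i, x, rfl⟩ := mem_cells.1 hx
    rw [cellLaw_real_closedBall hM0 zero_le_one le_rfl measurable_id (cell_mem_Icc' i x),
      cellLaw_real_closedBall hM0 hA0 hA1 hψm (cell_mem_Icc' i x), ← mul_div_assoc]
    have := rpow_mul_cellSum_le hM hγ hA rfl hψ hloc i x ht0 ht1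
    gcongr
  · intro hγ'
    obtain ⟨C, hC0, hC⟩ := hex hγ'
    set i : Fin M := ⟨0, by omega⟩
    -- The witness is the left end of the first cell, where the warp thins out the mass. Radii up to
    -- one unit reach neither an atom nor another cell, and the factor `(16 * M) ^ γ` converts `t`
    -- to cell units.
    refine ⟨pos M (8 * (i : ℕ) + (0 : I)), mem_cells.2 ⟨i, 0, rfl⟩, C * (16 * M) ^ γ,
      1 / (16 * M), by positivity, div_le_one_of_le₀ (by linarith) (by positivity), ?_⟩
    rintro t ⟨ht0, ht1⟩
    have hρ1 : 16 * M * t ≤ 1 := by rwa [le_div_iff₀' (by positivity)] at ht1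
    have hρ0 : 0 < 16 * M * t := by positivity
    rw [cellLaw_real_closedBall hM0 zero_le_one le_rfl measurable_id (cell_mem_Icc' i 0),
      cellLaw_real_closedBall hM0 hA0 hA1 hψm (cell_mem_Icc' i 0), ← mul_div_assoc]
    refine div_le_div_of_nonneg_right ?_ hMpos.le
    set ρ := 16 * M * t with hρ
    have hlow : ρ ≤ cellSum M 1 id (8 * (i : ℕ) + (0 : I)) ρ := by
      rw [cellSum_one_id]
      refine le_trans ?_ (Finset.single_le_sum
        (f := fun j : Fin M => cellFrac id j (8 * (i : ℕ) + (0 : I)) ρ)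
        (fun j _ => cellFrac_nonneg _ _ _ _) (Finset.mem_univ i))
      rw [cellFrac_self]
      exact le_volume_real_abs_sub_le 0 hρ0.le hρ1
    have hup : cellSum M A ψ (8 * (i : ℕ) + (0 : I)) ρ ≤ C * ρ ^ (γ + 1) := by
      rw [cellSum, Finset.sum_eq_single i]
      · rw [cellFrac_self, if_neg]
        · have := hC ρ hρ0.le
          simp only [Set.Icc.coe_zero, sub_zero, mul_zero, add_zero]
          exact (mul_le_of_le_one_left measureReal_nonneg hA1).trans this
        · simp only [Set.Icc.coe_zero, add_zero, add_sub_cancel_left]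
          rw [abs_of_pos (by norm_num)]
          linarith
      · intro j _ hj
        have hj1 : (1 : ℝ) ≤ (j : ℕ) := by
          have : (j : ℕ) ≠ 0 := fun h => hj (Fin.ext h)
          exact_mod_cast Nat.one_le_iff_ne_zero.2 this
        have hi0 : ((i : ℕ) : ℝ) = 0 := by simp [i]
        rw [cellFrac_eq_zero ψ 0 (by
          rw [hi0, sub_zero, abs_of_nonneg (by linarith)]; linarith), if_neg]
        · simp
        · rw [hi0]
          simp only [Set.Icc.coe_zero, mul_zero, add_zero, sub_zero]
          rw [abs_of_pos (by linarith)]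
          linarith
      · simp
    refine hup.trans ?_
    rw [Real.rpow_add_one hρ0.ne', mul_assoc C, ← Real.mul_rpow (by positivity) ht0.le, ← hρ,
      ← mul_assoc]
    gcongr

end Transfer

/-! ### Product laws and the transfer exponent in dimension `n + 1` -/

section Covariates

open unitInterval

variable {n : ℕ}

/-- The product law on `[0, 1] ^ (n + 1)` with first factor `P` and all other factors `Q`. -/
def prodLaw (n : ℕ) (P Q : Measure I) : Measure (Cov (n + 1)) :=
  Measure.pi (Fin.cons (α := fun _ => Measure I) P fun _ => Q)

instance isProbabilityMeasure_cons (P Q : Measure I) [hP : IsProbabilityMeasure P]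
    [hQ : IsProbabilityMeasure Q] (k : Fin (n + 1)) :
    IsProbabilityMeasure (Fin.cons (α := fun _ => Measure I) P (fun _ => Q) k) :=
  Fin.cases hP (fun _ => hQ) k

variable {P Q : Measure I} [IsProbabilityMeasure P] [IsProbabilityMeasure Q]

instance isProbabilityMeasure_prodLaw : IsProbabilityMeasure (prodLaw n P Q) := by
  unfold prodLaw; infer_instance

lemma prodLaw_real_pi (S : Fin (n + 1) → Set I) :
    (prodLaw n P Q).real (Set.univ.pi S) = P.real (S 0) * ∏ k : Fin n, Q.real (S k.succ) := by
  rw [measureReal_def, prodLaw, Measure.pi_pi, ENNReal.toReal_prod, Fin.prod_univ_succ]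
  rfl

lemma prodLaw_real_closedBall (x : Cov (n + 1)) {t : ℝ} (ht : 0 ≤ t) :
    (prodLaw n P Q).real (Metric.closedBall x t) =
      P.real (Metric.closedBall (x 0) t) * ∏ k : Fin n, Q.real (Metric.closedBall (x k.succ) t) := by
  rw [closedBall_pi x ht, prodLaw_real_pi]

lemma prodLaw_real_ball (x : Cov (n + 1)) {t : ℝ} (ht : 0 < t) :
    (prodLaw n P Q).real (Metric.ball x t) =
      P.real (Metric.ball (x 0) t) * ∏ k : Fin n, Q.real (Metric.ball (x k.succ) t) := by
  rw [ball_pi x ht, prodLaw_real_pi]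

lemma mem_of_mem_support_prodLaw {K : Set I} (hK : IsClosed K) (h0 : Q Kᶜ = 0)
    {x : Cov (n + 1)} (hx : x ∈ (prodLaw n Q Q).support) (k : Fin (n + 1)) : x k ∈ K := by
  have hcl : IsClosed (Function.eval k ⁻¹' K : Set (Cov (n + 1))) :=
    hK.preimage (continuous_apply k)
  refine Measure.support_subset_of_isClosed hcl ?_ hx
  have h : (Fin.cons (α := fun _ => Measure I) Q (fun _ => Q) k : Measure I) Kᶜ = 0 :=
    Fin.cases h0 (fun _ => h0) k
  exact Measure.pi_eval_preimage_null _ h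

namespace IsTransferPair

variable {γ C : ℝ} {K : Set I} (h : IsTransferPair γ C P Q K)
include h

omit [IsProbabilityMeasure P] [IsProbabilityMeasure Q] in
lemma const_nonneg : 0 ≤ C := by
  obtain ⟨x, hx⟩ := h.nonempty
  have h1 := h.ball_le x hx 1 ⟨one_pos, le_rfl⟩
  have h2 := h.le_ball x hx 1 ⟨one_pos, le_rfl⟩
  linarith

omit [IsProbabilityMeasure P] in
lemma mem_support {x : Cov (n + 1)} (hx : ∀ k, x k ∈ K) : x ∈ (prodLaw n Q Q).support := by
  rw [Measure.mem_support_iff_forall]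
  intro U hU
  obtain ⟨r, hr, hsub⟩ := Metric.nhds_basis_closedBall.mem_iff.1 hU
  have ht : min r 1 ∈ Set.Ioc (0 : ℝ) 1 := ⟨lt_min hr one_pos, min_le_right _ _⟩
  have hsub' : Metric.closedBall x (min r 1) ⊆ U :=
    (Metric.closedBall_subset_closedBall (min_le_left _ _)).trans hsub
  refine lt_of_lt_of_le ?_ (measure_mono hsub')
  refine ENNReal.toReal_pos_iff.1 (?_ : 0 < (prodLaw n Q Q).real _) |>.1
  rw [prodLaw_real_closedBall x ht.1.le]
  have hk : ∀ k, 0 < Q.real (Metric.closedBall (x k) (min r 1)) := fun k =>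
    ht.1.trans_le (h.le_ball _ (hx k) _ ht)
  exact mul_pos (hk 0) (Finset.prod_pos fun k _ => hk _)

omit [IsProbabilityMeasure P] in
lemma ballMassCondition {cQ : ℝ} (h1 : cQ ≤ 1) : BallMassCondition (prodLaw n Q Q) cQ := by
  have hC := h.const_nonneg
  -- The summand `2` secures the strict inequality `cQ < CQ`. The upper constant is free to depend
  -- on `M`.
  refine ⟨C ^ (n + 1) + 2, by linarith [pow_nonneg hC (n + 1)], fun x hx r hr => ?_⟩
  have hK := mem_of_mem_support_prodLaw h.isClosed h.compl_eq_zero hx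
  have hlow : ∀ k, r ≤ Q.real (Metric.closedBall (x k) r) := fun k => h.le_ball _ (hK k) r hr
  have hup : ∀ k, Q.real (Metric.closedBall (x k) r) ≤ C * r := fun k => h.ball_le _ (hK k) r hr
  have hr0 := hr.1.le
  rw [prodLaw_real_closedBall x hr0]
  constructor
  · calc cQ * r ^ (n + 1) ≤ 1 * r ^ (n + 1) := by gcongr
      _ = r * ∏ _k : Fin n, r := by simp [pow_succ']
      _ ≤ _ := mul_le_mul (hlow 0) (Finset.prod_le_prod (fun _ _ => hr0) fun k _ => hlow _)
          (Finset.prod_nonneg fun _ _ => hr0) measureReal_nonneg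
  · calc _ ≤ (C * r) * ∏ _k : Fin n, (C * r) :=
          mul_le_mul (hup 0) (Finset.prod_le_prod (fun _ _ => measureReal_nonneg) fun k _ => hup _)
            (Finset.prod_nonneg fun _ _ => measureReal_nonneg) (by positivity)
      _ = C ^ (n + 1) * r ^ (n + 1) := by simp [mul_pow, pow_succ']; ring
      _ ≤ _ := by gcongr; linarith

lemma transferBound {c : ℝ} (hc1 : c ≤ 1) :
    TransferBound (prodLaw n P Q) (prodLaw n Q Q) γ c := by
  intro x hx r hr
  have hK := mem_of_mem_support_prodLaw h.isClosed h.compl_eq_zero hx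
  have hr0 := hr.1.le
  rw [prodLaw_real_closedBall x hr0, prodLaw_real_closedBall x hr0, ← mul_assoc]
  refine mul_le_mul_of_nonneg_right ?_ (Finset.prod_nonneg fun _ _ => measureReal_nonneg)
  refine le_trans ?_ (h.transfer _ (hK 0) r hr)
  have : 0 ≤ r ^ γ * Q.real (Metric.closedBall (x 0) r) :=
    mul_nonneg (Real.rpow_nonneg hr0 _) measureReal_nonneg
  rw [mul_assoc]
  exact mul_le_of_le_one_left this hc1

/-- At the diagonal point over the sharp point of the pair, the common factors cancel. The bound
then reads `c ≤ C' * t ^ (γ - g)`, and for `g < γ` letting `t` tend to `0` contradicts `c > 0`. -/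
lemma le_of_transferBound {g c : ℝ} (hg : 0 ≤ g) (hc : 0 < c)
    (hb : TransferBound (prodLaw n P Q) (prodLaw n Q Q) g c) : γ ≤ g := by
  by_contra hlt
  rw [not_le] at hlt
  obtain ⟨x, hxK, C', t₀, ht₀, ht₁, hC'⟩ := h.exact (hg.trans_lt hlt)
  have hx : (fun _ : Fin (n + 1) => x) ∈ (prodLaw n Q Q).support := h.mem_support fun _ => hxK
  have key : ∀ t ∈ Set.Ioc (0 : ℝ) t₀, c ≤ C' * t ^ (γ - g) := by
    intro t ht
    have ht1 : t ∈ Set.Ioc (0 : ℝ) 1 := ⟨ht.1, ht.2.trans ht₁⟩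
    have h1 := hb _ hx t ht1
    have hq : 0 < Q.real (Metric.closedBall x t) := ht.1.trans_le (h.le_ball x hxK t ht1)
    rw [prodLaw_real_closedBall _ ht.1.le, prodLaw_real_closedBall _ ht.1.le, ← mul_assoc] at h1
    have h2 := le_of_mul_le_mul_right h1 (Finset.prod_pos fun _ _ => hq)
    have h3 := le_of_mul_le_mul_right (h2.trans (hC' t ht)) hq
    rw [Real.rpow_sub ht.1, ← mul_div_assoc, le_div_iff₀ (Real.rpow_pos_of_pos ht.1 _)]
    exact h3
  have hlim : Filter.Tendsto (fun t : ℝ => C' * t ^ (γ - g)) (nhdsWithin 0 (Set.Ioi 0))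
      (nhds (C' * 0)) := by
    refine Filter.Tendsto.const_mul C' ?_
    have hcont : ContinuousAt (fun t : ℝ => t ^ (γ - g)) 0 :=
      Real.continuousAt_rpow_const _ _ (Or.inr (by linarith))
    have := hcont.tendsto
    rw [Real.zero_rpow (by linarith)] at this
    exact this.mono_left nhdsWithin_le_nhds
  have := ge_of_tendsto hlim (Filter.eventually_of_mem
    (Ioc_mem_nhdsGT ht₀) key)
  linarith

lemma transferExponent_eq (hγ : 0 ≤ γ) :
    transferExponent (prodLaw n P Q) (prodLaw n Q Q) = ENNReal.ofReal γ := by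
  refine le_antisymm (sInf_le ⟨γ, hγ, rfl, 1, one_pos, le_rfl, h.transferBound le_rfl⟩)
    (le_sInf ?_)
  rintro _ ⟨g, hg, rfl, c, hc0, -, hb⟩
  exact ENNReal.ofReal_le_ofReal (h.le_of_transferBound hg hc0 hb)

end IsTransferPair

end Covariates

/-! ### Source prices and the exploration coefficient -/

section Exploration

open unitInterval

/-- The law of a source price: uniform with probability `κ`, and `0` otherwise. -/
def priceLaw (κ : ℝ) : Measure Price :=
  ENNReal.ofReal κ • volume + ENNReal.ofReal (1 - κ) • Measure.dirac 0

variable {κ : ℝ}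

lemma isProbabilityMeasure_priceLaw (h0 : 0 ≤ κ) (h1 : κ ≤ 1) :
    IsProbabilityMeasure (priceLaw κ) := by
  refine ⟨?_⟩
  simp only [priceLaw, Measure.add_apply, Measure.smul_apply, measure_univ, smul_eq_mul, mul_one]
  rw [← ENNReal.ofReal_add h0 (by linarith)]
  simp

lemma priceLaw_real (h0 : 0 ≤ κ) (h1 : κ ≤ 1) {S : Set Price} (hS : MeasurableSet S) :
    (priceLaw κ).real S = κ * (volume : Measure I).real S + (1 - κ) * S.indicator 1 0 := by
  have hind : S.indicator (1 : I → ℝ≥0∞) 0 ≠ ∞ := by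
    by_cases hm : (0 : I) ∈ S <;> simp [hm]
  simp only [priceLaw, measureReal_def, Measure.add_apply, Measure.smul_apply, smul_eq_mul,
    Measure.dirac_apply' _ hS]
  rw [ENNReal.toReal_add (ENNReal.mul_ne_top ENNReal.ofReal_ne_top (measure_ne_top _ _))
    (ENNReal.mul_ne_top ENNReal.ofReal_ne_top hind), ENNReal.toReal_mul, ENNReal.toReal_mul,
    ENNReal.toReal_ofReal h0, ENNReal.toReal_ofReal (by linarith)]
  congr 2
  by_cases hm : (0 : I) ∈ S <;> simp [hm]

lemma volume_real_closedBall_of_mem {p : Price} {r : ℝ} (h0 : 0 ≤ r)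
    (hp : (p : ℝ) ∈ Set.Icc r (1 - r)) :
    (volume : Measure I).real (Metric.closedBall p r) = 2 * r := by
  obtain ⟨a, b, hap, hpb, he, ha, hb⟩ := setOf_abs_sub_le_eq_Icc p h0
  have h : Metric.closedBall p r = Set.Icc a b := by
    rw [← he]
    ext u
    rw [Metric.mem_closedBall, Subtype.dist_eq, Real.dist_eq, Set.mem_ofPred_eq]
  rw [h, volume_real_Icc a b (hap.trans hpb), ha, hb, max_eq_right (by linarith [hp.1]),
    min_eq_right (by linarith [hp.2])]
  ring

/-- For a product law the covariate masses cancel, and the ratio is `κ` plus a nonnegative term that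
is present only when the price ball contains the atom at `0`. -/
lemma explorationCoeff_prod {d : ℕ} (h0 : 0 ≤ κ) (h1 : κ ≤ 1) (P : Measure (Cov d))
    [IsProbabilityMeasure P] : explorationCoeff (P.prod (priceLaw κ)) = κ := by
  have := isProbabilityMeasure_priceLaw h0 h1
  have hfst : (P.prod (priceLaw κ)).fst = P := Measure.fst_prod
  have hball : ∀ x ∈ P.support, ∀ r : ℝ, 0 < r → 0 < P.real (Metric.closedBall x r) :=
    fun x hx r hr => ENNReal.toReal_pos
      ((Measure.mem_support_iff_forall x).1 hx _ (Metric.closedBall_mem_nhds x hr)).ne'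
      (measure_ne_top _ _)
  have hratio : ∀ x ∈ P.support, ∀ r : ℝ, 0 < r → ∀ p : Price,
      (p : ℝ) ∈ Set.Icc r (1 - r) →
      (P.prod (priceLaw κ)).real (Metric.closedBall x r ×ˢ Metric.closedBall p r) /
        (2 * r * P.real (Metric.closedBall x r)) =
      κ + (1 - κ) * (Metric.closedBall p r).indicator 1 0 / (2 * r) := by
    intro x hx r hr p hp
    have := hball x hx r hr
    rw [measureReal_prod_prod, priceLaw_real h0 h1 Metric.isClosed_closedBall.measurableSet,
      volume_real_closedBall_of_mem hr.le hp]
    field_simp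
  obtain ⟨x, hx⟩ := Measure.nonempty_support (IsProbabilityMeasure.ne_zero P)
  rw [explorationCoeff, hfst]
  -- The price ball `[1 / 2, 1]` avoids the atom at `0`, so the infimum is attained there.
  refine IsLeast.csInf_eq ⟨⟨x, hx, 1 / 4, by norm_num, ⟨3 / 4, by norm_num, by norm_num⟩,
    by norm_num, ?_⟩, ?_⟩
  · rw [hratio x hx (1 / 4) (by norm_num) _ (by norm_num), Set.indicator_of_notMem]
    · simp
    · rw [Metric.mem_closedBall, Subtype.dist_eq, Real.dist_eq]
      norm_num [abs_of_neg]
  · rintro _ ⟨x, hx, r, hr, p, hp, rfl⟩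
    rw [hratio x hx r hr.1 p hp]
    have hind : 0 ≤ (Metric.closedBall p r).indicator (1 : I → ℝ) 0 :=
      Set.indicator_nonneg (fun _ _ => zero_le_one) _
    have := div_nonneg (mul_nonneg (sub_nonneg.2 h1) hind) (by linarith [hr.1] : 0 ≤ 2 * r)
    linarith

end Exploration

/-! ### Bernoulli revenues -/

section Bernoulli

open unitInterval

variable {d nP : ℕ}

/-- The kernel of Bernoulli laws on `{0, 1}` with means `f z`. -/
def bernoulliKernel (f : Cov d × Price → ℝ) (hf : Measurable f) :
    Kernel (Cov d × Price) I where
  toFun z := ENNReal.ofReal (f z) • Measure.dirac 1 + ENNReal.ofReal (1 - f z) • Measure.dirac 0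
  measurable' := by
    refine Measure.measurable_of_measurable_coe _ fun s hs => ?_
    simp only [Measure.add_apply, Measure.smul_apply, smul_eq_mul]
    exact (hf.ennreal_ofReal.mul_const _).add ((measurable_const.sub hf).ennreal_ofReal.mul_const _)

lemma bernoulliKernel_apply (f : Cov d × Price → ℝ) (hf : Measurable f) (z : Cov d × Price) :
    bernoulliKernel f hf z =
      ENNReal.ofReal (f z) • Measure.dirac 1 + ENNReal.ofReal (1 - f z) • Measure.dirac 0 := rfl

lemma isMarkovKernel_bernoulliKernel {f : Cov d × Price → ℝ} (hf : Measurable f)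
    (h : ∀ z, f z ∈ Set.Icc (0 : ℝ) 1) : IsMarkovKernel (bernoulliKernel f hf) := by
  refine ⟨fun z => ⟨?_⟩⟩
  simp only [bernoulliKernel_apply, Measure.add_apply, Measure.smul_apply, measure_univ,
    smul_eq_mul, mul_one]
  rw [← ENNReal.ofReal_add (h z).1 (by linarith [(h z).2])]
  simp

lemma lintegral_bernoulliKernel (f : Cov d × Price → ℝ) (hf : Measurable f) (z : Cov d × Price)
    {F : I → ℝ≥0∞} (hF : Measurable F) : ∫⁻ y, F y ∂(bernoulliKernel f hf z) =
      ENNReal.ofReal (f z) * F 1 + ENNReal.ofReal (1 - f z) * F 0 := by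
  rw [bernoulliKernel_apply, lintegral_add_measure, lintegral_smul_measure,
    lintegral_smul_measure, lintegral_dirac' _ hF, lintegral_dirac' _ hF]
  rfl

lemma integral_bernoulliKernel {f : Cov d × Price → ℝ} (hf : Measurable f) {z : Cov d × Price}
    (h : f z ∈ Set.Icc (0 : ℝ) 1) (F : I → ℝ) :
    ∫ y, F y ∂(bernoulliKernel f hf z) = f z * F 1 + (1 - f z) * F 0 := by
  have h1 : Integrable F (ENNReal.ofReal (f z) • Measure.dirac 1) :=
    (integrable_dirac (by simp)).smul_measure ENNReal.ofReal_ne_top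
  have h2 : Integrable F (ENNReal.ofReal (1 - f z) • Measure.dirac 0) :=
    (integrable_dirac (by simp)).smul_measure ENNReal.ofReal_ne_top
  rw [bernoulliKernel_apply, integral_add_measure h1 h2, integral_smul_measure,
    integral_smul_measure, integral_dirac, integral_dirac, ENNReal.toReal_ofReal h.1,
    ENNReal.toReal_ofReal (by linarith [h.2]), smul_eq_mul, smul_eq_mul]

/-- The pricing problem with Bernoulli revenues with mean `f`. -/
def bernoulliProblem (Q : Measure (Cov d)) [IsProbabilityMeasure Q] (μ : Measure (Cov d × Price))
    [IsProbabilityMeasure μ] (f : Cov d × Price → ℝ) (hf : Measurable f)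
    (h : ∀ z, f z ∈ Set.Icc (0 : ℝ) 1) : Problem d :=
  have := isMarkovKernel_bernoulliKernel hf h
  { targetCov := Q
    sourcePair := μ
    revenue := bernoulliKernel f hf }

variable {Q : Measure (Cov d)} [IsProbabilityMeasure Q] {μ : Measure (Cov d × Price)}
  [IsProbabilityMeasure μ]

lemma reward_bernoulliProblem {f : Cov d × Price → ℝ} (hf : Measurable f)
    (h : ∀ z, f z ∈ Set.Icc (0 : ℝ) 1) (z : Cov d × Price) :
    (bernoulliProblem Q μ f hf h).reward z = f z := by
  change ∫ y, (y : ℝ) ∂(bernoulliKernel f hf z) = f z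
  rw [integral_bernoulliKernel hf (h z)]
  simp

/-- The likelihood ratio of two Bernoulli revenues, the first of which has mean `1 / 2` where the
means differ. -/
def bernoulliLik (f₀ f₁ : Cov d × Price → ℝ) (o : Obs d) : ℝ :=
  1 + 4 * (f₁ o.1 - f₀ o.1) * ((o.2 : ℝ) - 1 / 2)

section TwoProblems

variable {f₀ f₁ : Cov d × Price → ℝ} (hf₀ : Measurable f₀) (hf₁ : Measurable f₁)
  (h₀ : ∀ z, f₀ z ∈ Set.Icc (0 : ℝ) 1) (h₁ : ∀ z, f₁ z ∈ Set.Icc (0 : ℝ) 1)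
  {B : Set (Cov d × Price)} (hB : MeasurableSet B) {δ : ℝ}
  (hout : ∀ z ∉ B, f₁ z = f₀ z) (hin : ∀ z ∈ B, f₀ z = 1 / 2 ∧ |f₁ z - 1 / 2| ≤ δ)
include hf₀ hf₁ h₀ h₁ hout hin

omit hf₀ hf₁ h₀ h₁ in
lemma abs_sub_le_of_mem (hδ0 : 0 ≤ δ) (z : Cov d × Price) : |f₁ z - f₀ z| ≤ δ := by
  by_cases hz : z ∈ B
  · rw [(hin z hz).1]
    exact (hin z hz).2
  · rw [hout z hz, sub_self, abs_zero]
    exact hδ0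

/-- Revenues are `0` or `1`. Where the first mean is `1 / 2`, the affine function `bernoulliLik`
takes the values `2 f₁` and `2 (1 - f₁)` there, which are the ratios of the point masses; where the
means agree it is `1`. The assumption `δ ≤ 1 / 4` keeps it within `1 / 2` of `1` at every revenue.
-/
lemma isLikelihoodRatio_bernoulli (hδ0 : 0 ≤ δ) (hδ : δ ≤ 1 / 4) :
    IsLikelihoodRatio (bernoulliProblem Q μ f₀ hf₀ h₀) (bernoulliProblem Q μ f₁ hf₁ h₁)
      (bernoulliLik f₀ f₁) := by
  have hm : Measurable (bernoulliLik f₀ f₁) := by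
    unfold bernoulliLik
    have h1 : Measurable fun o : Obs d => f₁ o.1 := hf₁.comp measurable_fst
    have h0 : Measurable fun o : Obs d => f₀ o.1 := hf₀.comp measurable_fst
    have h2 : Measurable fun o : Obs d => (o.2 : ℝ) :=
      measurable_subtype_coe.comp measurable_snd
    fun_prop
  have hbd : ∀ o : Obs d, |4 * (f₁ o.1 - f₀ o.1) * ((o.2 : ℝ) - 1 / 2)| ≤ 1 / 2 := by
    intro o
    have h1 := abs_sub_le_of_mem hout hin hδ0 o.1
    have h2 : |(o.2 : ℝ) - 1 / 2| ≤ 1 / 2 := by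
      rw [abs_le]; constructor <;> linarith [o.2.2.1, o.2.2.2]
    rw [abs_mul, abs_mul, abs_of_pos (by norm_num : (0 : ℝ) < 4)]
    nlinarith [abs_nonneg (f₁ o.1 - f₀ o.1), abs_nonneg ((o.2 : ℝ) - 1 / 2)]
  refine ⟨rfl, rfl, hm, fun o => ?_, fun o => ?_, fun z => ?_⟩
  · have := (abs_le.1 (hbd o)).1
    unfold bernoulliLik
    linarith
  · have := (abs_le.1 (hbd o)).2
    unfold bernoulliLik
    linarith
  · change bernoulliKernel f₁ hf₁ z = (bernoulliKernel f₀ hf₀ z).withDensity _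
    have hmz : Measurable fun y => ENNReal.ofReal (bernoulliLik f₀ f₁ (z, y)) :=
      (hm.comp measurable_prodMk_left).ennreal_ofReal
    have e1 : ENNReal.ofReal (f₁ z) =
        ENNReal.ofReal (f₀ z) * ENNReal.ofReal (bernoulliLik f₀ f₁ (z, 1)) := by
      rw [← ENNReal.ofReal_mul (h₀ z).1]
      congr 1
      simp only [bernoulliLik, Set.Icc.coe_one]
      by_cases hz : z ∈ B
      · rw [(hin z hz).1]; ring
      · rw [hout z hz]; ring
    have e0 : ENNReal.ofReal (1 - f₁ z) =
        ENNReal.ofReal (1 - f₀ z) * ENNReal.ofReal (bernoulliLik f₀ f₁ (z, 0)) := by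
      rw [← ENNReal.ofReal_mul (by linarith [(h₀ z).2])]
      congr 1
      simp only [bernoulliLik, Set.Icc.coe_zero]
      by_cases hz : z ∈ B
      · rw [(hin z hz).1]; ring
      · rw [hout z hz]; ring
    ext s hs
    rw [withDensity_apply _ hs, ← lintegral_indicator hs,
      lintegral_bernoulliKernel _ _ _ (hmz.indicator hs), bernoulliKernel_apply,
      Measure.add_apply, Measure.smul_apply, Measure.smul_apply, Measure.dirac_apply' _ hs,
      Measure.dirac_apply' _ hs, e1, e0]
    by_cases ha : (1 : I) ∈ s <;> by_cases hb : (0 : I) ∈ s <;> simp [ha, hb]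

omit hf₁ h₁ in
-- With `e = f₁ z - 1 / 2`, the relative entropy on `B` is `-log (1 - 4 e ^ 2) / 2`, which is at
-- most `4 e ^ 2` as `e ^ 2 ≤ 1 / 16`.
lemma integral_neg_log_bernoulliLik_le (hδ0 : 0 ≤ δ) (hδ : δ ≤ 1 / 4) (z : Cov d × Price) :
    ∫ y, -Real.log (bernoulliLik f₀ f₁ (z, y)) ∂((bernoulliProblem Q μ f₀ hf₀ h₀).revenue z) ≤
      B.indicator (fun _ => 4 * δ ^ 2) z := by
  change ∫ y, _ ∂(bernoulliKernel f₀ hf₀ z) ≤ _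
  rw [integral_bernoulliKernel hf₀ (h₀ z)]
  simp only [bernoulliLik, Set.Icc.coe_zero, Set.Icc.coe_one]
  by_cases hz : z ∈ B
  · rw [Set.indicator_of_mem hz, (hin z hz).1]
    have he := (hin z hz).2
    set e := f₁ z - 1 / 2 with hedef
    have he2 : e ^ 2 ≤ δ ^ 2 := sq_le_sq' (abs_le.1 he).1 (abs_le.1 he).2
    have he3 : e ^ 2 ≤ 1 / 16 := he2.trans (by nlinarith)
    have hpos1 : 0 < 1 + 2 * e := by linarith [(abs_le.1 he).1]
    have hpos2 : 0 < 1 - 2 * e := by linarith [(abs_le.1 he).2]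
    have hlog : -Real.log (1 + 2 * e) + -Real.log (1 - 2 * e) ≤ 8 * e ^ 2 := by
      have hp : (1 + 2 * e) * (1 - 2 * e) = 1 - 4 * e ^ 2 := by ring
      have hpos : 0 < 1 - 4 * e ^ 2 := by linarith
      rw [← neg_add, ← Real.log_mul hpos1.ne' hpos2.ne', hp]
      have h1 := Real.one_sub_inv_le_log_of_pos hpos
      have h2 : (1 - 4 * e ^ 2)⁻¹ ≤ 1 + 8 * e ^ 2 := by
        rw [inv_le_iff_one_le_mul₀ hpos]
        nlinarith [sq_nonneg e]
      linarith
    have ea : 1 + 4 * e * (1 - 1 / 2) = 1 + 2 * e := by ring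
    have eb : 1 + 4 * e * (0 - 1 / 2) = 1 - 2 * e := by ring
    rw [ea, eb]
    linarith
  · rw [Set.indicator_of_notMem hz, hout z hz]
    simp

/-- Change of measure for two Bernoulli problems whose means differ on `B` only. -/
lemma integral_law_bernoulli_le (hB : MeasurableSet B) (hδ0 : 0 ≤ δ) (hδ : δ ≤ 1 / 4)
    (π : Policy d nP) (t : ℕ)
    {g : Hist d nP t → ℝ} (hg : Measurable g) (hg0 : ∀ h, 0 ≤ g h) {m : ℝ} (hm0 : 0 ≤ m)
    (hm : ∀ h, g h ≤ m) {β : ℝ} (hβ : 0 < β) :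
    ∫ h, g h ∂((bernoulliProblem Q μ f₁ hf₁ h₁).law π t) ≤
      ∫ h, g h ∂((bernoulliProblem Q μ f₀ hf₀ h₀).law π t) +
      m * (β * (4 * δ ^ 2 * (nP * μ.real B + ∑ s ∈ Finset.range t,
        ((bernoulliProblem Q μ f₀ hf₀ h₀).law π (s + 1)).real
          {h : Hist d nP s × Obs d | h.2.1 ∈ B})) + 1 / β) := by
  have hℓ := isLikelihoodRatio_bernoulli (Q := Q) (μ := μ) hf₀ hf₁ h₀ h₁ hout hin hδ0 hδ
  have h1 := hℓ.integral_law_le π t hg hg0 hm hβ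
  have h2 := hℓ.integral_neg_log_lik_le π hB
    (integral_neg_log_bernoulliLik_le hf₀ h₀ hout hin hδ0 hδ) t
  refine h1.trans ?_
  gcongr
  exact h2

end TwoProblems

end Bernoulli

/-! ### Mean revenues with one bump per cell -/

section Bump

open unitInterval

variable {d M : ℕ}

/-- The lower left corner of a cell. -/
def corner (j : Fin d → Fin M) : Cov d := fun k => pos M (8 * (j k : ℕ))

/-- A bump of height `1 / (8 M)` around the corner of a cell and a price. -/
def bump (j : Fin d → Fin M) (a : ℝ) (z : Cov d × Price) : ℝ :=
  max 0 (1 / (8 * M) - max (dist z.1 (corner j)) |(z.2 : ℝ) - a|)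

lemma bump_nonneg (j : Fin d → Fin M) (a : ℝ) (z : Cov d × Price) : 0 ≤ bump j a z :=
  le_max_left _ _

lemma bump_le (j : Fin d → Fin M) (a : ℝ) (z : Cov d × Price) : bump j a z ≤ 1 / (8 * M) := by
  refine max_le (by positivity) ?_
  have : 0 ≤ max (dist z.1 (corner j)) |(z.2 : ℝ) - a| := dist_nonneg.trans (le_max_left _ _)
  linarith

lemma bump_eq_zero {j : Fin d → Fin M} {a : ℝ} {z : Cov d × Price}
    (h : ¬ (z.1 ∈ Metric.ball (corner j) (1 / (8 * M)) ∧ |(z.2 : ℝ) - a| < 1 / (8 * M))) :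
    bump j a z = 0 := by
  refine max_eq_left ?_
  rw [sub_nonpos]
  by_contra hlt
  rw [not_le, max_lt_iff] at hlt
  exact h hlt

lemma bump_le_add (j : Fin d → Fin M) (a : ℝ) (z z' : Cov d × Price) :
    bump j a z ≤ bump j a z' + dist z z' := by
  have h1 : dist z'.1 (corner j) ≤ dist z.1 (corner j) + dist z z' := by
    have : dist z'.1 z.1 ≤ dist z z' := by rw [dist_comm]; exact le_max_left _ _
    linarith [dist_triangle z'.1 z.1 (corner j)]
  have h2 : |(z'.2 : ℝ) - a| ≤ |(z.2 : ℝ) - a| + dist z z' := by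
    have h3 : |(z.2 : ℝ) - z'.2| ≤ dist z z' := le_max_right _ _
    have := abs_sub_le (z'.2 : ℝ) z.2 a
    rw [abs_sub_comm (z'.2 : ℝ) z.2] at this
    linarith
  refine max_le (add_nonneg (bump_nonneg _ _ _) dist_nonneg) ?_
  have h4 : max (dist z'.1 (corner j)) |(z'.2 : ℝ) - a| ≤
      max (dist z.1 (corner j)) |(z.2 : ℝ) - a| + dist z z' :=
    max_le (h1.trans (by gcongr; exact le_max_left _ _))
      (h2.trans (by gcongr; exact le_max_right _ _))
  have h5 : 1 / (8 * M) - max (dist z'.1 (corner j)) |(z'.2 : ℝ) - a| ≤ bump j a z' :=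
    le_max_right _ _
  linarith

/-- The mean revenue with one bump in each cell `j`, at the price `τ j`. -/
def bumpReward (L : ℝ) (τ : (Fin d → Fin M) → ℝ) (z : Cov d × Price) : ℝ :=
  1 / 2 + L * ⨆ j, bump j (τ j) z

variable {L : ℝ} (hL0 : 0 ≤ L) (hL1 : L ≤ 1) (τ : (Fin d → Fin M) → ℝ)

lemma bump_le_iSup (j : Fin d → Fin M) (z : Cov d × Price) :
    bump j (τ j) z ≤ ⨆ j, bump j (τ j) z :=
  le_ciSup (f := fun j => bump j (τ j) z) (Set.finite_range _).bddAbove j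

lemma iSup_bump_nonneg (z : Cov d × Price) : 0 ≤ ⨆ j, bump j (τ j) z :=
  Real.iSup_nonneg fun _ => bump_nonneg _ _ _

lemma iSup_bump_le (z : Cov d × Price) : ⨆ j, bump j (τ j) z ≤ 1 / (8 * M) :=
  Real.iSup_le (fun _ => bump_le _ _ _) (by positivity)

lemma iSup_bump_le_add (z z' : Cov d × Price) :
    ⨆ j, bump j (τ j) z ≤ (⨆ j, bump j (τ j) z') + dist z z' :=
  Real.iSup_le (fun j => (bump_le_add j _ z z').trans (by gcongr; exact bump_le_iSup τ j z'))
    (add_nonneg (iSup_bump_nonneg τ z') dist_nonneg)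

include hL0 in
lemma abs_bumpReward_sub_le (z z' : Cov d × Price) :
    |bumpReward L τ z - bumpReward L τ z'| ≤ L * dist z z' := by
  have h1 := iSup_bump_le_add τ z z'
  have h2 := iSup_bump_le_add τ z' z
  rw [dist_comm] at h2
  unfold bumpReward
  rw [add_sub_add_left_eq_sub, ← mul_sub, abs_mul, abs_of_nonneg hL0]
  refine mul_le_mul_of_nonneg_left ?_ hL0
  rw [abs_le]
  constructor <;> linarith

include hL0 in
lemma measurable_bumpReward : Measurable (bumpReward L τ) := by
  refine (LipschitzWith.of_dist_le_mul (K := ⟨L, hL0⟩) fun z z' => ?_).continuous.measurable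
  rw [Real.dist_eq]
  exact abs_bumpReward_sub_le hL0 τ z z'

include hL0 in
lemma half_le_bumpReward (z : Cov d × Price) : 1 / 2 ≤ bumpReward L τ z := by
  have := mul_nonneg hL0 (iSup_bump_nonneg τ z)
  unfold bumpReward
  linarith

include hL0 in
lemma bumpReward_le (z : Cov d × Price) : bumpReward L τ z ≤ 1 / 2 + L / (8 * M) := by
  have := mul_le_mul_of_nonneg_left (iSup_bump_le τ z) hL0
  unfold bumpReward
  rw [mul_one_div] at this
  linarith

include hL0 hL1 in
lemma bumpReward_mem_Icc (hM : 1 ≤ M) (z : Cov d × Price) :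
    bumpReward L τ z ∈ Set.Icc (0 : ℝ) 1 := by
  have hM' : (1 : ℝ) ≤ M := by exact_mod_cast hM
  refine ⟨by linarith [half_le_bumpReward hL0 τ z], (bumpReward_le hL0 τ z).trans ?_⟩
  have : L / (8 * M) ≤ 1 / 2 := by
    rw [div_le_div_iff₀ (by positivity) two_pos]
    linarith
  linarith

/-- The neighbourhoods of different cells are disjoint. -/
lemma eq_of_mem_ball_corner {x : Cov d} {j j' : Fin d → Fin M}
    (h : x ∈ Metric.ball (corner j) (1 / (8 * M)))
    (h' : x ∈ Metric.ball (corner j') (1 / (8 * M))) : j = j' := by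
  funext k
  have hM : 0 < M := (Nat.zero_le _).trans_lt (j k).2
  have hM0 : (0 : ℝ) < 16 * M := by positivity
  by_contra hne
  have h1 : dist (corner j k) (corner j' k) < 1 / (8 * M) + 1 / (8 * M) := by
    have h2 := (dist_le_pi_dist (corner j) (corner j') k).trans
      (dist_triangle_left (corner j) (corner j') x)
    rw [Metric.mem_ball] at h h'
    linarith
  have hmem : ∀ i : Fin M, 8 * ((i : ℕ) : ℝ) ∈ Set.Icc (0 : ℝ) (8 * M) := fun i => by
    simpa only [add_zero] using cell_mem_Icc i (u := 0) ⟨le_rfl, by norm_num⟩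
  rw [corner, corner, dist_pos (hmem _) (hmem _), div_lt_iff₀ hM0] at h1
  have h3 : (1 / (8 * (M : ℝ)) + 1 / (8 * M)) * (16 * M) = 4 := by field_simp; norm_num
  rw [h3, ← mul_sub, abs_mul, abs_of_pos (by norm_num : (0 : ℝ) < 8)] at h1
  have : (1 : ℤ) ≤ |((j k : ℕ) : ℤ) - (j' k : ℕ)| :=
    Int.one_le_abs fun h => hne (Fin.ext (by omega))
  have h4 : (1 : ℝ) ≤ |((j k : ℕ) : ℝ) - (j' k : ℕ)| := by exact_mod_cast this
  linarith

lemma bumpReward_of_mem_ball {x : Cov d} {j : Fin d → Fin M}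
    (h : x ∈ Metric.ball (corner j) (1 / (8 * M))) (p : Price) :
    bumpReward L τ (x, p) = 1 / 2 + L * bump j (τ j) (x, p) := by
  have : ⨆ j', bump j' (τ j') (x, p) = bump j (τ j) (x, p) := by
    refine le_antisymm (Real.iSup_le (fun j' => ?_) (bump_nonneg _ _ _)) (bump_le_iSup τ j _)
    by_cases hj : j' = j
    · rw [hj]
    · rw [bump_eq_zero fun hc => hj (eq_of_mem_ball_corner hc.1 h)]
      exact bump_nonneg _ _ _
  rw [bumpReward, this]

/-- The prices at distance less than `1 / (8 M)` from `a`, for covariates near a cell. -/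
def bumpSet (j : Fin d → Fin M) (a : ℝ) : Set (Cov d × Price) :=
  Metric.ball (corner j) (1 / (8 * M)) ×ˢ {p : Price | |(p : ℝ) - a| < 1 / (8 * M)}

lemma measurableSet_arm (M : ℕ) (a : ℝ) :
    MeasurableSet {p : Price | |(p : ℝ) - a| < 1 / (8 * (M : ℝ))} :=
  (isOpen_lt ((continuous_subtype_val.sub continuous_const).abs) continuous_const).measurableSet

lemma measurableSet_bumpSet (j : Fin d → Fin M) (a : ℝ) : MeasurableSet (bumpSet j a) :=
  Metric.isOpen_ball.measurableSet.prod (measurableSet_arm M a)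

lemma bumpReward_update_eq (j : Fin d → Fin M) {a a' : ℝ} {z : Cov d × Price}
    (ha : z ∉ bumpSet j a) (ha' : z ∉ bumpSet j a') :
    bumpReward L (Function.update τ j a) z = bumpReward L (Function.update τ j a') z := by
  unfold bumpReward
  congr 3
  funext j'
  by_cases hj : j' = j
  · subst hj
    simp only [Function.update_self]
    rw [bump_eq_zero ha, bump_eq_zero ha']
  · simp only [Function.update_of_ne hj]

/-- The fictitious price `-1` encodes the absence of a bump, so the reference problem is a member of
the same family. -/
lemma bumpSet_neg_one (hM : 1 ≤ M) (j : Fin d → Fin M) : bumpSet j (-1) = ∅ := by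
  have hM' : (1 : ℝ) ≤ M := by exact_mod_cast hM
  refine Set.eq_empty_of_forall_notMem fun z hz => ?_
  have h1 : |(z.2 : ℝ) - (-1)| < 1 / (8 * M) := hz.2
  have h2 := z.2.2.1
  rw [abs_of_nonneg (by linarith), lt_div_iff₀ (by positivity)] at h1
  nlinarith

end Bump

/-! ### Laws of the next covariate and price -/

section Marginals

variable {d nP : ℕ}

/-- The law of the next covariate-price pair given the history. -/
def pairKernel (Q : Measure (Cov d)) (π : Policy d nP) (t : ℕ) :
    Kernel (Hist d nP t) (Cov d × Price) :=
  Kernel.const (Hist d nP t) Q ⊗ₖ π.price t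

variable (Q : Measure (Cov d)) [IsProbabilityMeasure Q] (π : Policy d nP) (t : ℕ)

instance isMarkovKernel_pairKernel : IsMarkovKernel (pairKernel Q π t) := by
  unfold pairKernel; infer_instance

omit [IsProbabilityMeasure Q] in
lemma measurable_pairKernel_real {B : Set (Cov d × Price)} (hB : MeasurableSet B) :
    Measurable fun h => (pairKernel Q π t h).real B :=
  (Kernel.measurable_coe _ hB).ennreal_toReal

lemma pairKernel_real_fst (h : Hist d nP t) {S : Set (Cov d)} (hS : MeasurableSet S) :
    (pairKernel Q π t h).real (Prod.fst ⁻¹' S) = Q.real S := by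
  have : Kernel.fst (pairKernel Q π t) = Kernel.const (Hist d nP t) Q := Kernel.fst_compProd _ _
  have h1 : Kernel.fst (pairKernel Q π t) h S = Q S := by rw [this, Kernel.const_apply]
  rw [Kernel.fst_apply' _ _ hS] at h1
  exact congrArg ENNReal.toReal h1

lemma step_apply_fst (I : Problem d) (h : Hist d nP t) {B : Set (Cov d × Price)}
    (hB : MeasurableSet B) :
    I.step π t h (Prod.fst ⁻¹' B) = pairKernel I.targetCov π t h B := by
  have : Kernel.fst (I.step π t) = pairKernel I.targetCov π t := Kernel.fst_compProd _ _
  rw [← this, Kernel.fst_apply' _ _ hB]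
  rfl

lemma law_succ_real (I : Problem d) {B : Set (Cov d × Price)} (hB : MeasurableSet B) :
    (I.law π (t + 1)).real {h : Hist d nP t × Obs d | h.2.1 ∈ B} =
      ∫ h, (pairKernel I.targetCov π t h).real B ∂(I.law π t) := by
  have hE : MeasurableSet {h : Hist d nP t × Obs d | h.2.1 ∈ B} :=
    (measurable_fst.comp measurable_snd) hB
  have h1 : (I.law π (t + 1)) {h : Hist d nP t × Obs d | h.2.1 ∈ B} =
      ∫⁻ h, pairKernel I.targetCov π t h B ∂(I.law π t) := by
    refine (Measure.compProd_apply (μ := I.law π t) (κ := I.step π t) hE).trans ?_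
    exact lintegral_congr fun h => step_apply_fst π t I h hB
  rw [measureReal_def, h1]
  exact (integral_toReal (Kernel.measurable_coe _ hB).aemeasurable
    (.of_forall fun h => measure_lt_top _ _)).symm

lemma law_succ_real_fst (I : Problem d) {S : Set (Cov d)} (hS : MeasurableSet S) :
    (I.law π (t + 1)).real {h : Hist d nP t × Obs d | h.2.1.1 ∈ S} = I.targetCov.real S := by
  refine (law_succ_real π t I (measurable_fst hS)).trans ?_
  simp only [pairKernel_real_fst I.targetCov π t _ hS]
  simp

end Marginals

/-! ### From missed bumps to regret -/

section Regret

variable {d nP M : ℕ} {L : ℝ}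

lemma bddAbove_reward (I : Problem d) (x : Cov d) :
    BddAbove (Set.range fun p : Price => I.reward (x, p)) := by
  refine ⟨1, ?_⟩
  rintro _ ⟨p, rfl⟩
  calc ∫ y, (y : ℝ) ∂(I.revenue (x, p)) ≤ ∫ _y, (1 : ℝ) ∂(I.revenue (x, p)) :=
        integral_mono_of_nonneg (.of_forall fun y => y.2.1) (integrable_const 1)
          (.of_forall fun y => y.2.2)
    _ = 1 := by simp

lemma reward_le_optReward (I : Problem d) (x : Cov d) (p : Price) :
    I.reward (x, p) ≤ I.optReward x := le_ciSup (bddAbove_reward I x) p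

lemma continuous_optReward {I : Problem d} (hL0 : 0 ≤ L) (hI : I.LipschitzReward L) :
    Continuous I.optReward := by
  have key : ∀ x x', I.optReward x ≤ I.optReward x' + L * dist x x' := by
    intro x x'
    refine ciSup_le fun p => ?_
    have h1 := (abs_le.1 (hI (x, p) (x', p))).2
    have h2 : dist (x, p) (x', p) = dist x x' := by simp [Prod.dist_eq]
    rw [h2] at h1
    linarith [reward_le_optReward I x' p]
  refine (LipschitzWith.of_dist_le_mul (K := ⟨L, hL0⟩) fun x x' => ?_).continuous
  have h1 := key x x'
  have h2 := key x' x
  rw [dist_comm] at h2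
  have h3 : |I.optReward x - I.optReward x'| ≤ L * dist x x' := by
    rw [abs_le]
    constructor <;> linarith
  rw [Real.dist_eq]
  exact h3

/-- Near a corner, the cells contain only points of the cell of that corner, at most one unit away.
This is half the bump radius, so half the height of the bump remains available there. -/
lemma dist_corner_le {x : Cov d} (hx : ∀ k, x k ∈ cells M) {j : Fin d → Fin M}
    (hj : x ∈ Metric.ball (corner j) (1 / (8 * M))) : dist x (corner j) ≤ 1 / (16 * M) := by
  rw [dist_pi_le_iff (by positivity)]
  intro k
  have hM : 0 < M := (Nat.zero_le _).trans_lt (j k).2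
  have hM0 : (0 : ℝ) < 16 * M := by positivity
  have hk := (dist_le_pi_dist x (corner j) k).trans_lt hj
  obtain ⟨i, u, hu⟩ := mem_cells.1 (hx k)
  have hu0 := u.2.1
  have hu1 := u.2.2
  have hmem : 8 * ((j k : ℕ) : ℝ) ∈ Set.Icc (0 : ℝ) (8 * M) := by
    simpa only [add_zero] using cell_mem_Icc (j k) (u := 0) ⟨le_rfl, by norm_num⟩
  rw [← hu, corner, dist_pos (cell_mem_Icc' i u) hmem] at hk ⊢
  rw [div_lt_iff₀ hM0] at hk
  have h3 : 1 / (8 * (M : ℝ)) * (16 * M) = 2 := by field_simp; norm_num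
  rw [h3, abs_lt] at hk
  have hij : i = j k := by
    have h1 : ((i : ℕ) : ℝ) < (j k : ℕ) + 1 := by linarith
    have h2 : ((j k : ℕ) : ℝ) < (i : ℕ) + 1 := by linarith
    have h1' : (i : ℕ) < (j k : ℕ) + 1 := by exact_mod_cast h1
    have h2' : (j k : ℕ) < (i : ℕ) + 1 := by exact_mod_cast h2
    exact Fin.ext (by omega)
  rw [hij, add_sub_cancel_left, abs_of_nonneg hu0]
  gcongr

variable {I : Problem d} {τ : (Fin d → Fin M) → ℝ}

/-- A covariate is near at most one corner, so at most one summand survives. If the price misses the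
bump there, the revenue is `1 / 2`, whereas the price `τ j` would earn at least `L / (16 M)` more.
-/
lemma sum_indicator_le_optReward_sub (hL0 : 0 ≤ L) (hr : ∀ z, I.reward z = bumpReward L τ z)
    (hτ : ∀ j, τ j ∈ Set.Icc (0 : ℝ) 1) {x : Cov d} (hx : ∀ k, x k ∈ cells M) (p : Price) :
    ∑ j, L / (16 * M) * ((Metric.ball (corner j) (1 / (8 * M))).indicator 1 x -
      (bumpSet j (τ j)).indicator 1 (x, p)) ≤ I.optReward x - I.reward (x, p) := by
  have hopt := reward_le_optReward I x p
  by_cases hex : ∃ j : Fin d → Fin M, x ∈ Metric.ball (corner j) (1 / (8 * M))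
  · obtain ⟨j, hj⟩ := hex
    have hM : (0 : ℝ) ≤ M := Nat.cast_nonneg M
    rw [Finset.sum_eq_single j]
    · rw [Set.indicator_of_mem hj]
      by_cases hp : (x, p) ∈ bumpSet j (τ j)
      · rw [Set.indicator_of_mem hp]
        simp only [Pi.one_apply, sub_self, mul_zero]
        linarith
      · rw [Set.indicator_of_notMem hp]
        have h1 := reward_le_optReward I x ⟨τ j, hτ j⟩
        have h2 : 1 / (16 * (M : ℝ)) ≤ bump j (τ j) (x, ⟨τ j, hτ j⟩) := by
          refine le_trans ?_ (le_max_right _ _)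
          have h3 := dist_corner_le hx hj
          have h4 : max (dist x (corner j)) |τ j - τ j| ≤ 1 / (16 * M) := by
            rw [sub_self, abs_zero]
            exact max_le h3 (by positivity)
          have h5 : 1 / (8 * (M : ℝ)) = 1 / (16 * M) + 1 / (16 * M) := by ring
          change 1 / (16 * (M : ℝ)) ≤ 1 / (8 * M) - max (dist x (corner j)) |τ j - τ j|
          linarith
        have h6 := mul_le_mul_of_nonneg_left h2 hL0
        rw [hr, bumpReward_of_mem_ball τ hj] at h1
        rw [hr, bumpReward_of_mem_ball τ hj, bump_eq_zero hp]
        simp only [Pi.one_apply, sub_zero, mul_one, mul_zero, add_zero]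
        rw [mul_one_div] at h6
        linarith
    · intro j' _ hj'
      have h1 : x ∉ Metric.ball (corner j') (1 / (8 * (M : ℝ))) :=
        fun hc => hj' (eq_of_mem_ball_corner hc hj)
      have h2 : (x, p) ∉ bumpSet j' (τ j') := fun hc => h1 hc.1
      rw [Set.indicator_of_notMem h1, Set.indicator_of_notMem h2]
      simp
    · simp
  · rw [not_exists] at hex
    have h2 : ∀ j, (x, p) ∉ bumpSet j (τ j) := fun j hc => hex j hc.1
    simp only [Set.indicator_of_notMem (hex _), Set.indicator_of_notMem (h2 _)]
    simp only [sub_self, mul_zero, Finset.sum_const_zero]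
    linarith

/-- The regret of one step is at least the probability of missing the bump. -/
lemma sum_le_integral_regret (hL0 : 0 ≤ L) (hr : ∀ z, I.reward z = bumpReward L τ z)
    (hτ : ∀ j, τ j ∈ Set.Icc (0 : ℝ) 1)
    (hcell : ∀ᵐ x ∂I.targetCov, ∀ k, x k ∈ cells M) (π : Policy d nP) (t : ℕ) :
    ∑ j, L / (16 * M) * (I.targetCov.real (Metric.ball (corner j) (1 / (8 * M))) -
      (I.law π (t + 1)).real {h : Hist d nP t × Obs d | h.2.1 ∈ bumpSet j (τ j)}) ≤
    ∫ h : Hist d nP t × Obs d, (I.optReward h.2.1.1 - I.reward h.2.1) ∂(I.law π (t + 1)) := by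
  have hlip : I.LipschitzReward L := fun z z' => by
    rw [hr, hr]; exact abs_bumpReward_sub_le hL0 τ z z'
  have hEm : ∀ j, MeasurableSet {h : Hist d nP t × Obs d | h.2.1 ∈ bumpSet j (τ j)} := fun j =>
    (measurable_fst.comp measurable_snd) (measurableSet_bumpSet j (τ j))
  have hDm : ∀ j : Fin d → Fin M, MeasurableSet
      {h : Hist d nP t × Obs d | h.2.1.1 ∈ Metric.ball (corner j) (1 / (8 * (M : ℝ)))} := fun j =>
    (measurable_fst.comp (measurable_fst.comp measurable_snd)) Metric.isOpen_ball.measurableSet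
  let ν : Measure (Hist d nP t × Obs d) := I.law π (t + 1)
  have hν : IsProbabilityMeasure ν := isProbabilityMeasure_law I π (t + 1)
  have hae : ∀ᵐ h ∂ν, ∀ k, h.2.1.1 k ∈ cells M := by
    have hS : MeasurableSet {x : Cov d | ∀ k, x k ∈ cells M} := by
      have : {x : Cov d | ∀ k, x k ∈ cells M} = Set.univ.pi fun _ => cells M := by
        ext x; simp
      rw [this]
      exact MeasurableSet.univ_pi fun _ => (isClosed_cells M).measurableSet
    have h1 := law_succ_real_fst π t I hS.compl
    have h2 : I.targetCov.real {x : Cov d | ∀ k, x k ∈ cells M}ᶜ = 0 := by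
      rw [measureReal_eq_zero_iff]
      exact hcell
    rw [h2] at h1
    exact (measureReal_eq_zero_iff (measure_ne_top ν _)).1 h1
  have hrm : Measurable I.reward := by
    have : I.reward = bumpReward L τ := funext hr
    rw [this]
    exact measurable_bumpReward hL0 τ
  have hom : Measurable I.optReward := (continuous_optReward hL0 hlip).measurable
  have hdist : ∀ x p, |I.optReward x - I.reward (x, p)| ≤ 1 := by
    intro x p
    rw [abs_of_nonneg (by linarith [reward_le_optReward I x p])]
    have h1 : I.optReward x ≤ 1 := by
      refine ciSup_le fun p => ?_
      calc ∫ y, (y : ℝ) ∂(I.revenue (x, p)) ≤ ∫ _y, (1 : ℝ) ∂(I.revenue (x, p)) :=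
            integral_mono_of_nonneg (.of_forall fun y => y.2.1) (integrable_const 1)
              (.of_forall fun y => y.2.2)
        _ = 1 := by simp
    have h2 : 0 ≤ I.reward (x, p) := integral_nonneg fun y => y.2.1
    linarith
  have hint : Integrable (fun h : Hist d nP t × Obs d => I.optReward h.2.1.1 - I.reward h.2.1) ν :=
    Integrable.of_bound
      ((hom.comp (measurable_fst.comp (measurable_fst.comp measurable_snd))).sub
        (hrm.comp (measurable_fst.comp measurable_snd))).aestronglyMeasurable 1
      (.of_forall fun h => hdist _ _)
  have hi1 : ∀ j : Fin d → Fin M, Integrable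
      ({h : Hist d nP t × Obs d |
        h.2.1.1 ∈ Metric.ball (corner j) (1 / (8 * (M : ℝ)))}.indicator fun _ => (1 : ℝ)) ν :=
    fun j => (integrable_const 1).indicator (hDm j)
  have hi2 : ∀ j, Integrable
      ({h : Hist d nP t × Obs d | h.2.1 ∈ bumpSet j (τ j)}.indicator fun _ => (1 : ℝ)) ν :=
    fun j => (integrable_const 1).indicator (hEm j)
  have hval : ∀ j, L / (16 * M) * (I.targetCov.real (Metric.ball (corner j) (1 / (8 * M))) -
      ν.real {h : Hist d nP t × Obs d | h.2.1 ∈ bumpSet j (τ j)}) =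
      ∫ h, L / (16 * M) * ({h : Hist d nP t × Obs d |
        h.2.1.1 ∈ Metric.ball (corner j) (1 / (8 * (M : ℝ)))}.indicator (fun _ => (1 : ℝ)) h -
        {h : Hist d nP t × Obs d | h.2.1 ∈ bumpSet j (τ j)}.indicator (fun _ => (1 : ℝ)) h) ∂ν := by
    intro j
    rw [integral_const_mul, integral_sub (hi1 j) (hi2 j), integral_indicator_const _ (hDm j),
      integral_indicator_const _ (hEm j), smul_eq_mul, smul_eq_mul, mul_one, mul_one,
      ← law_succ_real_fst π t I Metric.isOpen_ball.measurableSet]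
    rfl
  have hintj : ∀ j : Fin d → Fin M, Integrable (fun h => L / (16 * M) * ({h : Hist d nP t × Obs d |
        h.2.1.1 ∈ Metric.ball (corner j) (1 / (8 * (M : ℝ)))}.indicator (fun _ => (1 : ℝ)) h -
        {h : Hist d nP t × Obs d | h.2.1 ∈ bumpSet j (τ j)}.indicator (fun _ => (1 : ℝ)) h)) ν :=
    fun j => ((hi1 j).sub (hi2 j)).const_mul (L / (16 * M))
  change ∑ j, L / (16 * M) * (I.targetCov.real (Metric.ball (corner j) (1 / (8 * M))) -
      ν.real {h : Hist d nP t × Obs d | h.2.1 ∈ bumpSet j (τ j)}) ≤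
    ∫ h, (I.optReward h.2.1.1 - I.reward h.2.1) ∂ν
  rw [Finset.sum_congr rfl fun j _ => hval j, ← integral_finsetSum _ fun j _ => hintj j]
  refine integral_mono_ae (integrable_finsetSum _ fun j _ => hintj j) hint ?_
  filter_upwards [hae] with h hh
  exact sum_indicator_le_optReward_sub hL0 hr hτ hh h.2.1.2

end Regret

/-! ### Candidate prices -/

section Arms

variable {d M : ℕ}

/-- The candidate prices for the bumps. -/
def arm (M : ℕ) (k : Fin M) : ℝ := (2 * (k : ℕ) + 1) / (8 * M)

lemma le_arm (k : Fin M) : 1 / (8 * M) ≤ arm M k := by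
  unfold arm
  gcongr
  have : (0 : ℝ) ≤ (k : ℕ) := Nat.cast_nonneg _
  linarith

lemma arm_mem_Icc (k : Fin M) : arm M k ∈ Set.Icc (0 : ℝ) 1 := by
  have h1 : ((k : ℕ) : ℝ) + 1 ≤ M := by exact_mod_cast k.2
  have h0 : (0 : ℝ) ≤ (k : ℕ) := Nat.cast_nonneg _
  exact ⟨by unfold arm; positivity, div_le_one_of_le₀ (by linarith) (by linarith)⟩

lemma arm_eq_of_near {p : ℝ} {k k' : Fin M} (h : |p - arm M k| < 1 / (8 * M))
    (h' : |p - arm M k'| < 1 / (8 * M)) : k = k' := by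
  have hM : 0 < M := (Nat.zero_le _).trans_lt k.2
  have hM0 : (0 : ℝ) < 8 * M := by positivity
  have e : ∀ i : Fin M, |p - arm M i| < 1 / (8 * M) →
      |8 * M * p - (2 * (i : ℕ) + 1)| < 1 := by
    intro i hi
    have h1 : 8 * M * p - (2 * (i : ℕ) + 1) = 8 * M * (p - arm M i) := by
      unfold arm; field_simp
    rw [h1, abs_mul, abs_of_pos hM0]
    rwa [lt_div_iff₀' hM0] at hi
  have h1 := abs_lt.1 (e k h)
  have h2 := abs_lt.1 (e k' h')
  have h3 : ((k : ℕ) : ℝ) < (k' : ℕ) + 1 := by linarith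
  have h4 : ((k' : ℕ) : ℝ) < (k : ℕ) + 1 := by linarith
  have h3' : (k : ℕ) < (k' : ℕ) + 1 := by exact_mod_cast h3
  have h4' : (k' : ℕ) < (k : ℕ) + 1 := by exact_mod_cast h4
  exact Fin.ext (by omega)

lemma sum_measureReal_bumpSet_le (m : Measure (Cov d × Price)) [IsFiniteMeasure m]
    (j : Fin d → Fin M) : ∑ k, m.real (bumpSet j (arm M k)) ≤
      m.real (Prod.fst ⁻¹' Metric.ball (corner j) (1 / (8 * M))) := by
  rw [← measureReal_biUnion_finset]
  · refine measureReal_mono (Set.iUnion₂_subset fun k _ z hz => hz.1)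
  · intro k _ k' _ hne
    refine Set.disjoint_left.2 fun z hz hz' => hne (arm_eq_of_near hz.2 hz'.2)
  · exact fun k _ => measurableSet_bumpSet j _

/-- Exchanging the value at `j` with the spare value `k` is an involution of `(α → β) × β`. This
lets an average over all configurations be taken as an average over one coordinate first. -/
lemma sum_update_eq {α β R : Type*} [Fintype α] [DecidableEq α] [Fintype β] [Semiring R]
    (F : (α → β) → R) (j : α) :
    ∑ σ : α → β, ∑ k, F (Function.update σ j k) = Fintype.card β * ∑ σ, F σ := by
  obtain ⟨e, he⟩ : ∃ e : (α → β) × β ≃ (α → β) × β, ∀ q, (e q).1 = Function.update q.1 j q.2 :=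
    ⟨{ toFun := fun q => (Function.update q.1 j q.2, q.1 j)
       invFun := fun q => (Function.update q.1 j q.2, q.1 j)
       left_inv := fun q => by simp
       right_inv := fun q => by simp }, fun _ => rfl⟩
  calc ∑ σ : α → β, ∑ k, F (Function.update σ j k)
      = ∑ q : (α → β) × β, F (Function.update q.1 j q.2) :=
        (Fintype.sum_prod_type fun q : (α → β) × β => F (Function.update q.1 j q.2)).symm
    _ = ∑ q : (α → β) × β, F (e q).1 := by simp only [he]
    _ = ∑ q : (α → β) × β, F q.1 := Equiv.sum_comp e fun q => F q.1
    _ = ∑ σ : α → β, ∑ _k : β, F σ := Fintype.sum_prod_type fun q : (α → β) × β => F q.1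
    _ = _ := by simp [Finset.mul_sum]

end Arms

/-! ### Averaging over the positions of the bumps -/

section Averaging

variable {d nP M : ℕ} {L : ℝ} (Q : Measure (Cov d)) [IsProbabilityMeasure Q]
  (μ : Measure (Cov d × Price)) [IsProbabilityMeasure μ]

/-- The Bernoulli problem with a bump at price `τ j` near each cell `j`. -/
def bumpProblem (hM : 1 ≤ M) (hL0 : 0 ≤ L) (hL1 : L ≤ 1) (τ : (Fin d → Fin M) → ℝ) : Problem d :=
  bernoulliProblem Q μ (bumpReward L τ) (measurable_bumpReward hL0 τ)
    (bumpReward_mem_Icc hL0 hL1 τ hM)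

variable (hM : 1 ≤ M) (hL0 : 0 ≤ L) (hL1 : L ≤ 1) {q s T : ℝ}

/-- The neighbourhoods of the arms are disjoint and lie over the same ball of covariates, so one
step hits them with total probability at most `q`. Applied to the reference problem, which does not
depend on the arm, this gains the factor `1 / M`. -/
lemma sum_law_bumpSet_le_of_eq {j : Fin d → Fin M}
    (hq : Q.real (Metric.ball (corner j) (1 / (8 * M))) = q)
    (I : Problem d) (hI : I.targetCov = Q) (π : Policy d nP) (t : ℕ) :
    ∑ k, (I.law π (t + 1)).real {h : Hist d nP t × Obs d | h.2.1 ∈ bumpSet j (arm M k)} ≤ q := by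
  subst hI
  simp only [law_succ_real π t I (measurableSet_bumpSet j _)]
  have hint : ∀ k, Integrable (fun h => (pairKernel I.targetCov π t h).real (bumpSet j (arm M k)))
      (I.law π t) := fun k =>
    Integrable.of_bound
      (measurable_pairKernel_real _ π t (measurableSet_bumpSet j _)).aestronglyMeasurable 1
      (.of_forall fun h => by
        rw [Real.norm_of_nonneg measureReal_nonneg]; exact measureReal_le_one)
  rw [← integral_finsetSum _ fun k _ => hint k]
  calc _ ≤ ∫ _h, q ∂(I.law π t) := by
        refine integral_mono (integrable_finsetSum _ fun k _ => hint k) (integrable_const q)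
          fun h => ?_
        refine (sum_measureReal_bumpSet_le _ j).trans_eq ?_
        rw [pairKernel_real_fst _ π t h Metric.isOpen_ball.measurableSet, hq]
    _ = q := by simp

/-- Averaged over the price of the bump of one cell, the policy finds the bump of this cell in at
most half of its visits. -/
lemma sum_law_bumpSet_le (j : Fin d → Fin M)
    (hq : Q.real (Metric.ball (corner j) (1 / (8 * M))) = q)
    (hs : ∀ k, μ.real (bumpSet j (arm M k)) ≤ s)
    (hnum : 1 + 8 * (4 * (L / (8 * M)) ^ 2 * (nP * (M * s) + T * q)) + M / 8 ≤ M / 2)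
    (τ : (Fin d → Fin M) → ℝ) (π : Policy d nP) (t : ℕ) (ht : t ≤ T) :
    ∑ k, ((bumpProblem Q μ hM hL0 hL1 (Function.update τ j (arm M k))).law π (t + 1)).real
      {h : Hist d nP t × Obs d | h.2.1 ∈ bumpSet j (arm M k)} ≤ M * (q / 2) := by
  have hM' : (1 : ℝ) ≤ M := by exact_mod_cast hM
  have hq0 : 0 ≤ q := hq ▸ measureReal_nonneg
  set I₀ := bumpProblem Q μ hM hL0 hL1 (Function.update τ j (-1)) with hI₀
  set δ := L / (8 * M) with hδ
  have hδ0 : 0 ≤ δ := by positivity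
  have hδ1 : δ ≤ 1 / 4 := by
    rw [hδ, div_le_div_iff₀ (by positivity) (by norm_num)]
    linarith
  have hstep : ∀ k,
      ((bumpProblem Q μ hM hL0 hL1 (Function.update τ j (arm M k))).law π (t + 1)).real
        {h : Hist d nP t × Obs d | h.2.1 ∈ bumpSet j (arm M k)} ≤
      (I₀.law π (t + 1)).real {h : Hist d nP t × Obs d | h.2.1 ∈ bumpSet j (arm M k)} +
      q * (8 * (4 * δ ^ 2 * (nP * s + ∑ r ∈ Finset.range t,
        (I₀.law π (r + 1)).real {h : Hist d nP r × Obs d | h.2.1 ∈ bumpSet j (arm M k)})) +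
        1 / 8) := by
    intro k
    have hB := measurableSet_bumpSet j (arm M k)
    have hout : ∀ z ∉ bumpSet j (arm M k), bumpReward L (Function.update τ j (arm M k)) z =
        bumpReward L (Function.update τ j (-1)) z := fun z hz =>
      bumpReward_update_eq τ j hz (by rw [bumpSet_neg_one hM]; exact Set.notMem_empty z)
    have hin : ∀ z ∈ bumpSet j (arm M k), bumpReward L (Function.update τ j (-1)) z = 1 / 2 ∧
        |bumpReward L (Function.update τ j (arm M k)) z - 1 / 2| ≤ δ := by
      rintro ⟨x, p⟩ hz
      constructor
      · rw [bumpReward_of_mem_ball _ hz.1, Function.update_self, bump_eq_zero, mul_zero, add_zero]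
        have : (x, p) ∉ bumpSet j (-1) := by rw [bumpSet_neg_one hM]; exact Set.notMem_empty _
        exact this
      · have h1 := half_le_bumpReward hL0 (Function.update τ j (arm M k)) (x, p)
        have h2 := bumpReward_le hL0 (Function.update τ j (arm M k)) (x, p)
        rw [abs_of_nonneg (by linarith)]
        linarith
    -- The statistic is the conditional probability that the next pair hits the bump. It is at most
    -- `q`, so the error of the change of measure is proportional to `q`. The choice `β = 8` makes
    -- its fixed part `q / 8`.
    have hle := integral_law_bernoulli_le (Q := Q) (μ := μ)
      (measurable_bumpReward hL0 (Function.update τ j (-1)))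
      (measurable_bumpReward hL0 (Function.update τ j (arm M k)))
      (bumpReward_mem_Icc hL0 hL1 _ hM) (bumpReward_mem_Icc hL0 hL1 _ hM) hout hin hB hδ0 hδ1
      π t (measurable_pairKernel_real Q π t hB) (fun _ => measureReal_nonneg) hq0
      (fun h => by
        rw [← hq, ← pairKernel_real_fst Q π t h Metric.isOpen_ball.measurableSet]
        exact measureReal_mono fun z hz => hz.1) (β := 8) (by norm_num)
    rw [law_succ_real π t _ hB, law_succ_real π t _ hB]
    refine hle.trans ?_
    have := hs k
    gcongr
    exacts [le_rfl, le_rfl]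
  have h0 : ∀ r, ∑ k, (I₀.law π (r + 1)).real
      {h : Hist d nP r × Obs d | h.2.1 ∈ bumpSet j (arm M k)} ≤ q := fun r =>
    sum_law_bumpSet_le_of_eq Q hq I₀ rfl π r
  refine (Finset.sum_le_sum fun k _ => hstep k).trans ?_
  have hsum : ∑ k : Fin M, q * (8 * (4 * δ ^ 2 * (nP * s + ∑ r ∈ Finset.range t,
        (I₀.law π (r + 1)).real {h : Hist d nP r × Obs d | h.2.1 ∈ bumpSet j (arm M k)})) +
        1 / 8) = q * (8 * (4 * δ ^ 2 * (nP * (M * s) + ∑ r ∈ Finset.range t, ∑ k,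
        (I₀.law π (r + 1)).real {h : Hist d nP r × Obs d | h.2.1 ∈ bumpSet j (arm M k)})) +
        M / 8) := by
    rw [Finset.sum_comm (s := Finset.range t), ← Finset.mul_sum, Finset.sum_add_distrib,
      ← Finset.mul_sum, ← Finset.mul_sum, Finset.sum_add_distrib]
    simp only [Finset.sum_const, Finset.card_univ, Fintype.card_fin, nsmul_eq_mul]
    ring
  rw [Finset.sum_add_distrib, hsum]
  have h1 : ∑ r ∈ Finset.range t, ∑ k,
      (I₀.law π (r + 1)).real {h : Hist d nP r × Obs d | h.2.1 ∈ bumpSet j (arm M k)} ≤ T * q := by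
    calc _ ≤ ∑ _r ∈ Finset.range t, q := Finset.sum_le_sum fun r _ => h0 r
      _ = t * q := by simp
      _ ≤ T * q := by gcongr
  calc _ ≤ q + q * (8 * (4 * δ ^ 2 * (nP * (M * s) + T * q)) + M / 8) := by
        gcongr
        exact h0 t
    _ = q * (1 + 8 * (4 * δ ^ 2 * (nP * (M * s) + T * q)) + M / 8) := by ring
    _ ≤ q * (M / 2) := by gcongr
    _ = M * (q / 2) := by ring

/-- Some choice of the bumps makes the regret large. -/
lemma exists_regret_ge (hcell : ∀ᵐ x ∂Q, ∀ k, x k ∈ cells M)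
    (hq : ∀ j : Fin d → Fin M, Q.real (Metric.ball (corner j) (1 / (8 * M))) = q)
    (hqM : (M : ℝ) ^ d * q = 1)
    (hs : ∀ (j : Fin d → Fin M) k, μ.real (bumpSet j (arm M k)) ≤ s) (nQ : ℕ)
    (hnum : 1 + 8 * (4 * (L / (8 * M)) ^ 2 * (nP * (M * s) + nQ * q)) + M / 8 ≤ M / 2)
    (π : Policy d nP) :
    ∃ σ : (Fin d → Fin M) → Fin M,
      nQ * (L / (32 * M)) ≤ (bumpProblem Q μ hM hL0 hL1 fun j => arm M (σ j)).regret π nQ := by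
  have hM' : (1 : ℝ) ≤ M := by exact_mod_cast hM
  have hM0 : (0 : ℝ) < M := by linarith
  have : Nonempty (Fin M) := ⟨⟨0, hM⟩⟩
  set G : ((Fin d → Fin M) → Fin M) → ℕ → (Fin d → Fin M) → ℝ := fun σ t j =>
    ((bumpProblem Q μ hM hL0 hL1 fun j => arm M (σ j)).law π (t + 1)).real
      {h : Hist d nP t × Obs d | h.2.1 ∈ bumpSet j (arm M (σ j))} with hG
  set N : ℝ := ((Fintype.card ((Fin d → Fin M) → Fin M) : ℕ) : ℝ) with hN
  have havg : ∀ t ∈ Finset.range nQ, ∀ j, ∑ σ, G σ t j ≤ N * (q / 2) := by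
    intro t ht j
    have h1 : ∀ σ : (Fin d → Fin M) → Fin M,
        ∑ k, G (Function.update σ j k) t j ≤ M * (q / 2) := by
      intro σ
      refine le_trans (le_of_eq ?_) (sum_law_bumpSet_le Q μ hM hL0 hL1 j (hq j) (hs j) hnum
        (fun j => arm M (σ j)) π t (by exact_mod_cast (Finset.mem_range.1 ht).le))
      refine Finset.sum_congr rfl fun k _ => ?_
      have h2 : (fun j' => arm M (Function.update σ j k j')) =
          Function.update (fun j' => arm M (σ j')) j (arm M k) := by
        funext j'
        by_cases h : j' = j
        · subst h; simp
        · simp [h]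
      simp only [hG]
      rw [h2, Function.update_self]
    -- The bound holds for every position of the other bumps, so averaging over the bump of cell `j`
    -- gives the average over all configurations.
    have h3 := sum_update_eq (fun σ => G σ t j) j
    have h4 := Finset.sum_le_sum fun σ (_ : σ ∈ Finset.univ) => h1 σ
    rw [h3, Finset.sum_const, Finset.card_univ, nsmul_eq_mul, Fintype.card_fin, ← hN,
      mul_left_comm] at h4
    exact le_of_mul_le_mul_left h4 hM0
  have hreg : ∀ σ : (Fin d → Fin M) → Fin M, ∑ t ∈ Finset.range nQ, ∑ j,
      L / (16 * M) * (q - G σ t j) ≤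
      (bumpProblem Q μ hM hL0 hL1 fun j => arm M (σ j)).regret π nQ := by
    intro σ
    refine Finset.sum_le_sum fun t _ => ?_
    have := sum_le_integral_regret (I := bumpProblem Q μ hM hL0 hL1 fun j => arm M (σ j)) hL0
      (fun z => reward_bernoulliProblem _ _ z) (fun j => arm_mem_Icc (σ j)) hcell π t
    refine le_trans (le_of_eq ?_) this
    refine Finset.sum_congr rfl fun j _ => ?_
    rw [← hq j]
    rfl
  obtain ⟨σ, -, hσ⟩ := Finset.exists_le_of_sum_le (s := Finset.univ)
    (f := fun _ : (Fin d → Fin M) → Fin M => nQ * (L / (32 * M)))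
    (g := fun σ => (bumpProblem Q μ hM hL0 hL1 fun j => arm M (σ j)).regret π nQ)
    Finset.univ_nonempty (by
      refine le_trans ?_ (Finset.sum_le_sum fun σ _ => hreg σ)
      rw [Finset.sum_comm]
      calc ∑ _σ : (Fin d → Fin M) → Fin M, (nQ : ℝ) * (L / (32 * M))
          = ∑ _t ∈ Finset.range nQ, N * (L / (32 * M)) := by
            simp only [Finset.sum_const, Finset.card_univ, Finset.card_range, nsmul_eq_mul, ← hN]
            ring
        _ ≤ _ := Finset.sum_le_sum fun t ht => ?_
      rw [Finset.sum_comm]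
      calc N * (L / (32 * M)) = ∑ _j : Fin d → Fin M, L / (16 * M) * (N * q - N * (q / 2)) := by
            have hcard : (Fintype.card (Fin d → Fin M) : ℝ) = (M : ℝ) ^ d := by simp
            rw [Finset.sum_const, Finset.card_univ, nsmul_eq_mul, hcard]
            have e : (M : ℝ) ^ d * (L / (16 * M) * (N * q - N * (q / 2))) =
                (M : ℝ) ^ d * q * (L / (16 * M) * (N / 2)) := by ring
            rw [e, hqM]
            field_simp
            ring
        _ ≤ ∑ j, ∑ σ, L / (16 * M) * (q - G σ t j) := Finset.sum_le_sum fun j _ => by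
            rw [← Finset.mul_sum, Finset.sum_sub_distrib, Finset.sum_const, Finset.card_univ,
              nsmul_eq_mul, ← hN]
            have := havg t ht j
            gcongr)
  exact ⟨σ, hσ⟩

end Averaging

/-! ### Membership in the class and choice of `M` -/

section Rate

open unitInterval

variable {n M : ℕ} {γ κ L : ℝ}

lemma ball_corner_prodLaw_real {P Q : Measure I} [IsProbabilityMeasure P]
    [IsProbabilityMeasure Q] (hM : 0 < M) {a : ℝ}
    (hP : ∀ i : Fin M, P.real (Metric.ball (pos M (8 * (i : ℕ))) (1 / (8 * M))) = a / M)
    (hQ : ∀ i : Fin M, Q.real (Metric.ball (pos M (8 * (i : ℕ))) (1 / (8 * M))) = 1 / M)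
    (j : Fin (n + 1) → Fin M) :
    (prodLaw n P Q).real (Metric.ball (corner j) (1 / (8 * M))) = a * (1 / M) ^ (n + 1) := by
  have hM' : (0 : ℝ) < M := by exact_mod_cast hM
  rw [prodLaw_real_ball _ (by positivity)]
  simp only [corner, hP, hQ, Finset.prod_const, Finset.card_univ, Fintype.card_fin]
  rw [pow_succ']
  ring

/-- Every arm is at least `1 / (8 M)`, so the price `0` lies outside the open neighbourhood and the
atom of the price law reveals nothing. -/
lemma prod_priceLaw_bumpSet_le {d : ℕ} (h0 : 0 ≤ κ) (h1 : κ ≤ 1) (P : Measure (Cov d))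
    [IsProbabilityMeasure P] (j : Fin d → Fin M) (k : Fin M) :
    (P.prod (priceLaw κ)).real (bumpSet j (arm M k)) ≤
      P.real (Metric.ball (corner j) (1 / (8 * M))) * (κ * (1 / (4 * M))) := by
  have := isProbabilityMeasure_priceLaw h0 h1
  rw [bumpSet, measureReal_prod_prod, priceLaw_real h0 h1 (measurableSet_arm M _),
    Set.indicator_of_notMem, mul_zero, add_zero]
  · have hvol : (volume : Measure I).real {p : Price | |(p : ℝ) - arm M k| < 1 / (8 * M)} ≤
        1 / (4 * M) := by
      have hsub : {p : Price | |(p : ℝ) - arm M k| < 1 / (8 * M)} ⊆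
          {p : Price | |(p : ℝ) - arm M k| ≤ 1 / (8 * M)} := fun p hp =>
        le_of_lt (Set.mem_ofPred_eq.mp hp)
      calc _ ≤ (volume : Measure I).real {p : I | |(p : ℝ) - arm M k| ≤ 1 / (8 * M)} :=
            measureReal_mono hsub
        _ ≤ 2 * (1 / (8 * M)) := volume_real_abs_sub_le_le _ _ (by positivity)
        _ = 1 / (4 * M) := by ring
    gcongr
  · rw [Set.mem_ofPred_eq, Set.Icc.coe_zero, zero_sub, abs_neg,
      abs_of_nonneg (arm_mem_Icc k).1, not_lt]
    exact le_arm k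

/-- The lower bound for problems with `M` cells in each direction. -/
lemma exists_inClass_regret_ge {cγ CLip cQ : ℝ} (hcγ1 : cγ ≤ 1) (hcQ1 : cQ ≤ 1)
    (hL0 : 0 ≤ L) (hL1 : L ≤ 1) (hL : L ≤ CLip) (hM : 32 ≤ M) (hγ : 0 ≤ γ) (hκ0 : 0 ≤ κ)
    (hκ1 : κ ≤ 1) {nP : ℕ} (nQ : ℕ) (hnQ : (nQ : ℝ) ≤ (M : ℝ) ^ (n + 4) / 4)
    (hnP : κ * nP * (16 / M) ^ γ ≤ (M : ℝ) ^ (n + 4) / 4) (π : Policy (n + 1) nP) :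
    ∃ J : Problem (n + 1), InClass γ cγ κ CLip cQ J ∧ nQ * (L / (32 * M)) ≤ J.regret π nQ := by
  have hM' : (32 : ℝ) ≤ M := by exact_mod_cast hM
  have hM0 : (0 : ℝ) < M := by linarith
  have hM1 : 1 ≤ M := by omega
  have hMne : M ≠ 0 := by omega
  obtain ⟨ψ, hψ, hpair⟩ := isTransferPair_cellLaw hM hγ
  set A : ℝ := (16 / M) ^ γ with hA
  have hA0 : 0 ≤ A := by positivity
  have hA1 : A ≤ 1 :=
    Real.rpow_le_one (by positivity) ((div_le_one hM0).2 (by linarith)) hγ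
  have hP := isProbabilityMeasure_cellLaw hMne hA0 hA1 hψ
  have hQ := isProbabilityMeasure_cellLaw (M := M) hMne zero_le_one le_rfl measurable_id
  have hν := isProbabilityMeasure_priceLaw hκ0 hκ1
  set P := cellLaw M A ψ
  set Q := cellLaw M 1 id
  have hcell : ∀ᵐ x ∂(prodLaw n Q Q), ∀ k, x k ∈ cells M := by
    rw [ae_all_iff]
    intro k
    have h : (Fin.cons (α := fun _ => Measure I) Q (fun _ => Q) k : Measure I) (cells M)ᶜ = 0 :=
      Fin.cases hpair.compl_eq_zero (fun _ => hpair.compl_eq_zero) k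
    exact Measure.pi_eval_preimage_null _ h
  have hballQ : ∀ i : Fin M,
      Q.real (Metric.ball (pos M (8 * (i : ℕ))) (1 / (8 * M))) = 1 / M :=
    fun i => cellLaw_real_ball hMne zero_le_one le_rfl measurable_id i
  have hballP : ∀ i : Fin M,
      P.real (Metric.ball (pos M (8 * (i : ℕ))) (1 / (8 * M))) = A / M :=
    fun i => cellLaw_real_ball hMne hA0 hA1 hψ i
  set q : ℝ := (1 / M) ^ (n + 1) with hqdef
  have hq0 : 0 ≤ q := by positivity
  have hq : ∀ j : Fin (n + 1) → Fin M,
      (prodLaw n Q Q).real (Metric.ball (corner j) (1 / (8 * M))) = q := fun j => by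
    rw [ball_corner_prodLaw_real hM1 (a := 1) hballQ hballQ j, one_mul]
  have hqM : (M : ℝ) ^ (n + 1) * q = 1 := by
    rw [hqdef, ← mul_pow, mul_one_div_cancel hM0.ne', one_pow]
  have hs : ∀ (j : Fin (n + 1) → Fin M) (k : Fin M),
      ((prodLaw n P Q).prod (priceLaw κ)).real (bumpSet j (arm M k)) ≤
        A * q * (κ * (1 / (4 * M))) := fun j k => by
    have := prod_priceLaw_bumpSet_le hκ0 hκ1 (prodLaw n P Q) j k
    rwa [ball_corner_prodLaw_real hM1 hballP hballQ j] at this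
  have hnum : 1 + 8 * (4 * (L / (8 * M)) ^ 2 * (nP * (M * (A * q * (κ * (1 / (4 * M))))) +
      nQ * q)) + M / 8 ≤ M / 2 := by
    have hpow : (M : ℝ) ^ (n + 4) * q = M ^ 3 := by
      calc (M : ℝ) ^ (n + 4) * q = M ^ 3 * ((M : ℝ) ^ (n + 1) * q) := by ring
        _ = M ^ 3 := by rw [hqM, mul_one]
    have h1 : nP * (M * (A * q * (κ * (1 / (4 * M))))) + nQ * q ≤ M ^ 3 / 2 := by
      have e : nP * (M * (A * q * (κ * (1 / (4 * M))))) = κ * nP * A * q / 4 := by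
        field_simp
      have h2 := mul_le_mul_of_nonneg_right hnP hq0
      have h3 := mul_le_mul_of_nonneg_right hnQ hq0
      have h4 : (M : ℝ) ^ (n + 4) / 4 * q = M ^ 3 / 4 := by rw [div_mul_eq_mul_div, hpow]
      rw [h4] at h2 h3
      have h5 : 0 ≤ κ * nP * A * q := by positivity
      rw [e]
      linarith
    have h2 : (L / (8 * M)) ^ 2 ≤ (1 / (8 * M)) ^ 2 := by gcongr
    have h3 : 8 * (4 * (L / (8 * M)) ^ 2 * (nP * (M * (A * q * (κ * (1 / (4 * M))))) +
        nQ * q)) ≤ 8 * (4 * (1 / (8 * M)) ^ 2 * ((M : ℝ) ^ 3 / 2)) := by gcongr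
    -- The budget `M / 2` accommodates this `M / 4`, the `M / 8` from the change of measure, and `1
    -- ≤ M / 32`.
    have h4 : 8 * (4 * (1 / (8 * (M : ℝ))) ^ 2 * ((M : ℝ) ^ 3 / 2)) = M / 4 := by
      field_simp
      norm_num
    linarith
  obtain ⟨w, hw⟩ := exists_regret_ge (prodLaw n Q Q) ((prodLaw n P Q).prod (priceLaw κ)) hM1 hL0
    hL1 hcell hq hqM hs nQ hnum π
  -- Membership in the class does not depend on where the bumps are.
  refine ⟨_, ?_, hw⟩
  have hfst : ((prodLaw n P Q).prod (priceLaw κ)).fst = prodLaw n P Q := Measure.fst_prod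
  constructor
  · change transferExponent ((prodLaw n P Q).prod (priceLaw κ)).fst (prodLaw n Q Q) = _
    rw [hfst]
    exact hpair.transferExponent_eq hγ
  · change TransferBound ((prodLaw n P Q).prod (priceLaw κ)).fst (prodLaw n Q Q) γ cγ
    rw [hfst]
    exact hpair.transferBound hcγ1
  · exact explorationCoeff_prod hκ0 hκ1 _
  · intro z z'
    rw [bumpProblem, reward_bernoulliProblem, reward_bernoulliProblem]
    exact (abs_bumpReward_sub_le hL0 _ z z').trans (by gcongr)
  · exact hpair.ballMassCondition hcQ1

/-- The number of cells that matches the sample sizes. -/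
lemma exists_cell_number {D γ x y : ℝ} (hD : 1 ≤ D) (hγ : 0 ≤ γ) (hx : 1 ≤ x) (hy : 0 ≤ y) :
    ∃ M : ℕ, 32 ≤ M ∧ x ≤ (M : ℝ) ^ D / 4 ∧ y * (16 / M) ^ γ ≤ (M : ℝ) ^ D / 4 ∧
      (M : ℝ)⁻¹ ≥ (x + y ^ (D / (D + γ))) ^ (-(1 / D)) / 64 := by
  have hD0 : 0 < D := by linarith
  have hDγ : 0 < D + γ := by linarith
  set X := y ^ (D / (D + γ)) with hX
  have hX0 : 0 ≤ X := Real.rpow_nonneg hy _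
  set S := x + X with hS
  have hS1 : 1 ≤ S := by linarith
  have hS0 : 0 ≤ S := by linarith
  set T := S ^ (1 / D) with hT
  have hT1 : 1 ≤ T := Real.one_le_rpow hS1 (by positivity)
  have hT0 : 0 < T := by linarith
  have hTD : T ^ D = S := by
    rw [hT, ← Real.rpow_mul hS0, one_div_mul_cancel hD0.ne', Real.rpow_one]
  -- The factor `32` yields `32 ≤ M`, as `T ≥ 1`, and absorbs the `4` through `32 ^ D ≥ 32`.
  set M := ⌈32 * T⌉₊ with hM
  have hM1 : 32 * T ≤ M := Nat.le_ceil _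
  have hM2 : (M : ℝ) < 32 * T + 1 := Nat.ceil_lt_add_one (by positivity)
  have hM32 : (32 : ℝ) ≤ M := by linarith
  have hM0 : (0 : ℝ) < M := by linarith
  have hTM : T ≤ M / 32 := by rw [le_div_iff₀ (by norm_num)]; linarith
  have h32 : (32 : ℝ) ≤ 32 ^ D := by
    simpa using Real.rpow_le_rpow_of_exponent_le (by norm_num : (1 : ℝ) ≤ 32) hD
  have hMD : ((M : ℝ) / 32) ^ D ≤ (M : ℝ) ^ D / 4 := by
    rw [Real.div_rpow hM0.le (by norm_num)]
    have : (0 : ℝ) ≤ (M : ℝ) ^ D := by positivity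
    gcongr
    linarith
  refine ⟨M, by exact_mod_cast hM32, ?_, ?_, ?_⟩
  · calc x ≤ S := by linarith
      _ = T ^ D := hTD.symm
      _ ≤ ((M : ℝ) / 32) ^ D := by gcongr
      _ ≤ _ := hMD
  · have hyT : y ≤ ((M : ℝ) / 32) ^ (D + γ) := by
      calc y = X ^ ((D + γ) / D) := by
            rw [hX, ← Real.rpow_mul hy, div_mul_div_cancel₀ hDγ.ne', div_self hD0.ne',
              Real.rpow_one]
        _ ≤ S ^ ((D + γ) / D) := by gcongr; linarith
        _ = T ^ (D + γ) := by
            rw [hT, ← Real.rpow_mul hS0]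
            congr 1
            ring
        _ ≤ _ := by gcongr
    -- The product `(M / 32) * (16 / M) = 1 / 2` is at most one, so the power `γ` costs nothing and
    -- the constant does not depend on `γ`.
    calc y * (16 / M) ^ γ ≤ ((M : ℝ) / 32) ^ (D + γ) * (16 / M) ^ γ := by gcongr
      _ = ((M : ℝ) / 32) ^ D * (1 / 2) ^ γ := by
          rw [Real.rpow_add (by positivity), mul_assoc, ← Real.mul_rpow (by positivity)
            (by positivity)]
          congr 2
          field_simp
          norm_num
      _ ≤ ((M : ℝ) / 32) ^ D * 1 := by
          gcongr
          exact Real.rpow_le_one (by norm_num) (by norm_num) hγ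
      _ ≤ _ := by rw [mul_one]; exact hMD
  · rw [Real.rpow_neg hS0, ← hT, div_eq_mul_inv, ← mul_inv, ge_iff_le]
    gcongr
    linarith

end Rate

end DynamicPricing

end

theorem theorem2 (CLip cγ cQ : ℝ) (hCLip : 0 < CLip) (hcγ : 0 < cγ) (hcγ1 : cγ ≤ 1)
    (hcQ : 0 < cQ) (hcQ1 : cQ ≤ 1) :
    ∃ c : ℝ, 0 < c ∧
      ∀ (d nP nQ : ℕ) (γ κ : ℝ), 1 ≤ d → 1 ≤ nQ → 0 ≤ γ → 0 ≤ κ → κ ≤ 1 →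
        ((c * (nQ : ℝ) *
            ((nQ : ℝ) + (κ * (nP : ℝ)) ^ (((d : ℝ) + 3) / ((d : ℝ) + 3 + γ))) ^
              (-(1 / ((d : ℝ) + 3))) : ℝ) : EReal) ≤
          DynamicPricing.minimaxRegret d nP nQ γ cγ κ CLip cQ := by
  have hL : 0 < min CLip 1 := lt_min hCLip one_pos
  -- Here `2048 = 32 * 64`: the regret per step is at least `L / (32 M)`, and `M` is at most `64`
  -- times the inverse rate. The slope `L = min CLip 1` is also capped at `1`, which keeps the mean
  -- revenues in `[0, 1]`.
  refine ⟨min CLip 1 / 2048, by positivity, ?_⟩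
  intro d nP nQ γ κ hd hnQ hγ hκ0 hκ1
  obtain ⟨n, rfl⟩ : ∃ n, d = n + 1 := ⟨d - 1, by omega⟩
  have hnQ' : (1 : ℝ) ≤ nQ := by exact_mod_cast hnQ
  have hcast : (((n + 1 : ℕ) : ℝ) + 3) = ((n + 4 : ℕ) : ℝ) := by push_cast; ring
  have hD : (1 : ℝ) ≤ ((n + 4 : ℕ) : ℝ) := by push_cast; linarith [(Nat.cast_nonneg n : (0 : ℝ) ≤ n)]
  obtain ⟨M, hM, h1, h2, h3⟩ := DynamicPricing.exists_cell_number hD hγ hnQ'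
    (mul_nonneg hκ0 (Nat.cast_nonneg nP))
  rw [Real.rpow_natCast] at h1 h2
  rw [hcast]
  refine le_iInf fun π => ?_
  obtain ⟨I, hI, hreg⟩ := DynamicPricing.exists_inClass_regret_ge hcγ1 hcQ1 hL.le
    (min_le_right CLip 1) (min_le_left CLip 1) hM hγ hκ0 hκ1 nQ h1 h2 π
  refine le_iSup_of_le (⟨I, hI⟩ : {I // DynamicPricing.InClass γ cγ κ CLip cQ I}) ?_
  refine EReal.coe_le_coe_iff.2 (le_trans ?_ hreg)
  have h4 : (nQ : ℝ) * (min CLip 1 / (32 * M)) = min CLip 1 / 32 * nQ * (M : ℝ)⁻¹ := by ring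
  rw [h4]
  refine le_trans (le_of_eq ?_) (mul_le_mul_of_nonneg_left h3 (by positivity))
  ring
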